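/- Setting. Let $\mathcal X$ be a finite linearly ordered set, $\mathcal Y=\{0,1\}^n$, $\mathcal T$ a finite set, and $f:\mathcal X\times\mathcal Y\to\mathcal T$ any function. Put $$\Gamma=\max_{x,t}\bigl|\{y: f(x,y)=t\}\bigr|,\qquad \Gamma'=\max_{x\ne x',\,y'}\bigl|\{y: f(x,y)=f(x',y')\}\bigr|$$ (a maximum over the empty set is $0$). The simulator $\mathcal S$. It holds a register $D=(D_x)_{x\in\mathcal X}$, where $D_x$ has orthonormal basis $\{|y\rangle: y\in\mathcal Y\cup\{\bot\}\}$, initially in the state $\bigotimes_x|\bot\rangle$. With $|\phi_\eta\rangle=2^{-n/2}\sum_y(-1)^{\eta\cdot y}|y\rangle$, let $F$ be the unitary that exchanges $|\bot\rangle$ and $|\phi_0\rangle$ and fixes $|\phi_\eta\rangle$ for $\eta\neq0$. * $\mathcal S.RO$ applies to the query registers $X,Y$ and to $D$ the unitary $O=\sum_x|x\rangle\langle x|_X\otimes F_{D_x}\mathrm{CNOT}_{YD_x}F_{D_x}$, where $\mathrm{CNOT}|y\rangle|u\rangle=|y\oplus u\rangle|u\rangle$ for $u\in\mathcal Y$ and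 $\mathrm{CNOT}|y\rangle|\bot\rangle=|y\rangle|\bot\rangle$. A classical query on $x$ is a query with registers $XY$ in state $|x\rangle|0\rangle$, after which $Y$ is measured to give the response $h$. * $\mathcal S.E$, on a classical input $t\in\mathcal T$, performs on $D$ the projective measurement with outcome $\hat x\in\mathcal X\cup\{\emptyset\}$ that, in the basis $\{|\mathbf y\rangle\}$ of $D$, returns the smallest $x$ with $y_x\ne\bot$ and $f(x,y_x)=t$, and $\emptyset$ if there is none. The algorithm. Let $\mathcal A$ be a quantum oracle algorithm with finite-dimensional registers, which makes at most $q$ (superposition) oracle queries, announces classical values $t_1,\dots,t_\ell\in\mathcal T$ in this order at arbitrary points of its run, and at the end outputs classical $x_1,\dots,x_\ell\in\mathcal X\cup\{\bot\}$ and a quantum register $W$. * In the real run $\mathcal A^{RO}$, queries are answered by the unitary $|x\rangle|y\rangle\mapsto|x\rangle|y\oplus RO(x)\rangle$ for a uniformly random function $RO:\mathcal X\to\mathcal Y$; put $RO(\bot)=\bot$ and $RO(\mathbf x)=(RO(x_1),\dots,RO(x_\ell))$. * In the game $G_{\mathcal S}^{\mathcal A}$, queries are answered by $\mathcal S.RO$.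 As soon as $\mathcal A$ announces $t_i$, $\mathcal S.E$ is queried on $t_i$; its outcome $\hat x_i$ is not given to $\mathcal A$. After the run, $\mathcal S.RO$ is queried classically on each $x_i\neq\bot$ to give $h_i$, and $h_i:=\bot$ if $x_i=\bot$. For classical values $c$ and a quantum register $W$ let $[c,W]$ denote the density operator $\sum_c p(c)\,|c\rangle\langle c|\otimes\rho_W^c$, and let $\delta(\rho,\sigma)=\frac12\|\rho-\sigma\|_1$ be the trace distance. The relation $f(x_i,h_i)=t_i$ is declared to be false if $x_i=\bot$. Claim. For all $n,\ell,q\ge0$, all such $f$ and all such $\mathcal A$, $$\delta\Bigl([\mathbf t,\mathbf x,RO(\mathbf x),W]_{\mathcal A^{RO}},\ [\mathbf t,\mathbf x,\mathbf h,W]_{G_{\mathcal S}^{\mathcal A}}\Bigr)\ \le\ 8\,\ell\,(q+\ell)\sqrt{2\Gamma/2^n}$$ and $$\Pr_{G_{\mathcal S}^{\mathcal A}}\bigl[\exists\, i:\ x_i\neq\hat x_i\ \wedge\ f(x_i,h_i)=t_i\bigr]\ \le\ 8\,\ell\,(q+1)\sqrt{2\Gamma/2^n}+\frac{40e^2(q+\ell+1)^3\,\Gamma'+2}{2^n}.$$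 -/

import Mathlib

open scoped Kronecker

namespace QROM

noncomputable section

/-! ### Trace distance and classical-quantum states -/

section States

variable {C W ι : Type*}

open scoped MatrixOrder in
/-- The Schatten-1 norm `tr √(Aᴴ A)`. -/
def traceNorm [Fintype ι] [DecidableEq ι] (A : Matrix ι ι ℂ) : ℝ :=
  (CFC.abs A).trace.re

/-- The trace distance `½ ‖ρ - σ‖₁`. -/
def traceDist [Fintype ι] [DecidableEq ι] (ρ σ : Matrix ι ι ℂ) : ℝ :=
  (1 / 2) * traceNorm (ρ - σ)

/-- A hybrid state with classical part in `C` and quantum register `W`: to the classical value `c`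
it assigns the operator `p(c) • ρ_W^c`. -/
abbrev CQState (C W : Type*) := C → Matrix W W ℂ

/-- The operator `∑ c, p(c) |c⟩⟨c| ⊗ ρ_W^c` of a hybrid state. -/
def CQState.density [DecidableEq C] (ρ : CQState C W) : Matrix (W × C) (W × C) ℂ :=
  Matrix.blockDiagonal ρ

open Classical in
/-- The probability that the classical part of a hybrid state satisfies `ev`. -/
def CQState.prob [Fintype C] [Fintype W] (ρ : CQState C W) (ev : C → Prop) : ℝ :=
  ∑ c : C, if ev c then (ρ c).trace.re else 0

end States

/-! ### Registers and algorithms -/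

/-- Bit strings of length `n`; addition is the bitwise XOR. -/
abbrev Bits (n : ℕ) := Fin n → ZMod 2

/-- Basis of the space of a query algorithm: query input register, query output register and
working register `E`. -/
abbrev Reg (X : Type*) (n : ℕ) (E : Type*) := X × Bits n × E

/-- Kraus operators, one for each outcome, of a quantum measurement with `m` outcomes. -/
def IsInstrument {A B : Type*} [Fintype B] [DecidableEq A] {m : ℕ}
    (K : Fin m → Matrix B A ℂ) : Prop :=
  ∑ k, (K k).conjTranspose * K k = 1

/-- The remaining program of an oracle algorithm which has already announced `j` values
and makes at most `q` further oracle queries. In total it announces `ℓ` values.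
* `measure`: apply a measurement to the own registers (a unitary is the case of one outcome) and
  continue depending on the outcome;
* `query`: one quantum query with the query registers;
* `announce`: announce the next (classical) value `t`;
* `finish`: perform a final measurement, which determines the classical final outputs
  `x₁, …, x_ℓ` (`none` if no `xᵢ` is output) and leaves the output register `W`. -/
inductive Program (X : Type*) (n : ℕ) (T E W : Type*) (ℓ : ℕ)
    [Fintype X] [DecidableEq X] [Fintype E] [DecidableEq E] [Fintype W] : ℕ → ℕ → Type _
  | finish {q : ℕ} (m : ℕ) (K : Fin m → Matrix W (Reg X n E) ℂ) (hK : IsInstrument K)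
      (out : Fin m → Fin ℓ → Option X) : Program X n T E W ℓ ℓ q
  | query {j q : ℕ} (next : Program X n T E W ℓ j q) : Program X n T E W ℓ j (q + 1)
  | announce {j q : ℕ} (t : T) (next : Program X n T E W ℓ (j + 1) q) : Program X n T E W ℓ j q
  | measure {j q : ℕ} (m : ℕ) (K : Fin m → Matrix (Reg X n E) (Reg X n E) ℂ)
      (hK : IsInstrument K) (next : Fin m → Program X n T E W ℓ j q) : Program X n T E W ℓ j q

/-- A multi-round oracle algorithm with at most `q` queries: initial state vector and program. -/
structure Algorithm (X : Type*) (n : ℕ) (T E W : Type*) (ℓ q : ℕ)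
    [Fintype X] [DecidableEq X] [Fintype E] [DecidableEq E] [Fintype W] where
  init : Reg X n E → ℂ
  norm_init : ∑ r, ‖init r‖ ^ 2 = 1
  prog : Program X n T E W ℓ 0 q

section Games

variable {X T E W : Type*} {n ℓ : ℕ}

/-! ### The run with the quantum random oracle -/

/-- The oracle unitary `|x⟩|y⟩|e⟩ ↦ |x⟩|y ⊕ H(x)⟩|e⟩`. -/
def oracleUnitary [DecidableEq X] [DecidableEq E] (H : X → Bits n) :
    Matrix (Reg X n E) (Reg X n E) ℂ :=
  Matrix.of fun r s =>
    if r = (s.1, s.2.1 + H s.1, s.2.2) then 1 else 0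

/-- Classical outputs `(t, x, h)`. -/
abbrev Outcome (X : Type*) (n : ℕ) (T : Type*) (ℓ : ℕ) :=
  (Fin ℓ → T) × (Fin ℓ → Option X) × (Fin ℓ → Option (Bits n))

instance [DecidableEq X] [DecidableEq T] : DecidableEq (Outcome X n T ℓ) :=
  fun a b => decidable_of_iff (a.1 = b.1 ∧ a.2.1 = b.2.1 ∧ a.2.2 = b.2.2) (by
    simp [Prod.ext_iff])

/-- `[t, x, H(x), W]` (with the convention `H(⊥) = ⊥`), when the program, having announced the
values `τ`, is run with oracle `H` on the state `ρ`. -/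
def runWith [Fintype X] [DecidableEq X] [DecidableEq T] [Fintype E] [DecidableEq E] [Fintype W]
    (H : X → Bits n) : {j q : ℕ} → Program X n T E W ℓ j q → (Fin j → T) →
      Matrix (Reg X n E) (Reg X n E) ℂ → CQState (Outcome X n T ℓ) W
  | _, _, .finish _ K _ out, τ, ρ => fun c =>
      ∑ k, if c = (τ, out k, fun i => (out k i).map H) then
        K k * ρ * (K k).conjTranspose else 0
  | _, _, .query next, τ, ρ =>
      runWith H next τ (oracleUnitary H * ρ * (oracleUnitary H).conjTranspose)
  | _, _, .announce t next, τ, ρ => runWith H next (Fin.snoc (α := fun _ => T) τ t) ρ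
  | _, _, .measure _ K _ next, τ, ρ =>
      ∑ k, runWith H (next k) τ (K k * ρ * (K k).conjTranspose)

/-- `[t, x, RO(x), W]` in the run of `A` with a uniformly random function `RO : X → {0,1}ⁿ`. -/
def realState [Fintype X] [DecidableEq X] [DecidableEq T] [Fintype E] [DecidableEq E] [Fintype W]
    {q : ℕ} (A : Algorithm X n T E W ℓ q) : CQState (Outcome X n T ℓ) W :=
  ∑ H : X → Bits n, ((Fintype.card (X → Bits n) : ℂ)⁻¹) •
    runWith H A.prog Fin.elim0 (Matrix.vecMulVec A.init (star A.init))

/-! ### The compressed oracle -/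

/-- The Hadamard basis vector `|φ_η⟩ = 2^{-n/2} ∑ y, (-1)^{η·y} |y⟩`, in the space with basis
`{0,1}ⁿ ∪ {⊥}` (`⊥` is `none`). -/
def phi (η : Bits n) : Option (Bits n) → ℂ
  | none => 0
  | some y => ((Real.sqrt (2 ^ n))⁻¹ : ℝ) * (-1) ^ (η ⬝ᵥ y).val

/-- The basis vector `|⊥⟩`. -/
def ketBot (n : ℕ) : Option (Bits n) → ℂ := Pi.single none 1

/-- The unitary `F` with `F|⊥⟩ = |φ₀⟩`, `F|φ₀⟩ = |⊥⟩` and `F|φ_η⟩ = |φ_η⟩` for `η ≠ 0`. -/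
def opF (n : ℕ) : Matrix (Option (Bits n)) (Option (Bits n)) ℂ :=
  Matrix.vecMulVec (phi 0) (star (ketBot n)) + Matrix.vecMulVec (ketBot n) (star (phi 0)) +
    ∑ η : Bits n, if η ≠ 0 then Matrix.vecMulVec (phi η) (star (phi η)) else 0

/-- `|y⟩|u⟩ ↦ |y ⊕ u⟩|u⟩` for `u ∈ {0,1}ⁿ`, and `|y⟩|⊥⟩ ↦ |y⟩|⊥⟩`. -/
def cnot (n : ℕ) : Matrix (Bits n × Option (Bits n)) (Bits n × Option (Bits n)) ℂ :=
  Matrix.of fun a b => if a = (b.1 + b.2.getD 0, b.2) then 1 else 0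

/-- `O^x = F_{D_x} CNOT_{Y D_x} F_{D_x}`, as an operator on the registers `Y` and `D_x`. -/
def cellOp (n : ℕ) : Matrix (Bits n × Option (Bits n)) (Bits n × Option (Bits n)) ℂ :=
  ((1 : Matrix (Bits n) (Bits n) ℂ) ⊗ₖ opF n) * cnot n *
    ((1 : Matrix (Bits n) (Bits n) ℂ) ⊗ₖ opF n)

/-- Basis of the register `D = (D_x)_x`. -/
abbrev DB (X : Type*) (n : ℕ) := X → Option (Bits n)

/-- `O_{XYD} = ∑ x, |x⟩⟨x| ⊗ O^x_{Y D_x}`, where `O^x` acts as the identity on `D_{x'}` for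
`x' ≠ x`. -/
def compressedOracle [Fintype X] [DecidableEq X] :
    Matrix ((X × Bits n) × DB X n) ((X × Bits n) × DB X n) ℂ :=
  Matrix.of fun a b =>
    if a.1.1 = b.1.1 ∧ ∀ x, x ≠ b.1.1 → a.2 x = b.2 x then
      cellOp n (a.1.2, a.2 b.1.1) (b.1.2, b.2 b.1.1) else 0

/-- `O_{XYD}`, acting as the identity on the working register `E`. -/
def simQuery [Fintype X] [DecidableEq X] [DecidableEq E] :
    Matrix (Reg X n E × DB X n) (Reg X n E × DB X n) ℂ :=
  Matrix.of fun a b =>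
    if a.1.2.2 = b.1.2.2 then
      compressedOracle ((a.1.1, a.1.2.1), a.2) ((b.1.1, b.1.2.1), b.2) else 0

/-- Operator on `D` of a classical query on `x` with response `h`, that is `⟨h|_Y O^x |0⟩_Y`.
On `x = ⊥` no query is made, and the response is `⊥`. -/
def classicalQuery [Fintype X] [DecidableEq X] :
    Option X → Option (Bits n) → Matrix (DB X n) (DB X n) ℂ
  | some x, some h => Matrix.of fun d d' => compressedOracle ((x, h), d) ((x, 0), d')
  | none, none => 1
  | _, _ => 0

/-- Classical queries on `x₁, …, x_ℓ`, in this order, with responses `h₁, …, h_ℓ`. -/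
def classicalQueries [Fintype X] [DecidableEq X]
    (x : Fin ℓ → Option X) (h : Fin ℓ → Option (Bits n)) : Matrix (DB X n) (DB X n) ℂ :=
  (List.ofFn fun i => classicalQuery (x i) (h i)).reverse.prod

/-! ### The extraction interface -/

/-- The register `D_x` contains some `y` with `f(x, y) = t`. -/
def Hits (f : X → Bits n → T) (t : T) (d : DB X n) (x : X) : Prop :=
  ∃ y, d x = some y ∧ f x y = t

open Classical in
/-- The projectors of the measurement `M^t`: the outcome `some x` (projector `Σ^x`) means that
`D_x` is the first register with `y` in it such that `f(x, y) = t`, and the outcome `none`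
(projector `Σ^∅`) means that there is no such register. -/
def extractProj [LinearOrder X] (f : X → Bits n → T) (t : T) :
    Option X → Matrix (DB X n) (DB X n) ℂ
  | some x => Matrix.diagonal fun d => if Hits f t d x ∧ ∀ x' < x, ¬ Hits f t d x' then 1 else 0
  | none => Matrix.diagonal fun d => if ∀ x', ¬ Hits f t d x' then 1 else 0

/-! ### The run with the extractable simulator -/

/-- Classical values `(t, x̂, x, h)` in the game with the simulator. -/
abbrev SimOutcome (X : Type*) (n : ℕ) (T : Type*) (ℓ : ℕ) :=
  (Fin ℓ → T) × (Fin ℓ → Option X) × (Fin ℓ → Option X) × (Fin ℓ → Option (Bits n))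

instance [DecidableEq X] [DecidableEq T] : DecidableEq (SimOutcome X n T ℓ) :=
  fun a b => decidable_of_iff (a.1 = b.1 ∧ a.2.1 = b.2.1 ∧ a.2.2.1 = b.2.2.1 ∧ a.2.2.2 = b.2.2.2)
    (by simp [Prod.ext_iff])

/-- The partial trace over the register `D`. -/
def traceOutDB [Fintype X] [DecidableEq X] (M : Matrix (W × DB X n) (W × DB X n) ℂ) :
    Matrix W W ℂ :=
  Matrix.of fun w w' => ∑ d, M (w, d) (w', d)

/-- `[t, x̂, x, h, W]`, when the program, having announced the values `τ` with extraction
outcomes `ξ`, is run with the simulator on the joint state `ρ` of its registers and of `D`.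
At each announcement the extraction interface is queried at once; after the run
the oracle interface is queried classically on `x₁, …, x_ℓ`. -/
def simRun [Fintype X] [LinearOrder X] [DecidableEq T] [Fintype E] [DecidableEq E]
    [Fintype W] (f : X → Bits n → T) :
    {j q : ℕ} → Program X n T E W ℓ j q → (Fin j → T) → (Fin j → Option X) →
      Matrix (Reg X n E × DB X n) (Reg X n E × DB X n) ℂ → CQState (SimOutcome X n T ℓ) W
  | _, _, .finish _ K _ out, τ, ξ, ρ => fun c =>
      ∑ k, ∑ h : Fin ℓ → Option (Bits n), if c = (τ, ξ, out k, h) then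
        traceOutDB ((K k ⊗ₖ classicalQueries (out k) h) * ρ *
          (K k ⊗ₖ classicalQueries (out k) h).conjTranspose) else 0
  | _, _, .query next, τ, ξ, ρ =>
      simRun f next τ ξ (simQuery * ρ * simQuery.conjTranspose)
  | _, _, .announce t next, τ, ξ, ρ =>
      ∑ xhat : Option X,
        simRun f next (Fin.snoc (α := fun _ => T) τ t) (Fin.snoc (α := fun _ => Option X) ξ xhat)
          (((1 : Matrix (Reg X n E) (Reg X n E) ℂ) ⊗ₖ extractProj f t xhat) * ρ *
            ((1 : Matrix (Reg X n E) (Reg X n E) ℂ) ⊗ₖ extractProj f t xhat).conjTranspose)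
  | _, _, .measure _ K _ next, τ, ξ, ρ =>
      ∑ k, simRun f (next k) τ ξ
        ((K k ⊗ₖ (1 : Matrix (DB X n) (DB X n) ℂ)) * ρ *
          (K k ⊗ₖ (1 : Matrix (DB X n) (DB X n) ℂ)).conjTranspose)

/-- `[t, x̂, x, h, W]` in the game with the simulator; `D` is initially in state `|⊥⟩ ⊗ ⋯ ⊗ |⊥⟩`. -/
def simState [Fintype X] [LinearOrder X] [DecidableEq T] [Fintype E] [DecidableEq E] [Fintype W]
    (f : X → Bits n → T) {q : ℕ} (A : Algorithm X n T E W ℓ q) :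
    CQState (SimOutcome X n T ℓ) W :=
  simRun f A.prog Fin.elim0 Fin.elim0
    (Matrix.vecMulVec A.init (star A.init) ⊗ₖ
      Matrix.single (fun _ => none : DB X n) (fun _ => none) 1)

/-- `[t, x, h, W]`, the extraction outcomes `x̂` being discarded. -/
def CQState.forgetExtracted [Fintype X] (ρ : CQState (SimOutcome X n T ℓ) W) :
    CQState (Outcome X n T ℓ) W :=
  fun c => ∑ xhat : Fin ℓ → Option X, ρ (c.1, xhat, c.2.1, c.2.2)

/-- `f(x, h) = t`, with the convention that this is false for `x = ⊥`. -/
def Opens (f : X → Bits n → T) : Option X → Option (Bits n) → T → Prop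
  | some x, some h, t => f x h = t
  | _, _, _ => False

/-! ### The parameters of `f` -/

/-- `Γ(f) = max_{x, t} |{y | f(x, y) = t}|`. -/
def Gam [Fintype X] [Fintype T] [DecidableEq T] (f : X → Bits n → T) : ℕ :=
  Finset.univ.sup fun p : X × T => (Finset.univ.filter fun y => f p.1 y = p.2).card

/-- `Γ'(f) = max_{x ≠ x', y'} |{y | f(x, y) = f(x', y')}|`. -/
def Gam' [Fintype X] [DecidableEq X] [DecidableEq T] (f : X → Bits n → T) : ℕ :=
  (Finset.univ.filter fun p : X × X × Bits n => p.1 ≠ p.2.1).sup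
    fun p => (Finset.univ.filter fun y => f p.1 y = f p.2.1 p.2.2).card

end Games

end

end QROM

namespace QROM

set_option linter.unusedSectionVars false
set_option linter.unusedSimpArgs false

noncomputable section

/-! ### Squared norms -/

/-! Write γ = √(Γ/2^n) and w = |⊥⟩ − |φ₀⟩. Since ‖w‖² = 2, F is the reflection 1 − w wᵀ
(`opF_apply`), and the oracle O is F, then an addition controlled by the basis states of D, then F.
This has two consequences.

Up to F on all cells, a run without extractions is the purification of the run with a random
function, D holding the superposition of all |H⟩. Without extractions the two games therefore agree
exactly (`realState_apply`).

Moreover, F is the only part of O that disturbs a measurement of D in the computational basis. If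
the outcome, as a function of D_x alone, has one value on a set of w-weight at most β and one value
off it, then the commutator with F has squared norm at most 4β (`sum_commutator_cell_le`).
Extraction is such a measurement with β = Γ/2^n (`splits_extracted`), so moving it past one query
costs 4γ. Errors are ℓ²-norms of the whole family of unnormalized final states, indexed by
measurement outcomes, extraction outcomes and responses. Hence the number of outcomes never enters,
and errors add up by Minkowski's inequality (`nsq_add_le`).

For the trace distance, all ℓ extractions are postponed past the q queries of the algorithm
(`sum_extractVec_sub_le`) and past the ℓ final classical queries (`sum_commutator_matches_le`), with
total error 4ℓ(q+ℓ)γ. They are then measurements with discarded outcome on a register that is traced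
out, and have no effect.

For the openings, the extractions are postponed only to the end of the algorithm, which raises the
probability by at most 8ℓqγ. It remains to study the state reached without extractions. If its
database has no collision and the extraction on tᵢ does not return xᵢ, then the cell of xᵢ holds no
preimage of tᵢ. Each cell is moreover orthogonal to |φ₀⟩, so the final query rarely creates such a
preimage (`sum_hit_cell_le`, `sum_nsq_hit_le`). Having a collision is again a two-valued function of
each cell, with β = qΓ'/2^n, and is false at the start. The commutator bound thus limits its weight
to 16q³Γ'/2^n (`sum_nsq_collides_le`). A remaining term of order ℓ²γ² is absorbed by ℓγ because
probabilities are at most 1 (`opening_bound_numeric`). -/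

/-- The squared Euclidean norm of a vector. -/
def nsq {ι : Type*} [Fintype ι] (v : ι → ℂ) : ℝ := ∑ i, ‖v i‖ ^ 2

section Nsq

variable {ι κ m : Type*} [Fintype ι] [Fintype κ] [Fintype m]

lemma nsq_nonneg (v : ι → ℂ) : 0 ≤ nsq v := Finset.sum_nonneg fun _ _ => by positivity

lemma nsq_eq_dotProduct (v : ι → ℂ) : ((nsq v : ℝ) : ℂ) = star v ⬝ᵥ v := by
  simp [nsq, dotProduct, Complex.conj_mul']

/-- Minkowski's inequality, for squared norms. -/
lemma sum_norm_add_sq_le (a b : ι → ℂ) {α β N : ℝ} (hα : 0 ≤ α) (hβ : 0 ≤ β) (hN : 0 ≤ N)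
    (ha : ∑ i, ‖a i‖ ^ 2 ≤ α ^ 2 * N) (hb : ∑ i, ‖b i‖ ^ 2 ≤ β ^ 2 * N) :
    ∑ i, ‖a i + b i‖ ^ 2 ≤ (α + β) ^ 2 * N := by
  have h := norm_add_le (WithLp.toLp 2 a : EuclideanSpace ℂ ι) (WithLp.toLp 2 b)
  have e : ∀ c : ι → ℂ, ‖(WithLp.toLp 2 c : EuclideanSpace ℂ ι)‖ = √(∑ i, ‖c i‖ ^ 2) := fun c => by
    rw [EuclideanSpace.norm_eq]
  have e2 : ∀ {γ : ℝ}, 0 ≤ γ → √(γ ^ 2 * N) = γ * √N := fun h => by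
    rw [Real.sqrt_mul (by positivity), Real.sqrt_sq h]
  rw [← WithLp.toLp_add, e, e, e] at h
  have h2 := Real.sqrt_le_sqrt ha
  have h3 := Real.sqrt_le_sqrt hb
  rw [e2 hα] at h2
  rw [e2 hβ] at h3
  have h4 : √(∑ i, ‖(a + b) i‖ ^ 2) ≤ (α + β) * √N := by linarith
  have h5 := Real.sqrt_le_iff.1 h4 |>.2
  rwa [mul_pow, Real.sq_sqrt hN] at h5

lemma sum_norm_add_sq_le_two (a b : ι → ℂ) :
    ∑ i, ‖a i + b i‖ ^ 2 ≤ 2 * ∑ i, ‖a i‖ ^ 2 + 2 * ∑ i, ‖b i‖ ^ 2 := by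
  rw [Finset.mul_sum, Finset.mul_sum, ← Finset.sum_add_distrib]
  refine Finset.sum_le_sum fun i _ => ?_
  have h1 := norm_add_le (a i) (b i)
  have h2 : ‖a i + b i‖ ^ 2 ≤ (‖a i‖ + ‖b i‖) ^ 2 := by gcongr
  nlinarith [sq_nonneg (‖a i‖ - ‖b i‖)]

/-- The Cauchy–Schwarz inequality. -/
lemma norm_sum_mul_sq_le (s : Finset ι) (a b : ι → ℂ) :
    ‖∑ i ∈ s, a i * b i‖ ^ 2 ≤ (∑ i ∈ s, ‖a i‖ ^ 2) * ∑ i ∈ s, ‖b i‖ ^ 2 := by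
  have h : ‖∑ i ∈ s, a i * b i‖ ≤ ∑ i ∈ s, ‖a i‖ * ‖b i‖ :=
    (norm_sum_le _ _).trans (by simp)
  calc _ ≤ (∑ i ∈ s, ‖a i‖ * ‖b i‖) ^ 2 := by gcongr
    _ ≤ _ := Finset.sum_mul_sq_le_sq_mul_sq _ _ _

lemma norm_sum_sq_le (s : Finset ι) (b : ι → ℂ) :
    ‖∑ i ∈ s, b i‖ ^ 2 ≤ s.card * ∑ i ∈ s, ‖b i‖ ^ 2 := by
  simpa using norm_sum_mul_sq_le s (fun _ => 1) b

lemma sum_nsq_mulVec [DecidableEq κ] (K : ι → Matrix m κ ℂ)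
    (hK : ∑ k, (K k).conjTranspose * K k = 1) (v : κ → ℂ) :
    ∑ k, nsq ((K k).mulVec v) = nsq v := by
  have h : ((∑ k, nsq ((K k).mulVec v) : ℝ) : ℂ) = nsq v := by
    push_cast
    simp_rw [nsq_eq_dotProduct, Matrix.star_mulVec, Matrix.dotProduct_mulVec,
      Matrix.vecMul_vecMul, ← Matrix.dotProduct_mulVec]
    rw [← dotProduct_sum, ← Matrix.sum_mulVec, hK, Matrix.one_mulVec]
  exact_mod_cast h

lemma nsq_mulVec [DecidableEq κ] (A : Matrix m κ ℂ) (hA : A.conjTranspose * A = 1) (v : κ → ℂ) :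
    nsq (A.mulVec v) = nsq v := by
  simpa using sum_nsq_mulVec (fun _ : Unit => A) (by simpa using hA) v

end Nsq

/-! ### The unitary `F` -/

/-- The vector `|⊥⟩ - |φ₀⟩`. -/
def wvec (n : ℕ) : Option (Bits n) → ℝ
  | none => 1
  | some _ => -(√(2 ^ n))⁻¹

lemma inv_sqrt_two_pow_sq (n : ℕ) : ((√(2 ^ n))⁻¹ : ℝ) ^ 2 = (2 ^ n)⁻¹ := by
  rw [inv_pow, Real.sq_sqrt (by positivity)]

lemma card_bits (n : ℕ) : Fintype.card (Bits n) = 2 ^ n := by simp [ZMod.card]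

lemma neg_one_pow_val_mul (a b : ZMod 2) :
    ((-1 : ℂ) ^ a.val) * (-1) ^ b.val = (-1) ^ (a + b).val := by
  have h : ∀ a : ZMod 2, a = 0 ∨ a = 1 := by decide
  rcases h a with rfl | rfl <;> rcases h b with rfl | rfl <;>
    simp [ZMod.val_one, CharTwo.add_self_eq_zero]

lemma sum_neg_one_pow_dotProduct {n : ℕ} (z : Bits n) :
    ∑ η : Bits n, (-1 : ℂ) ^ (η ⬝ᵥ z).val = if z = 0 then 2 ^ n else 0 := by
  split_ifs with h
  · subst h
    simp
  · obtain ⟨i, hi⟩ := Function.ne_iff.1 h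
    have hi : z i = 1 := by
      have : ∀ a : ZMod 2, a ≠ 0 → a = 1 := by decide
      exact this _ hi
    -- Translation by the unit vector at i, where z i = 1, flips the sign of every term, so the sum
    -- equals its negative.
    have := Equiv.sum_comp (Equiv.addRight (Pi.single i 1 : Bits n))
      (fun η : Bits n => (-1 : ℂ) ^ (η ⬝ᵥ z).val)
    simp only [Equiv.coe_addRight, add_dotProduct, single_dotProduct, one_mul, hi,
      ← neg_one_pow_val_mul, ZMod.val_one, pow_one, mul_neg, mul_one, Finset.sum_neg_distrib] at this
    exact CharZero.neg_eq_self_iff.1 this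

lemma bits_add_self {n : ℕ} (y : Bits n) : y + y = 0 := by
  ext i
  exact CharTwo.add_self_eq_zero _

lemma bits_eq_add_iff {n : ℕ} (a b c : Bits n) : a = b + c ↔ b = a + c := by
  constructor <;> rintro rfl <;> simp [add_assoc, bits_add_self]

/-- By completeness of the Hadamard basis, F is the reflection 1 − w wᵀ. From here on F enters only
through w and its weights. -/
lemma opF_apply {n : ℕ} (u v : Option (Bits n)) :
    opF n u v = (if u = v then 1 else 0) - (wvec n u * wvec n v : ℝ) := by
  have hs : ∀ M : Bits n → Matrix (Option (Bits n)) (Option (Bits n)) ℂ,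
      (∑ η : Bits n, if η ≠ 0 then M η else 0) u v = (∑ η, M η u v) - M 0 u v := by
    intro M
    rw [← Finset.sum_filter, Matrix.sum_apply, Finset.filter_ne', 
      ← Finset.add_sum_erase _ _ (Finset.mem_univ (0 : Bits n))]
    ring
  simp only [opF, Matrix.add_apply, hs]
  rcases u with _ | y <;> rcases v with _ | y'
  · simp [Matrix.vecMulVec_apply, phi, ketBot, wvec]
  · simp [Matrix.vecMulVec_apply, phi, ketBot, wvec]
  · simp [Matrix.vecMulVec_apply, phi, ketBot, wvec]
  · have h : ∀ η : Bits n, Matrix.vecMulVec (phi η) (star (phi η)) (some y) (some y') =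
        ((((√(2 ^ n))⁻¹ ^ 2 : ℝ)) : ℂ) * (-1) ^ (η ⬝ᵥ (y + y')).val := by
      intro η
      rw [dotProduct_add, ← neg_one_pow_val_mul]
      simp only [Matrix.vecMulVec_apply, phi, Pi.star_apply, star_mul', star_pow, star_neg,
        star_one, Complex.star_def, Complex.conj_ofReal]
      push_cast
      ring
    simp only [h, ← Finset.mul_sum, sum_neg_one_pow_dotProduct, inv_sqrt_two_pow_sq]
    have e : y + y' = 0 ↔ y = y' := by
      rw [eq_comm, bits_eq_add_iff, zero_add]
    have e3 : ((√(2 ^ n) : ℝ) : ℂ)⁻¹ * ((√(2 ^ n) : ℝ) : ℂ)⁻¹ = (2 ^ n)⁻¹ := by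
      have := inv_sqrt_two_pow_sq n
      rw [sq] at this
      simpa using congrArg (Complex.ofReal) this
    by_cases hy : y = y' <;> simp [Matrix.vecMulVec_apply, phi, ketBot, wvec, e, hy, e3, bits_add_self]

lemma sum_wvec_sq (n : ℕ) : ∑ u, wvec n u ^ 2 = 2 := by
  simp [Fintype.sum_option, wvec, inv_sqrt_two_pow_sq, ZMod.card, -inv_pow]
  norm_num

lemma opF_mul_self (n : ℕ) : opF n * opF n = 1 := by
  ext u v
  -- The value ‖w‖² = 2 is what makes 1 − w wᵀ an involution.
  have h2 : ∑ a : Option (Bits n), ((wvec n a : ℝ) : ℂ) * wvec n a = 2 := by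
    have := sum_wvec_sq n
    simp only [sq] at this
    exact_mod_cast this
  simp only [Matrix.mul_apply, opF_apply, sub_mul, mul_sub, Finset.sum_sub_distrib, ite_mul, one_mul,
    zero_mul, mul_ite, mul_one, mul_zero, Finset.sum_ite_eq, Finset.sum_ite_eq', Finset.mem_univ,
    if_true, Matrix.one_apply]
  have : ∑ x : Option (Bits n), ((wvec n u * wvec n x : ℝ) : ℂ) * ((wvec n x * wvec n v : ℝ) : ℂ) =
      2 * (wvec n u * wvec n v) := by
    rw [← h2, Finset.sum_mul]
    refine Finset.sum_congr rfl fun x _ => ?_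
    push_cast
    ring
  rw [this]
  push_cast
  ring

lemma opF_conjTranspose (n : ℕ) : (opF n).conjTranspose = opF n := by
  ext u v
  simp only [Matrix.conjTranspose_apply, opF_apply, star_sub, apply_ite star, star_one, star_zero,
    eq_comm (a := v)]
  simp [mul_comm]

/-! ### Tensor products of operators on the cells of `D` -/

section Tens

variable {X U : Type*} [Fintype X] [DecidableEq X] [Fintype U] [DecidableEq U]

/-- The tensor product of a family of operators. -/
def tens (A : X → Matrix U U ℂ) : Matrix (X → U) (X → U) ℂ :=
  Matrix.of fun d d' => ∏ x, A x (d x) (d' x)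

lemma tens_mul (A B : X → Matrix U U ℂ) : tens A * tens B = tens fun x => A x * B x := by
  ext d d'
  simp [tens, Matrix.mul_apply, Finset.prod_univ_sum, Finset.prod_mul_distrib]

lemma tens_update_apply (x : X) (A : Matrix U U ℂ) (d d' : X → U) :
    tens (Function.update 1 x A) d d' =
      if ∀ x', x' ≠ x → d x' = d' x' then A (d x) (d' x) else 0 := by
  rw [tens, Matrix.of_apply, ← Finset.mul_prod_erase _ _ (Finset.mem_univ x)]
  simp only [Function.update_self]
  have : ∏ x' ∈ Finset.univ.erase x, (Function.update 1 x A : X → Matrix U U ℂ) x' (d x') (d' x') =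
      if ∀ x', x' ≠ x → d x' = d' x' then 1 else 0 := by
    rw [← Finset.prod_congr rfl (g := fun x' => _) (fun x' hx' => by
      rw [Function.update_of_ne (Finset.ne_of_mem_erase hx'), Pi.one_apply, Matrix.one_apply])]
    rw [Finset.prod_ite_zero]
    simp
  rw [this]
  simp

lemma tens_one : tens (1 : X → Matrix U U ℂ) = 1 := by
  ext d d'
  simp [tens, Matrix.one_apply, Finset.prod_ite_zero, funext_iff]

lemma tens_conjTranspose (A : X → Matrix U U ℂ) :
    (tens A).conjTranspose = tens fun x => (A x).conjTranspose := by
  ext d d'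
  simp [tens]

lemma tens_update_diagonal (x : X) (p : U → ℂ) :
    tens (Function.update 1 x (Matrix.diagonal p)) = Matrix.diagonal fun d => p (d x) := by
  ext d d'
  rw [tens_update_apply, Matrix.diagonal_apply, Matrix.diagonal_apply]
  by_cases h : d = d'
  · simp [h]
  · rw [if_neg h]
    split_ifs with h1 h2
    · refine absurd (funext fun x' => ?_) h
      by_cases hx : x' = x
      · rw [hx, h2]
      · exact h1 _ hx
    · rfl
    · rfl

lemma tens_update_mulVec (x : X) (A : Matrix U U ℂ) (v : (X → U) → ℂ) (d : X → U) :
    (tens (Function.update 1 x A)).mulVec v d = ∑ u, A (d x) u * v (Function.update d x u) := by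
  simp only [Matrix.mulVec, dotProduct, tens_update_apply, ite_mul, zero_mul]
  rw [← Finset.sum_filter]
  symm
  refine Finset.sum_nbij (fun u => Function.update d x u) ?_ ?_ ?_ ?_
  · intro u _
    simp only [Finset.mem_filter, Finset.mem_univ, true_and]
    intro x' hx'
    rw [Function.update_of_ne hx']
  · intro u _ u' _ h
    simpa using congrFun h x
  · intro d' hd'
    simp only [Finset.coe_filter, Finset.mem_univ, true_and, Set.mem_ofPred_eq] at hd'
    refine ⟨d' x, by simp, funext fun x' => ?_⟩
    by_cases hx : x' = x
    · simp [hx]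
    · simp [hx, hd']
  · intro u _
    simp

/-- Comparison of two sums over all functions, one argument at a time. -/
lemma sum_le_sum_of_update (x : X) (a b : (X → U) → ℝ)
    (h : ∀ d, ∑ u, a (Function.update d x u) ≤ ∑ u, b (Function.update d x u)) :
    ∑ d, a d ≤ ∑ d, b d := by
  rcases isEmpty_or_nonempty U with hU | hU
  · have : IsEmpty (X → U) := ⟨fun d => hU.elim (d x)⟩
    simp
  -- Resampling the argument x produces each function once for every discarded old value, that is
  -- `card U` times.
  have e : ∀ a : (X → U) → ℝ,
      ∑ d, ∑ u, a (Function.update d x u) = Fintype.card U * ∑ d, a d := by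
    intro a
    rw [← Equiv.sum_comp (Equiv.funSplitAt x U).symm a,
      ← Equiv.sum_comp (Equiv.funSplitAt x U).symm (fun d => ∑ u, a (Function.update d x u))]
    simp only [Fintype.sum_prod_type]
    have : ∀ (u' : U) (r : { j // j ≠ x } → U) (u : U),
        Function.update ((Equiv.funSplitAt x U).symm (u', r)) x u =
          (Equiv.funSplitAt x U).symm (u, r) := by
      intro u' r u
      ext x'
      by_cases hx : x' = x
      · subst hx
        simp [Equiv.funSplitAt]
      · simp [Equiv.funSplitAt, hx]
    simp only [this, Finset.sum_const, Finset.card_univ, nsmul_eq_mul]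
    rw [Finset.sum_comm]
  have := Finset.sum_le_sum fun d (_ : d ∈ Finset.univ) => h d
  rw [e, e] at this
  exact le_of_mul_le_mul_left this (by exact_mod_cast Fintype.card_pos)

end Tens

/-! ### The operator F on sets of cells, and the oracle as a conjugated diagonal operator -/

section FS

variable {X : Type*} {n : ℕ} [Fintype X] [DecidableEq X]

/-- The operator `F` applied to all cells in `s`. -/
def FS (n : ℕ) (s : Finset X) : Matrix (DB X n) (DB X n) ℂ :=
  tens fun x => if x ∈ s then opF n else 1

lemma FS_mul_self (s : Finset X) : FS n s * FS n s = 1 := by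
  rw [FS, tens_mul, ← tens_one]
  congr 1
  ext1 x
  split_ifs <;> simp [opF_mul_self]

lemma FS_conjTranspose (s : Finset X) : (FS n s).conjTranspose = FS n s := by
  rw [FS, tens_conjTranspose]
  congr 1
  ext1 x
  split_ifs <;> simp [opF_conjTranspose]

/-- On the cells other than x the two copies of F cancel. So an oracle call may be conjugated by F
on any set of cells containing x: small sets suit commutators, the set of all cells suits the
comparison with a random function. -/
lemma FS_mul_tens_mul_FS {s : Finset X} {x : X} (hx : x ∈ s)
    (G : Matrix (Option (Bits n)) (Option (Bits n)) ℂ) :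
    FS n s * tens (Function.update 1 x G) * FS n s =
      tens (Function.update 1 x (opF n * G * opF n)) := by
  rw [FS, tens_mul, tens_mul]
  congr 1
  ext1 x'
  by_cases h : x' = x
  · subst h
    simp [hx]
  · simp only [Function.update_of_ne h, Pi.one_apply, mul_one]
    split_ifs <;> simp [opF_mul_self]

lemma FS_singleton (x : X) : FS n {x} = tens (Function.update 1 x (opF n)) := by
  rw [FS]
  congr 1
  ext1 x'
  by_cases h : x' = x
  · subst h; simp
  · simp [h]

lemma FS_insert {s : Finset X} {x : X} (hx : x ∉ s) : FS n (insert x s) = FS n {x} * FS n s := by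
  rw [FS, FS, FS, tens_mul]
  congr 1
  ext1 x'
  by_cases h : x' = x
  · subst h; simp [hx]
  · simp [h]

lemma nsq_FS_mulVec (s : Finset X) (v : DB X n → ℂ) : nsq ((FS n s).mulVec v) = nsq v :=
  nsq_mulVec _ (by rw [FS_conjTranspose, FS_mul_self]) _

/-- `F_{D_x}` is a rank-one perturbation of the identity. -/
lemma FS_singleton_mulVec (x : X) (v : DB X n → ℂ) (d : DB X n) :
    (FS n {x}).mulVec v d =
      v d - wvec n (d x) * ∑ u, wvec n u * v (Function.update d x u) := by
  rw [FS_singleton, tens_update_mulVec]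
  simp only [opF_apply, sub_mul, ite_mul, one_mul, zero_mul, Finset.sum_sub_distrib,
    Finset.sum_ite_eq, Finset.mem_univ, if_true, Function.update_eq_self, Finset.mul_sum]
  simp [mul_assoc]

/-! ### The oracle operators in the basis given by `F` -/

lemma cellOp_apply (y y' : Bits n) (u u' : Option (Bits n)) :
    cellOp n (y, u) (y', u') =
      (opF n * Matrix.diagonal (fun v : Option (Bits n) => if y = y' + v.getD 0 then (1 : ℂ) else 0) *
        opF n : Matrix _ _ ℂ) u u' := by
  have h : ∀ a b : Bits n × Option (Bits n), cnot n a b =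
      if a.2 = b.2 then if a.1 = b.1 + b.2.getD 0 then 1 else 0 else 0 := by
    intro a b
    simp only [cnot, Matrix.of_apply, Prod.ext_iff]
    split_ifs <;> simp_all
  simp only [cellOp, Matrix.mul_apply, Fintype.sum_prod_type, Matrix.kroneckerMap_apply,
    Matrix.one_apply, ite_mul, one_mul, zero_mul, h, mul_ite, mul_one, mul_zero,
    Finset.sum_ite_eq, Finset.sum_ite_eq', Finset.mem_univ, if_true, Matrix.diagonal_apply,
    Finset.sum_ite_irrel, Finset.sum_const_zero]

lemma compressedOracle_apply {s : Finset X} {x : X} (hx : x ∈ s) (y y' : Bits n) (x' : X)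
    (d d' : DB X n) :
    compressedOracle ((x, y), d) ((x', y'), d') = if x = x' then
      (FS n s * Matrix.diagonal (fun d : DB X n => if y = y' + (d x).getD 0 then (1 : ℂ) else 0) *
        FS n s : Matrix _ _ ℂ) d d'
      else 0 := by
  rw [← tens_update_diagonal x (fun u : Option (Bits n) => if y = y' + u.getD 0 then (1 : ℂ) else 0),
    FS_mul_tens_mul_FS hx, tens_update_apply]
  simp only [compressedOracle, Matrix.of_apply]
  by_cases h : x = x'
  · subst h
    simp [cellOp_apply]
  · simp [h]

end FS

/-! ### Oracle calls as maps on state vectors -/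

section Oracle

variable {X E R Z : Type*} {n ℓ : ℕ} [Fintype X] [DecidableEq X] [Fintype E] [DecidableEq E]
  [Fintype R] [Fintype Z]

/-- The action of an operator on `D`. -/
def actD (C : Matrix (DB X n) (DB X n) ℂ) (v : R × DB X n → ℂ) : R × DB X n → ℂ :=
  fun a => C.mulVec (fun d => v (a.1, d)) a.2

lemma one_kronecker_mulVec [DecidableEq R] (C : Matrix (DB X n) (DB X n) ℂ) (v : R × DB X n → ℂ) :
    ((1 : Matrix R R ℂ) ⊗ₖ C).mulVec v = actD C v := by
  ext ⟨r, d⟩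
  simp [Matrix.mulVec, dotProduct, actD, Fintype.sum_prod_type, Matrix.one_apply, ite_mul,
    Finset.sum_ite_irrel]

lemma nsq_prod (v : R × DB X n → ℂ) : nsq v = ∑ r, nsq fun d => v (r, d) := by
  simp [nsq, Fintype.sum_prod_type]

/-- The operator `F`, applied to the cells in `S x` for the queried `x`. -/
def ctrlF (S : X → Finset X) (ψ : Reg X n E × DB X n → ℂ) : Reg X n E × DB X n → ℂ :=
  fun a => (FS n (S a.1.1)).mulVec (fun d => ψ (a.1, d)) a.2

/-- The oracle for a database in the computational basis. -/
def plainQuery (ψ : Reg X n E × DB X n → ℂ) : Reg X n E × DB X n → ℂ :=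
  fun a => ψ ((a.1.1, a.1.2.1 + (a.2 a.1.1).getD 0, a.1.2.2), a.2)

/-- The freedom in `S` is used twice: singletons give commutator bounds independent of the number of
cells, while `Finset.univ` lets the F's of consecutive queries cancel. -/
lemma simQuery_mulVec {S : X → Finset X} (hS : ∀ x, x ∈ S x) (ψ : Reg X n E × DB X n → ℂ) :
    simQuery.mulVec ψ = ctrlF S (plainQuery (ctrlF S ψ)) := by
  ext ⟨⟨x, y, e⟩, d⟩
  have h1 : simQuery.mulVec ψ ((x, y, e), d) = ∑ y', ((FS n (S x) * Matrix.diagonal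
      (fun d : DB X n => if y = y' + (d x).getD 0 then (1 : ℂ) else 0) * FS n (S x) :
        Matrix _ _ ℂ).mulVec fun d' => ψ ((x, y', e), d')) d := by
    simp only [Matrix.mulVec, dotProduct, simQuery, Matrix.of_apply, Fintype.sum_prod_type,
      compressedOracle_apply (hS x), ite_mul, zero_mul, Finset.sum_ite_irrel, Finset.sum_const_zero,
      Finset.sum_ite_eq, Finset.mem_univ, if_true]
  rw [h1]
  simp only [← Matrix.mulVec_mulVec, ← Finset.sum_apply, ← Matrix.mulVec_sum]
  unfold ctrlF
  congr 1
  ext d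
  simp only [Finset.sum_apply, Matrix.mulVec_diagonal, plainQuery, ite_mul, one_mul, zero_mul,
    bits_eq_add_iff, Finset.sum_ite_eq', Finset.mem_univ, if_true]

lemma nsq_ctrlF (S : X → Finset X) (ψ : Reg X n E × DB X n → ℂ) : nsq (ctrlF S ψ) = nsq ψ := by
  rw [nsq_prod (ctrlF S ψ), nsq_prod ψ]
  exact Finset.sum_congr rfl fun r _ => nsq_FS_mulVec (S r.1) fun d => ψ (r, d)

lemma nsq_plainQuery (ψ : Reg X n E × DB X n → ℂ) : nsq (plainQuery ψ) = nsq ψ := by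
  simp only [nsq, Fintype.sum_prod_type, plainQuery]
  refine Finset.sum_congr rfl fun x _ => ?_
  rw [Finset.sum_comm]
  conv_rhs => rw [Finset.sum_comm]
  refine Finset.sum_congr rfl fun e _ => ?_
  rw [Finset.sum_comm]
  conv_rhs => rw [Finset.sum_comm]
  refine Finset.sum_congr rfl fun d _ => ?_
  exact Equiv.sum_comp (Equiv.addRight ((d x).getD 0)) fun y => ‖ψ ((x, y, e), d)‖ ^ 2

lemma nsq_simQuery_mulVec (ψ : Reg X n E × DB X n → ℂ) : nsq (simQuery.mulVec ψ) = nsq ψ := by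
  rw [simQuery_mulVec (S := fun x => {x}) (by simp), nsq_ctrlF, nsq_plainQuery, nsq_ctrlF]

/-! ### Classical queries -/

/-- The responses to classical queries on `xs`, for a database in the computational basis. -/
def responses (xs : Fin ℓ → Option X) (d : DB X n) : Fin ℓ → Option (Bits n) :=
  fun i => (xs i).map fun x => (d x).getD 0

lemma classicalQuery_eq {s : Finset X} {x : Option X} (hx : ∀ x' ∈ x, x' ∈ s)
    (h : Option (Bits n)) :
    classicalQuery x h = FS n s * Matrix.diagonal
      (fun d : DB X n => if h = x.map (fun x' => (d x').getD 0) then (1 : ℂ) else 0) * FS n s := by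
  rcases x with _ | x <;> rcases h with _ | h
  · simp [classicalQuery, FS_mul_self]
  · simp [classicalQuery]
  · simp [classicalQuery]
  · ext d d'
    simp only [classicalQuery, Matrix.of_apply, compressedOracle_apply (hx x rfl)]
    simp

/-- If `s` contains every queried argument, the F's between consecutive queries cancel. All queries
together become one measurement of D in the computational basis between two layers of F. -/
lemma classicalQueries_eq {s : Finset X} {xs : Fin ℓ → Option X} (hx : ∀ i, ∀ x ∈ xs i, x ∈ s)
    (h : Fin ℓ → Option (Bits n)) :
    classicalQueries xs h = FS n s * Matrix.diagonal
      (fun d : DB X n => if h = responses xs d then (1 : ℂ) else 0) * FS n s := by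
  classical
  have key : ∀ L : List (Fin ℓ), (L.map fun i => classicalQuery (xs i) (h i)).prod =
      FS n s * Matrix.diagonal (fun d : DB X n => if ∀ i ∈ L, h i = responses xs d i then (1 : ℂ)
        else 0) * FS n s := by
    intro L
    induction L with
    | nil => simp [FS_mul_self]
    | cons i L ih =>
      rw [List.map_cons, List.prod_cons, ih, classicalQuery_eq (hx i)]
      have : ∀ A B : Matrix (DB X n) (DB X n) ℂ,
          FS n s * A * FS n s * (FS n s * B * FS n s) = FS n s * (A * B) * FS n s := by
        intro A B
        have e := FS_mul_self (n := n) s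
        calc _ = FS n s * A * (FS n s * FS n s) * B * FS n s := by simp only [Matrix.mul_assoc]
          _ = _ := by rw [e]; simp only [Matrix.mul_assoc, Matrix.mul_one, Matrix.one_mul]
      rw [this, Matrix.diagonal_mul_diagonal]
      congr 3
      ext d
      simp only [List.mem_cons, forall_eq_or_imp, responses, ite_and, ite_mul, one_mul, zero_mul]
      congr
  have e : (List.ofFn fun i => classicalQuery (n := n) (xs i) (h i)).reverse =
      ((List.finRange ℓ).reverse.map fun i => classicalQuery (xs i) (h i)) := by
    rw [List.ofFn_eq_map, List.map_reverse]
  rw [classicalQueries, e, key]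
  congr 3
  ext d
  simp [funext_iff]

lemma sum_nsq_indicator {κ : Type*} [Fintype κ] [DecidableEq Z] (g : κ → Z) (v : κ → ℂ) :
    ∑ z, nsq (fun i => if z = g i then v i else 0) = nsq v := by
  simp only [nsq]
  rw [Finset.sum_comm]
  refine Finset.sum_congr rfl fun i _ => ?_
  simp [apply_ite norm, ite_pow]

lemma diagonal_ite_mulVec {κ : Type*} [Fintype κ] [DecidableEq κ] (p : κ → Prop) [DecidablePred p]
    (v : κ → ℂ) : (Matrix.diagonal fun i => if p i then (1 : ℂ) else 0).mulVec v =
      fun i => if p i then v i else 0 := by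
  ext i
  simp [Matrix.mulVec_diagonal]

lemma sum_nsq_classicalQueries (xs : Fin ℓ → Option X) (v : DB X n → ℂ) :
    ∑ h, nsq ((classicalQueries xs h).mulVec v) = nsq v := by
  simp_rw [classicalQueries_eq (s := Finset.univ) (xs := xs) (by simp), ← Matrix.mulVec_mulVec,
    nsq_FS_mulVec, diagonal_ite_mulVec]
  rw [sum_nsq_indicator, nsq_FS_mulVec]

lemma sum_nsq_actD_classicalQueries (xs : Fin ℓ → Option X) (v : R × DB X n → ℂ) :
    ∑ h, nsq (actD (classicalQueries xs h) v) = nsq v := by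
  simp only [nsq, Fintype.sum_prod_type]
  rw [Finset.sum_comm]
  exact Finset.sum_congr rfl fun r _ => sum_nsq_classicalQueries xs fun d => v (r, d)

/-! ### Commutators with measurements of the database -/

open Classical in
/-- The restriction of a vector to the databases that satisfy `p`. -/
def res (p : DB X n → Prop) (v : R × DB X n → ℂ) : R × DB X n → ℂ :=
  fun a => if p a.2 then v a else 0

lemma res_sub (p : DB X n → Prop) (v w : R × DB X n → ℂ) : res p (v - w) = res p v - res p w := by
  ext a
  by_cases h : p a.2 <;> simp [res, h]

lemma res_res (p p' : DB X n → Prop) (v : R × DB X n → ℂ) :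
    res p (res p' v) = res (fun d => p d ∧ p' d) v := by
  ext a
  by_cases h : p a.2 <;> by_cases h' : p' a.2 <;> simp [res, h, h']

lemma sum_nsq_res (g : DB X n → Z) (v : R × DB X n → ℂ) :
    ∑ z, nsq (res (fun d => g d = z) v) = nsq v := by
  classical
  rw [← sum_nsq_indicator (fun a => g a.2) v]
  refine Finset.sum_congr rfl fun z _ => ?_
  congr 1
  ext a
  simp [res, eq_comm]

/-- As a function of `D_x`, with the other cells as in `d`, the label `g` has one value on a set `B`
and one value off `B`, where `B` has weight at most `β`. -/
def Splits (g : DB X n → Z) (β : ℝ) (x : X) (d : DB X n) : Prop :=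
  ∃ (B : Finset (Option (Bits n))) (z₀ z₁ : Z), ∑ u ∈ B, wvec n u ^ 2 ≤ β ∧
    ∀ u, (u ∈ B → g (Function.update d x u) = z₁) ∧ (u ∉ B → g (Function.update d x u) = z₀)

open Classical in
/-- The commutator of a two-valued measurement with `F`, on one cell. -/
lemma sum_commutator_cell_le (B : Finset (Option (Bits n))) (z₀ z₁ : Z) {β : ℝ}
    (hB : ∑ u ∈ B, wvec n u ^ 2 ≤ β) (g : Option (Bits n) → Z)
    (h1 : ∀ u ∈ B, g u = z₁) (h0 : ∀ u ∉ B, g u = z₀) (v : Option (Bits n) → ℂ) :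
    ∑ u, ∑ z, ‖(wvec n u : ℂ) * ∑ a, (wvec n a : ℂ) *
        (((if g u = z then 1 else 0) - if g a = z then 1 else 0) * v a)‖ ^ 2 ≤
      4 * β * ∑ u, ‖v u‖ ^ 2 := by
  -- In row u of the commutator only the entries a on the other side of the partition survive; `T u`
  -- is that side.
  set T : Option (Bits n) → Finset (Option (Bits n)) := fun u => if u ∈ B then Bᶜ else B with hT
  have hw : ∀ u, ‖(wvec n u : ℂ)‖ ^ 2 = wvec n u ^ 2 := fun u => by simp
  have hz : ∀ u z, ‖(wvec n u : ℂ) * ∑ a, (wvec n a : ℂ) *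
        (((if g u = z then 1 else 0) - if g a = z then 1 else 0) * v a)‖ ^ 2 ≤
      (if z = z₀ then wvec n u ^ 2 * ‖∑ a ∈ T u, (wvec n a : ℂ) * v a‖ ^ 2 else 0) +
      (if z = z₁ then wvec n u ^ 2 * ‖∑ a ∈ T u, (wvec n a : ℂ) * v a‖ ^ 2 else 0) := by
    intro u z
    have hnn : 0 ≤ wvec n u ^ 2 * ‖∑ a ∈ T u, (wvec n a : ℂ) * v a‖ ^ 2 := by positivity
    obtain ⟨c, hc, hc'⟩ : ∃ c : ℂ, ‖c‖ ^ 2 ≤ (if z = z₀ then 1 else 0) + (if z = z₁ then 1 else 0) ∧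
        ∀ a, ((if g u = z then (1 : ℂ) else 0) - if g a = z then 1 else 0) =
          if a ∈ T u then c else 0 := by
      by_cases hu : u ∈ B
      · refine ⟨(if z₁ = z then (1 : ℂ) else 0) - if z₀ = z then 1 else 0, ?_, fun a => ?_⟩
        · by_cases e1 : z₁ = z <;> by_cases e0 : z₀ = z <;> simp [e1, e0, eq_comm (a := z)]
        · rw [h1 u hu]
          by_cases ha : a ∈ B
          · simp [hT, hu, ha, h1]
          · simp [hT, hu, ha, h0]
      · refine ⟨(if z₀ = z then (1 : ℂ) else 0) - if z₁ = z then 1 else 0, ?_, fun a => ?_⟩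
        · by_cases e1 : z₁ = z <;> by_cases e0 : z₀ = z <;> simp [e1, e0, eq_comm (a := z)]
        · rw [h0 u hu]
          by_cases ha : a ∈ B
          · simp [hT, hu, ha, h1]
          · simp [hT, hu, ha, h0]
    have e : ∑ a, (wvec n a : ℂ) *
        (((if g u = z then 1 else 0) - if g a = z then 1 else 0) * v a) =
        c * ∑ a ∈ T u, (wvec n a : ℂ) * v a := by
      rw [Finset.mul_sum, ← Finset.sum_filter_add_sum_filter_not Finset.univ (· ∈ T u)]
      rw [Finset.sum_eq_zero (s := Finset.univ.filter (· ∉ T u)), add_zero]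
      · refine Finset.sum_congr (by ext; simp) fun a ha => ?_
        rw [hc', if_pos ha]
        ring
      · intro a ha
        rw [hc', if_neg (by simpa using ha)]
        simp
    rw [e, norm_mul, norm_mul, mul_pow, mul_pow, hw]
    calc _ = ‖c‖ ^ 2 * (wvec n u ^ 2 * ‖∑ a ∈ T u, (wvec n a : ℂ) * v a‖ ^ 2) := by ring
      _ ≤ _ * (wvec n u ^ 2 * ‖∑ a ∈ T u, (wvec n a : ℂ) * v a‖ ^ 2) :=
        mul_le_mul_of_nonneg_right hc hnn
      _ = _ := by split_ifs <;> ring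
  have hcs : ∀ s : Finset (Option (Bits n)), ‖∑ a ∈ s, (wvec n a : ℂ) * v a‖ ^ 2 ≤
      (∑ a ∈ s, wvec n a ^ 2) * ∑ a ∈ s, ‖v a‖ ^ 2 := by
    intro s
    simpa [hw] using norm_sum_mul_sq_le s (fun a => (wvec n a : ℂ)) v
  -- Each product of weights pairs B, of weight at most β, with its complement, of weight at most
  -- ‖w‖² = 2. With the two outcomes this gives 4β.
  have hc2 : ∑ a ∈ Bᶜ, wvec n a ^ 2 ≤ 2 := by
    rw [← sum_wvec_sq n]
    exact Finset.sum_le_sum_of_subset_of_nonneg (Finset.subset_univ _) fun _ _ _ => by positivity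
  have hβ : 0 ≤ β := (Finset.sum_nonneg fun _ _ => by positivity).trans hB
  have hv : ∀ s : Finset (Option (Bits n)), 0 ≤ ∑ a ∈ s, ‖v a‖ ^ 2 := fun s =>
    Finset.sum_nonneg fun _ _ => by positivity
  have hww : ∀ s : Finset (Option (Bits n)), 0 ≤ ∑ a ∈ s, wvec n a ^ 2 := fun s =>
    Finset.sum_nonneg fun _ _ => by positivity
  calc _ ≤ ∑ u, 2 * (wvec n u ^ 2 * ‖∑ a ∈ T u, (wvec n a : ℂ) * v a‖ ^ 2) := by
        refine Finset.sum_le_sum fun u _ => (Finset.sum_le_sum fun z _ => hz u z).trans ?_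
        rw [Finset.sum_add_distrib]
        simp [two_mul]
    _ = 2 * ((∑ u ∈ B, wvec n u ^ 2) * ‖∑ a ∈ Bᶜ, (wvec n a : ℂ) * v a‖ ^ 2) +
        2 * ((∑ u ∈ Bᶜ, wvec n u ^ 2) * ‖∑ a ∈ B, (wvec n a : ℂ) * v a‖ ^ 2) := by
        rw [← Finset.sum_add_sum_compl B]
        simp only [Finset.sum_mul, Finset.mul_sum]
        congr 1
        · exact Finset.sum_congr rfl fun u hu => by simp [hT, hu]
        · exact Finset.sum_congr rfl fun u hu => by simp [hT, Finset.mem_compl.1 hu]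
    _ ≤ 2 * (β * (2 * ∑ a ∈ Bᶜ, ‖v a‖ ^ 2)) + 2 * (2 * (β * ∑ a ∈ B, ‖v a‖ ^ 2)) := by
        have i1 := (hcs Bᶜ).trans (mul_le_mul_of_nonneg_right hc2 (hv _))
        have i2 := (hcs B).trans (mul_le_mul_of_nonneg_right hB (hv _))
        have := hv Bᶜ
        have := hv B
        gcongr
    _ = _ := by
        rw [← Finset.sum_add_sum_compl B]
        ring

/-- The commutator acts separately on each fibre over the other cells, where the one-cell bound
applies. Fibres on which v vanishes need no hypothesis on g, so that g only has to be two-valued on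
databases that are small enough. -/
lemma sum_commutator_FS_singleton_le {g : DB X n → Z} {β : ℝ} {x : X}
    (v : DB X n → ℂ) (hv : ∀ d, Splits g β x d ∨ ∀ u, v (Function.update d x u) = 0)
    (p : Z → DB X n → Prop) [∀ z, DecidablePred (p z)] (hp : ∀ z d, p z d ↔ g d = z) :
    ∑ z, nsq (fun d => (FS n {x}).mulVec (fun d => if p z d then v d else 0) d -
      if p z d then (FS n {x}).mulVec v d else 0) ≤ 4 * β * nsq v := by
  classical
  simp only [nsq]
  rw [Finset.sum_comm, Finset.mul_sum]
  refine sum_le_sum_of_update x _ _ fun d => ?_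
  have e : ∀ u z, ‖(FS n {x}).mulVec (fun d => if p z d then v d else 0) (Function.update d x u) -
      if p z (Function.update d x u) then (FS n {x}).mulVec v (Function.update d x u) else 0‖ ^ 2 =
      ‖(wvec n u : ℂ) * ∑ a, (wvec n a : ℂ) *
        (((if g (Function.update d x u) = z then 1 else 0) -
          if g (Function.update d x a) = z then 1 else 0) * v (Function.update d x a))‖ ^ 2 := by
    intro u z
    congr 2
    simp only [FS_singleton_mulVec, hp, Function.update_self, Function.update_idem]
    split_ifs
    · simp only [sub_mul, mul_sub, one_mul, Finset.sum_sub_distrib, ite_mul, zero_mul]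
      ring
    · simp only [sub_mul, mul_sub, zero_mul, mul_zero, Finset.sum_sub_distrib, ite_mul, one_mul,
        Finset.sum_const_zero]
      ring
  simp only [e]
  rw [← Finset.mul_sum]
  rcases hv d with ⟨B, z₀, z₁, hB, h⟩ | h
  · exact sum_commutator_cell_le B z₀ z₁ hB (fun u => g (Function.update d x u))
      (fun u => (h u).1) (fun u => (h u).2) fun u => v (Function.update d x u)
  · simp [h]

lemma sum_commutator_ctrlF_le {g : DB X n → Z} {β : ℝ} (ψ : Reg X n E × DB X n → ℂ)
    (hψ : ∀ (r : Reg X n E) d, Splits g β r.1 d ∨ ∀ u, ψ (r, Function.update d r.1 u) = 0) :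
    ∑ z, nsq (ctrlF (fun x => {x}) (res (fun d => g d = z) ψ) -
      res (fun d => g d = z) (ctrlF (fun x => {x}) ψ)) ≤ 4 * β * nsq ψ := by
  classical
  simp only [nsq_prod (R := Reg X n E)]
  rw [Finset.sum_comm, Finset.mul_sum]
  refine Finset.sum_le_sum fun r _ => ?_
  exact sum_commutator_FS_singleton_le (fun d => ψ (r, d)) (hψ r) (fun z d => g d = z) (by simp)

/-- The triangle inequality for a family viewed as a single long vector; the number of members does
not enter. -/
lemma nsq_add_le {κ ι : Type*} [Fintype κ] [Fintype ι] (a b : ι → κ → ℂ) {α β N : ℝ} (hα : 0 ≤ α)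
    (hβ : 0 ≤ β) (hN : 0 ≤ N) (ha : ∑ i, nsq (a i) ≤ α ^ 2 * N) (hb : ∑ i, nsq (b i) ≤ β ^ 2 * N) :
    ∑ i, nsq (a i + b i) ≤ (α + β) ^ 2 * N := by
  have h := sum_norm_add_sq_le (fun p : ι × κ => a p.1 p.2) (fun p => b p.1 p.2) hα hβ hN
  simp only [Fintype.sum_prod_type] at h
  exact h ha hb

/-- The plain query commutes with any measurement of D in the computational basis, so only the two
F's contribute, 2√β each. The vanishing alternative ranges over all y because the plain query moves
amplitude between values of Y. -/
lemma sum_commutator_simQuery_le {g : DB X n → Z} {β : ℝ} (hβ : 0 ≤ β)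
    (ψ : Reg X n E × DB X n → ℂ)
    (hψ : ∀ (r : Reg X n E) d, Splits g β r.1 d ∨ ∀ y u, ψ ((r.1, y, r.2.2), Function.update d r.1 u) = 0) :
    ∑ z, nsq (simQuery.mulVec (res (fun d => g d = z) ψ) -
      res (fun d => g d = z) (simQuery.mulVec ψ)) ≤ (4 * √β) ^ 2 * nsq ψ := by
  set S : X → Finset X := fun x => {x} with hS
  have hcf : ∀ a b : Reg X n E × DB X n → ℂ, ctrlF S (a - b) = ctrlF S a - ctrlF S b := by
    intro a b
    ext i
    exact congrFun (Matrix.mulVec_sub _ (fun d => a (i.1, d)) fun d => b (i.1, d)) i.2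
  have hpl : ∀ a b : Reg X n E × DB X n → ℂ,
      plainQuery (a - b) = plainQuery a - plainQuery b := fun a b => rfl
  have e : ∀ z, simQuery.mulVec (res (fun d => g d = z) ψ) -
      res (fun d => g d = z) (simQuery.mulVec ψ) =
      ctrlF S (plainQuery (ctrlF S (res (fun d => g d = z) ψ) -
        res (fun d => g d = z) (ctrlF S ψ))) +
      (ctrlF S (res (fun d => g d = z) (plainQuery (ctrlF S ψ))) -
        res (fun d => g d = z) (ctrlF S (plainQuery (ctrlF S ψ)))) := by
    intro z
    rw [simQuery_mulVec (S := S) (by simp [hS]), simQuery_mulVec (S := S) (by simp [hS]), hpl, hcf]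
    have : plainQuery (res (fun d => g d = z) (ctrlF S ψ)) =
      res (fun d => g d = z) (plainQuery (ctrlF S ψ)) := rfl
    rw [this]
    abel
  have h4 : (2 * √β) ^ 2 = 4 * β := by rw [mul_pow, Real.sq_sqrt hβ]; norm_num
  simp_rw [e]
  refine (nsq_add_le _ _ (α := 2 * √β) (β := 2 * √β) (by positivity) (by positivity)
    (nsq_nonneg _) ?_ ?_).trans (le_of_eq (by ring))
  · simp_rw [nsq_ctrlF, nsq_plainQuery, h4]
    exact sum_commutator_ctrlF_le ψ fun r d => (hψ r d).imp id fun h u => h _ u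
  · rw [h4, ← nsq_ctrlF S ψ, ← nsq_plainQuery (ctrlF S ψ)]
    refine sum_commutator_ctrlF_le _ fun r d => (hψ r d).imp id fun h u => ?_
    simp only [plainQuery, ctrlF, hS, FS_singleton_mulVec, Function.update_idem, h]
    simp

lemma actD_sub (C : Matrix (DB X n) (DB X n) ℂ) (v w : R × DB X n → ℂ) :
    actD C (v - w) = actD C v - actD C w := by
  ext i
  exact congrFun (Matrix.mulVec_sub C (fun d => v (i.1, d)) fun d => w (i.1, d)) i.2

lemma actD_mul (C C' : Matrix (DB X n) (DB X n) ℂ) (v : R × DB X n → ℂ) :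
    actD (C * C') v = actD C (actD C' v) := by
  ext i
  simp [actD, ← Matrix.mulVec_mulVec]

lemma nsq_actD_FS (s : Finset X) (v : R × DB X n → ℂ) : nsq (actD (FS n s) v) = nsq v := by
  simp only [nsq, Fintype.sum_prod_type (α₂ := DB X n)]
  exact Finset.sum_congr rfl fun r _ => nsq_FS_mulVec _ fun d => v (r, d)

lemma actD_FS_actD_FS (s : Finset X) (v : R × DB X n → ℂ) :
    actD (FS n s) (actD (FS n s) v) = v := by
  rw [← actD_mul, FS_mul_self]
  ext i
  simp [actD]

/-- The measurement is moved past the F's one cell at a time, at a cost of 2√β each. -/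
lemma sum_commutator_actD_FS_le {g : DB X n → Z} {β : ℝ} (hβ : 0 ≤ β)
    (hg : ∀ x d, Splits g β x d) (s : Finset X) (v : R × DB X n → ℂ) :
    ∑ z, nsq (actD (FS n s) (res (fun d => g d = z) v) -
      res (fun d => g d = z) (actD (FS n s) v)) ≤ (s.card * (2 * √β)) ^ 2 * nsq v := by
  classical
  induction s using Finset.induction_on with
  | empty =>
    have : FS n (∅ : Finset X) = 1 := by
      rw [← tens_one, FS]
      congr 1
    have h1 : ∀ w : R × DB X n → ℂ, actD 1 w = w := fun w => by ext; simp [actD]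
    simp [this, nsq, h1]
  | insert x s hx ih =>
    have e : ∀ z, actD (FS n (insert x s)) (res (fun d => g d = z) v) -
        res (fun d => g d = z) (actD (FS n (insert x s)) v) =
        actD (FS n {x}) (actD (FS n s) (res (fun d => g d = z) v) -
          res (fun d => g d = z) (actD (FS n s) v)) +
        (actD (FS n {x}) (res (fun d => g d = z) (actD (FS n s) v)) -
          res (fun d => g d = z) (actD (FS n {x}) (actD (FS n s) v))) := by
      intro z
      rw [FS_insert hx, actD_mul, actD_mul, actD_sub]
      abel
    simp_rw [e]
    refine (nsq_add_le _ _ (α := s.card * (2 * √β)) (β := 2 * √β) (by positivity) (by positivity)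
      (nsq_nonneg v) ?_ ?_).trans (le_of_eq ?_)
    · simpa only [nsq_actD_FS] using ih
    · rw [mul_pow, Real.sq_sqrt hβ, ← nsq_actD_FS s v]
      simp only [nsq_prod (R := R)]
      rw [Finset.sum_comm, Finset.mul_sum]
      refine Finset.sum_le_sum fun r _ => ?_
      have := sum_commutator_FS_singleton_le (fun d => actD (FS n s) v (r, d))
        (fun d => Or.inl (hg x d)) (fun z d => g d = z) (by simp)
      norm_num
      exact this
    · rw [Finset.card_insert_of_notMem hx]
      push_cast
      ring

lemma actD_classicalQueries {s : Finset X} {xs : Fin ℓ → Option X} (hx : ∀ i, ∀ x ∈ xs i, x ∈ s)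
    (h : Fin ℓ → Option (Bits n)) (v : R × DB X n → ℂ) :
    actD (classicalQueries xs h) v =
      actD (FS n s) (res (fun d => responses xs d = h) (actD (FS n s) v)) := by
  rw [classicalQueries_eq hx, actD_mul, actD_mul]
  unfold actD
  ext a
  simp only [diagonal_ite_mulVec, ← Matrix.mulVec_mulVec, res, eq_comm (a := h)]

/-- The queries are two layers of F on at most ℓ cells around a measurement that commutes with g.
Each layer costs ℓ · 2√β, and summing over the responses is free because they belong to orthogonal
projections. -/
lemma sum_commutator_classicalQueries_le {g : DB X n → Z} {β : ℝ} (hβ : 0 ≤ β)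
    (hg : ∀ x d, Splits g β x d) (xs : Fin ℓ → Option X) (v : R × DB X n → ℂ) :
    ∑ z, ∑ h, nsq (actD (classicalQueries xs h) (res (fun d => g d = z) v) -
      res (fun d => g d = z) (actD (classicalQueries xs h) v)) ≤ (ℓ * (4 * √β)) ^ 2 * nsq v := by
  classical
  obtain ⟨s, hs, hc⟩ : ∃ s : Finset X, (∀ i, ∀ x ∈ xs i, x ∈ s) ∧ s.card ≤ ℓ := by
    refine ⟨(Finset.univ.image xs).eraseNone, fun i x hx => ?_, ?_⟩
    · simp only [Finset.mem_eraseNone, Finset.mem_image, Finset.mem_univ, true_and]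
      exact ⟨i, hx⟩
    · calc _ ≤ (Finset.univ.image xs).card := Finset.card_eraseNone_le _
        _ ≤ _ := Finset.card_image_le.trans (by simp)
  have e : ∀ z h, actD (classicalQueries xs h) (res (fun d => g d = z) v) -
        res (fun d => g d = z) (actD (classicalQueries xs h) v) =
      actD (FS n s) (res (fun d => responses xs d = h) (actD (FS n s) (res (fun d => g d = z) v) -
          res (fun d => g d = z) (actD (FS n s) v))) +
      (actD (FS n s) (res (fun d => g d = z) (res (fun d => responses xs d = h)
          (actD (FS n s) v))) -
        res (fun d => g d = z) (actD (FS n s) (res (fun d => responses xs d = h)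
          (actD (FS n s) v)))) := by
    intro z h
    rw [actD_classicalQueries hs, actD_classicalQueries hs, res_sub, actD_sub]
    have : res (fun d => responses xs d = h) (res (fun d => g d = z) (actD (FS n s) v)) =
        res (fun d => g d = z) (res (fun d => responses xs d = h) (actD (FS n s) v)) := by
      rw [res_res, res_res]
      simp only [and_comm]
    rw [this]
    abel
  have hb := sum_commutator_actD_FS_le (R := R) (g := g) hβ hg s
  have key := nsq_add_le (N := nsq v) (α := s.card * (2 * √β)) (β := s.card * (2 * √β))
    (fun p : Z × (Fin ℓ → Option (Bits n)) => actD (FS n s) (res (fun d => responses xs d = p.2)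
      (actD (FS n s) (res (fun d => g d = p.1) v) - res (fun d => g d = p.1) (actD (FS n s) v))))
    (fun p => (actD (FS n s) (res (fun d => g d = p.1) (res (fun d => responses xs d = p.2)
          (actD (FS n s) v))) -
        res (fun d => g d = p.1) (actD (FS n s) (res (fun d => responses xs d = p.2)
          (actD (FS n s) v))))) (by positivity) (by positivity) (nsq_nonneg _) ?_ ?_
  · simp only [Fintype.sum_prod_type, ← e] at key
    refine key.trans (mul_le_mul_of_nonneg_right ?_ (nsq_nonneg _))
    have : (s.card : ℝ) ≤ ℓ := by exact_mod_cast hc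
    have h0 : 0 ≤ √β := Real.sqrt_nonneg _
    rw [show (s.card : ℝ) * (2 * √β) + s.card * (2 * √β) = s.card * (4 * √β) by ring]
    gcongr
  · simp only [Fintype.sum_prod_type, nsq_actD_FS, sum_nsq_res]
    exact hb v
  · simp only [Fintype.sum_prod_type]
    rw [Finset.sum_comm]
    refine (Finset.sum_le_sum fun h _ => hb _).trans ?_
    rw [← Finset.mul_sum, sum_nsq_res, nsq_actD_FS]

end Oracle

/-! ### The extraction interface as a function of the database -/

section Extract

variable {X T : Type*} {n : ℕ} [Fintype X] [LinearOrder X]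

open Classical in
/-- The outcome of the extraction for a database in the computational basis. -/
def extracted (f : X → Bits n → T) (t : T) (d : DB X n) : Option X :=
  if h : (Finset.univ.filter (Hits f t d)).Nonempty then
    some ((Finset.univ.filter (Hits f t d)).min' h) else none

lemma extracted_eq_some {f : X → Bits n → T} {t : T} {d : DB X n} {x : X} :
    extracted f t d = some x ↔ Hits f t d x ∧ ∀ x' < x, ¬ Hits f t d x' := by
  classical
  unfold extracted
  split_ifs with h
  · rw [Option.some_inj]
    constructor
    · rintro rfl
      refine ⟨(Finset.mem_filter.1 (Finset.min'_mem _ h)).2, fun x' hx' hh => ?_⟩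
      exact absurd (Finset.min'_le _ x' (by simpa using hh)) (not_le.2 hx')
    · rintro ⟨h1, h2⟩
      refine le_antisymm (Finset.min'_le _ _ (by simpa using h1)) (not_lt.1 fun hlt => ?_)
      exact h2 _ hlt (Finset.mem_filter.1 (Finset.min'_mem _ h)).2
  · refine ⟨fun h' => by simp at h', fun h' => absurd ⟨x, by simpa using h'.1⟩ h⟩

lemma extracted_eq_none {f : X → Bits n → T} {t : T} {d : DB X n} :
    extracted f t d = none ↔ ∀ x, ¬ Hits f t d x := by
  classical
  unfold extracted
  split_ifs with h
  · obtain ⟨x, hx⟩ := h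
    simp only [reduceCtorEq, false_iff, not_forall, not_not]
    exact ⟨x, (Finset.mem_filter.1 hx).2⟩
  · simp only [true_iff]
    exact fun x hx => h ⟨x, by simpa using hx⟩

lemma extracted_congr {f : X → Bits n → T} {t : T} {d d' : DB X n}
    (h : ∀ x, Hits f t d x ↔ Hits f t d' x) : extracted f t d = extracted f t d' := by
  ext x
  simp only [extracted_eq_some, h]

lemma extractProj_eq (f : X → Bits n → T) (t : T) (z : Option X) :
    extractProj f t z =
      Matrix.diagonal fun d : DB X n => if extracted f t d = z then (1 : ℂ) else 0 := by
  ext d d'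
  rcases z with _ | x
  · simp only [extractProj, Matrix.diagonal_apply]
    congr 2
    exact propext extracted_eq_none.symm
  · simp only [extractProj, Matrix.diagonal_apply]
    congr 2
    exact propext extracted_eq_some.symm

lemma one_kronecker_extractProj_mulVec {R : Type*} [Fintype R] [DecidableEq R]
    (f : X → Bits n → T) (t : T) (z : Option X) (v : R × DB X n → ℂ) :
    ((1 : Matrix R R ℂ) ⊗ₖ extractProj f t z).mulVec v =
      res (fun d => extracted f t d = z) v := by
  rw [one_kronecker_mulVec, extractProj_eq]
  ext a
  simp only [actD, diagonal_ite_mulVec, res]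
  congr

lemma hits_update_of_ne {f : X → Bits n → T} {t : T} {d : DB X n} {x x' : X} (h : x' ≠ x)
    (u : Option (Bits n)) : Hits f t (Function.update d x u) x' ↔ Hits f t d x' := by
  simp [Hits, h]

lemma hits_update_self {f : X → Bits n → T} {t : T} {d : DB X n} {x : X}
    (u : Option (Bits n)) : Hits f t (Function.update d x u) x ↔ ∃ y, u = some y ∧ f x y = t := by
  simp [Hits]

lemma sum_wvec_sq_map (B : Finset (Bits n)) :
    ∑ u ∈ B.map Function.Embedding.some, wvec n u ^ 2 = B.card / 2 ^ n := by
  simp only [Finset.sum_map, Function.Embedding.some_apply, wvec, neg_sq, inv_sqrt_two_pow_sq,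
    Finset.sum_const, nsmul_eq_mul]
  rfl

lemma card_filter_le_Gam [Fintype T] [DecidableEq T] (f : X → Bits n → T) (x : X) (t : T) :
    (Finset.univ.filter fun y => f x y = t).card ≤ Gam f :=
  Finset.le_sup (f := fun p : X × T => (Finset.univ.filter fun y => f p.1 y = p.2).card)
    (Finset.mem_univ (x, t))

/-- If an earlier cell already hits t, the content of D_x is irrelevant. Otherwise the outcome is x
on the at most Γ preimages of t, and is as for D_x = ⊥ elsewhere; each bit string has w-weight
2^{-n}. -/
lemma splits_extracted [Fintype T] [DecidableEq T] (f : X → Bits n → T) (t : T) (x : X)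
    (d : DB X n) : Splits (extracted f t) (Gam f / 2 ^ n) x d := by
  by_cases h : ∃ x' < x, Hits f t d x'
  · refine ⟨∅, extracted f t (Function.update d x none), none, by simp; positivity,
      fun u => ⟨by simp, fun _ => ?_⟩⟩
    obtain ⟨x', hx', hh⟩ := h
    rcases hz : extracted f t (Function.update d x none) with _ | x₁
    · exact absurd ((hits_update_of_ne hx'.ne none).2 hh) (extracted_eq_none.1 hz x')
    · rw [extracted_eq_some] at hz ⊢
      have h1 : x₁ ≤ x' := by
        by_contra hlt
        exact hz.2 x' (not_le.1 hlt) ((hits_update_of_ne hx'.ne none).2 hh)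
      have h2 := h1.trans_lt hx'
      rw [hits_update_of_ne h2.ne] at hz ⊢
      refine ⟨hz.1, fun x'' hx'' => ?_⟩
      rw [hits_update_of_ne (hx''.trans h2).ne]
      have := hz.2 x'' hx''
      rwa [hits_update_of_ne (hx''.trans h2).ne] at this
  · push Not at h
    refine ⟨(Finset.univ.filter fun y => f x y = t).map Function.Embedding.some,
      extracted f t (Function.update d x none), some x, ?_, fun u => ⟨fun hu => ?_, fun hu => ?_⟩⟩
    · rw [sum_wvec_sq_map]
      have := card_filter_le_Gam f x t
      gcongr
    · rw [extracted_eq_some, hits_update_self]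
      refine ⟨?_, fun x' hx' => by rw [hits_update_of_ne hx'.ne]; exact h x' hx'⟩
      simp only [Finset.mem_map, Finset.mem_filter, Finset.mem_univ, true_and,
        Function.Embedding.some_apply] at hu
      obtain ⟨y, hy, rfl⟩ := hu
      exact ⟨y, rfl, hy⟩
    · refine extracted_congr fun x' => ?_
      by_cases hx : x' = x
      · subst hx
        rw [hits_update_self, hits_update_self]
        simp only [Finset.mem_map, Finset.mem_filter, Finset.mem_univ, true_and,
          Function.Embedding.some_apply, not_exists] at hu
        simp only [reduceCtorEq, false_and, exists_false, iff_false, not_exists, not_and]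
        rintro y rfl hy
        exact hu y ⟨hy, rfl⟩
      · rw [hits_update_of_ne hx, hits_update_of_ne hx]

end Extract

/-! ### The number of cells in use -/

section Size

variable {X : Type*} {n : ℕ} [Fintype X] [DecidableEq X]

/-- The number of cells that are not `⊥`. -/
def dbSize (d : DB X n) : ℕ := (Finset.univ.filter fun x => d x ≠ none).card

lemma dbSize_le_card (d : DB X n) : dbSize d ≤ Fintype.card X := Finset.card_le_univ _

lemma dbSize_update_none_le (d : DB X n) (x : X) (u : Option (Bits n)) :
    dbSize (Function.update d x none) ≤ dbSize (Function.update d x u) := by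
  refine Finset.card_le_card fun x' => ?_
  by_cases h : x' = x
  · subst h; simp
  · simp [h]

lemma dbSize_le_add_one {d d' : DB X n} {x : X} (h : ∀ x', x' ≠ x → d x' = d' x') :
    dbSize d ≤ dbSize d' + 1 := by
  unfold dbSize
  refine le_trans (Finset.card_le_card (t := insert x (Finset.univ.filter fun x => d' x ≠ none))
    fun x' hx' => ?_) (Finset.card_insert_le _ _)
  by_cases hx : x' = x
  · simp [hx]
  · simpa [hx, h x' hx] using hx'

/-- `v` is supported on databases with at most `k` cells in use. -/
def SizeLE {R : Type*} (k : ℕ) (v : R × DB X n → ℂ) : Prop := ∀ a, k < dbSize a.2 → v a = 0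

/-- A query changes only one cell in each term. -/
lemma SizeLE.simQuery {E : Type*} [Fintype E] [DecidableEq E] {k : ℕ}
    {ψ : Reg X n E × DB X n → ℂ} (h : SizeLE k ψ) : SizeLE (k + 1) (simQuery.mulVec ψ) := by
  intro a ha
  refine Finset.sum_eq_zero fun b _ => ?_
  simp only [QROM.simQuery, Matrix.of_apply, compressedOracle]
  split_ifs with h1 h2
  · have := dbSize_le_add_one h2.2
    rw [h b (by omega), mul_zero]
  · simp
  · simp

end Size

/-! ### Branches of a program -/

section Programs

universe u

variable {X : Type u} {T E W Z : Type*} {n ℓ : ℕ} [Fintype X] [LinearOrder X]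
  [Fintype E] [DecidableEq E] [Fintype W] [Fintype Z]

/-- The sequences of measurement outcomes of a program. -/
def Branch : {j q : ℕ} → Program X n T E W ℓ j q → Type
  | _, _, .finish m _ _ _ => Fin m
  | _, _, .query next => Branch next
  | _, _, .announce _ next => Branch next
  | _, _, .measure m _ _ next => Σ k : Fin m, Branch (next k)

instance Branch.fintype : {j q : ℕ} → (P : Program X n T E W ℓ j q) → Fintype (Branch P)
  | _, _, .finish m _ _ _ => inferInstanceAs (Fintype (Fin m))
  | _, _, .query next => Branch.fintype next
  | _, _, .announce _ next => Branch.fintype next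
  | _, _, .measure m _ _ next =>
    letI := fun k => Branch.fintype (next k)
    inferInstanceAs (Fintype (Σ k : Fin m, Branch (next k)))

/-- The sequences of extraction outcomes along a branch. -/
def Outs : {j q : ℕ} → (P : Program X n T E W ℓ j q) → Branch P → Type u
  | _, _, .finish _ _ _ _, _ => PUnit.{u + 1}
  | _, _, .query next, b => Outs next b
  | _, _, .announce _ next, b => Option X × Outs next b
  | _, _, .measure _ _ _ next, b => Outs (next b.1) b.2

instance Outs.fintype : {j q : ℕ} → (P : Program X n T E W ℓ j q) → (b : Branch P) →
    Fintype (Outs P b)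
  | _, _, .finish _ _ _ _, _ => inferInstanceAs (Fintype PUnit.{u + 1})
  | _, _, .query next, b => Outs.fintype next b
  | _, _, .announce _ next, b =>
    letI := Outs.fintype next b
    inferInstanceAs (Fintype (Option X × Outs next b))
  | _, _, .measure _ _ _ next, b => Outs.fintype (next b.1) b.2

lemma sum_branch_measure {M : Type*} [AddCommMonoid M] {j q m : ℕ}
    {K : Fin m → Matrix (Reg X n E) (Reg X n E) ℂ} {hK : IsInstrument K}
    {next : Fin m → Program X n T E W ℓ j q} (F : Branch (.measure m K hK next) → M) :
    ∑ b, F b = ∑ k, ∑ b : Branch (next k), F ⟨k, b⟩ :=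
  Fintype.sum_sigma (α := fun k => Branch (next k)) F

lemma sum_outs_announce {M : Type*} [AddCommMonoid M] {j q : ℕ} {t : T}
    {next : Program X n T E W ℓ (j + 1) q} {b : Branch next}
    (F : Outs (.announce t next) b → M) :
    @Finset.sum _ _ _ (@Finset.univ _ (Outs.fintype (.announce t next) b)) F = ∑ z : Option X, ∑ o : Outs next b, F (z, o) :=
  Fintype.sum_prod_type (α₁ := Option X) (α₂ := Outs next b) F

lemma sum_outs_finish {M : Type*} [AddCommMonoid M] {q m : ℕ}
    {K : Fin m → Matrix W (Reg X n E) ℂ} {hK : IsInstrument K} {out : Fin m → Fin ℓ → Option X}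
    {b : Branch (.finish (T := T) (q := q) m K hK out)} (F : Outs (.finish (T := T) (q := q) m K hK out) b → M) :
    @Finset.sum _ _ _ (@Finset.univ _ (Outs.fintype (.finish (T := T) (q := q) m K hK out) b)) F = F PUnit.unit :=
  Fintype.sum_unique (ι := PUnit.{u + 1}) F

/-- The values announced along a branch. -/
def announced : {j q : ℕ} → (P : Program X n T E W ℓ j q) → Branch P → (Fin j → T) → Fin ℓ → T
  | _, _, .finish _ _ _ _, _, τ => τ
  | _, _, .query next, b, τ => announced next b τ
  | _, _, .announce t next, b, τ => announced next b (Fin.snoc (α := fun _ => T) τ t)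
  | _, _, .measure _ _ _ next, b, τ => announced (next b.1) b.2 τ

/-- The final outputs of a branch. -/
def outputs : {j q : ℕ} → (P : Program X n T E W ℓ j q) → Branch P → Fin ℓ → Option X
  | _, _, .finish _ _ _ out, k => out k
  | _, _, .query next, b => outputs next b
  | _, _, .announce _ next, b => outputs next b
  | _, _, .measure _ _ _ next, b => outputs (next b.1) b.2

/-- All extraction outcomes, given those before the program was started. -/
def extractions : {j q : ℕ} → (P : Program X n T E W ℓ j q) → (b : Branch P) → Outs P b →
    (Fin j → Option X) → Fin ℓ → Option X
  | _, _, .finish _ _ _ _, _, _, ξ => ξ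
  | _, _, .query next, b, o, ξ => extractions next b o ξ
  | _, _, .announce _ next, b, o, ξ =>
    extractions next b o.2 (Fin.snoc (α := fun _ => Option X) ξ o.1)
  | _, _, .measure _ _ _ next, b, o, ξ => extractions (next b.1) b.2 o ξ

/-- The final (unnormalized) state of a branch in the run with the simulator, if the extraction
interface is not used. -/
def branchVec : {j q : ℕ} → (P : Program X n T E W ℓ j q) → Branch P →
    (Reg X n E × DB X n → ℂ) → W × DB X n → ℂ
  | _, _, .finish _ K _ _, k, ψ => (K k ⊗ₖ (1 : Matrix (DB X n) (DB X n) ℂ)).mulVec ψ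
  | _, _, .query next, b, ψ => branchVec next b (simQuery.mulVec ψ)
  | _, _, .announce _ next, b, ψ => branchVec next b ψ
  | _, _, .measure _ K _ next, b, ψ =>
    branchVec (next b.1) b.2 ((K b.1 ⊗ₖ (1 : Matrix (DB X n) (DB X n) ℂ)).mulVec ψ)

/-- The final (unnormalized) state of a branch in the run with the simulator. -/
def extractVec (f : X → Bits n → T) : {j q : ℕ} → (P : Program X n T E W ℓ j q) → (b : Branch P) →
    Outs P b → (Reg X n E × DB X n → ℂ) → W × DB X n → ℂ
  | _, _, .finish _ K _ _, k, _, ψ => (K k ⊗ₖ (1 : Matrix (DB X n) (DB X n) ℂ)).mulVec ψ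
  | _, _, .query next, b, o, ψ => extractVec f next b o (simQuery.mulVec ψ)
  | _, _, .announce t next, b, o, ψ =>
    extractVec f next b o.2 (res (fun d => extracted f t d = o.1) ψ)
  | _, _, .measure _ K _ next, b, o, ψ =>
    extractVec f (next b.1) b.2 o ((K b.1 ⊗ₖ (1 : Matrix (DB X n) (DB X n) ℂ)).mulVec ψ)

/-- For the database `d`, the extraction outcomes are `o`. -/
def Matches (f : X → Bits n → T) : {j q : ℕ} → (P : Program X n T E W ℓ j q) → (b : Branch P) →
    Outs P b → DB X n → Prop
  | _, _, .finish _ _ _ _, _, _, _ => True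
  | _, _, .query next, b, o, d => Matches f next b o d
  | _, _, .announce t next, b, o, d => Matches f next b o.2 d ∧ extracted f t d = o.1
  | _, _, .measure _ _ _ next, b, o, d => Matches f (next b.1) b.2 o d

lemma kronecker_one_mulVec {A B : Type*} [Fintype A] (K : Matrix B A ℂ) (ψ : A × DB X n → ℂ)
    (a : B × DB X n) : (K ⊗ₖ (1 : Matrix (DB X n) (DB X n) ℂ)).mulVec ψ a =
      K.mulVec (fun r => ψ (r, a.2)) a.1 := by
  simp [Matrix.mulVec, dotProduct, Fintype.sum_prod_type, Matrix.one_apply]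

lemma kronecker_one_mulVec_res {A B : Type*} [Fintype A] (K : Matrix B A ℂ) (p : DB X n → Prop)
    (ψ : A × DB X n → ℂ) : (K ⊗ₖ (1 : Matrix (DB X n) (DB X n) ℂ)).mulVec (res p ψ) =
      res p ((K ⊗ₖ (1 : Matrix (DB X n) (DB X n) ℂ)).mulVec ψ) := by
  ext a
  rw [kronecker_one_mulVec]
  by_cases h : p a.2
  · simp [res, h, kronecker_one_mulVec]
  · simp only [res, h, if_false]
    exact congrFun (Matrix.mulVec_zero K) a.1

lemma SizeLE.kronecker_one {A B : Type*} [Fintype A] (K : Matrix B A ℂ) {k : ℕ}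
    {ψ : A × DB X n → ℂ} (h : SizeLE k ψ) :
    SizeLE k ((K ⊗ₖ (1 : Matrix (DB X n) (DB X n) ℂ)).mulVec ψ) := by
  intro a ha
  rw [kronecker_one_mulVec]
  have : (fun r => ψ (r, a.2)) = 0 := funext fun r => h (r, a.2) ha
  rw [this, Matrix.mulVec_zero, Pi.zero_apply]

lemma sum_nsq_instrument {A B : Type*} [Fintype A] [DecidableEq A] [Fintype B] {m : ℕ}
    {K : Fin m → Matrix B A ℂ} (hK : IsInstrument K) (ψ : A × DB X n → ℂ) :
    ∑ k, nsq ((K k ⊗ₖ (1 : Matrix (DB X n) (DB X n) ℂ)).mulVec ψ) = nsq ψ := by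
  refine sum_nsq_mulVec (fun k => K k ⊗ₖ (1 : Matrix (DB X n) (DB X n) ℂ)) ?_ ψ
  simp_rw [Matrix.conjTranspose_kronecker, ← Matrix.mul_kronecker_mul]
  rw [Matrix.conjTranspose_one, Matrix.one_mul]
  have : ∑ k, ((K k).conjTranspose * K k) ⊗ₖ (1 : Matrix (DB X n) (DB X n) ℂ) =
      (∑ k, (K k).conjTranspose * K k) ⊗ₖ (1 : Matrix (DB X n) (DB X n) ℂ) := by
    ext a b
    simp [Matrix.sum_apply, Finset.sum_mul]
  rw [this, hK, Matrix.one_kronecker_one]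

lemma branchVec_sub {j q : ℕ} (P : Program X n T E W ℓ j q) (b : Branch P)
    (ψ φ : Reg X n E × DB X n → ℂ) :
    branchVec P b (ψ - φ) = branchVec P b ψ - branchVec P b φ := by
  induction P generalizing ψ φ with
  | finish m K hK out => exact Matrix.mulVec_sub _ _ _
  | query next ih =>
    simp only [branchVec, Matrix.mulVec_sub]
    exact ih _ _ _
  | announce t next ih => exact ih _ _ _
  | measure m K hK next ih =>
    obtain ⟨k, b⟩ := b
    simp only [branchVec, Matrix.mulVec_sub]
    exact ih _ _ _ _

lemma sum_nsq_branchVec {j q : ℕ} (P : Program X n T E W ℓ j q) (ψ : Reg X n E × DB X n → ℂ) :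
    ∑ b, nsq (branchVec P b ψ) = nsq ψ := by
  induction P generalizing ψ with
  | finish m K hK out => exact sum_nsq_instrument hK ψ
  | query next ih => exact (ih _).trans (nsq_simQuery_mulVec ψ)
  | announce t next ih => exact ih _
  | measure m K hK next ih =>
    rw [← sum_nsq_instrument hK ψ]
    rw [sum_branch_measure]
    refine Finset.sum_congr rfl fun k _ => ?_
    exact ih k ((K k ⊗ₖ (1 : Matrix (DB X n) (DB X n) ℂ)).mulVec ψ)

lemma SizeLE.branchVec {j q : ℕ} (P : Program X n T E W ℓ j q) (b : Branch P) {k : ℕ}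
    {ψ : Reg X n E × DB X n → ℂ} (h : SizeLE k ψ) : SizeLE (k + q) (branchVec P b ψ) := by
  induction P generalizing k ψ with
  | finish m K hK out =>
    intro a ha
    exact h.kronecker_one (K b) a (by omega)
  | @query j q next ih =>
    have := ih b h.simQuery
    rwa [add_assoc, add_comm 1] at this
  | announce t next ih => exact ih b h
  | measure m K hK next ih =>
    obtain ⟨k, b⟩ := b
    exact ih k b (h.kronecker_one (K k))

/-- A two-valued measurement of the database almost commutes with the run of a program. -/
lemma sum_commutator_branchVec_le {g : DB X n → Z} {β : ℝ} {Q : ℕ} (hβ : 0 ≤ β)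
    (hg : ∀ x d, dbSize (Function.update d x none) ≤ Q → Splits g β x d) {j q : ℕ}
    (P : Program X n T E W ℓ j q) {k : ℕ} (hk : k + q ≤ Q + 1)
    {ψ : Reg X n E × DB X n → ℂ} (hψ : SizeLE k ψ) :
    ∑ b, ∑ z, nsq (branchVec P b (res (fun d => g d = z) ψ) -
      res (fun d => g d = z) (branchVec P b ψ)) ≤ (q * (4 * √β)) ^ 2 * nsq ψ := by
  induction P generalizing k ψ with
  | finish m K hK out =>
    refine le_trans (le_of_eq ?_) (mul_nonneg (sq_nonneg _) (nsq_nonneg _))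
    refine Finset.sum_eq_zero fun b _ => Finset.sum_eq_zero fun z _ => ?_
    simp only [branchVec, kronecker_one_mulVec_res, sub_self]
    simp [nsq]
  | @query j q next ih =>
    have e : ∀ (b : Branch next) z, branchVec next b (simQuery.mulVec (res (fun d => g d = z) ψ)) -
        res (fun d => g d = z) (branchVec next b (simQuery.mulVec ψ)) =
        branchVec next b (simQuery.mulVec (res (fun d => g d = z) ψ) -
          res (fun d => g d = z) (simQuery.mulVec ψ)) +
        (branchVec next b (res (fun d => g d = z) (simQuery.mulVec ψ)) -
          res (fun d => g d = z) (branchVec next b (simQuery.mulVec ψ))) := by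
      intro b z
      rw [branchVec_sub]
      abel
    have key := nsq_add_le (N := nsq ψ) (α := 4 * √β) (β := q * (4 * √β))
      (fun p : Branch next × Z => branchVec next p.1 (simQuery.mulVec (res (fun d => g d = p.2) ψ) -
          res (fun d => g d = p.2) (simQuery.mulVec ψ)))
      (fun p => (branchVec next p.1 (res (fun d => g d = p.2) (simQuery.mulVec ψ)) -
          res (fun d => g d = p.2) (branchVec next p.1 (simQuery.mulVec ψ))))
      (by positivity) (by positivity) (nsq_nonneg _) ?_ ?_
    · simp only [Fintype.sum_prod_type, ← e] at key
      refine key.trans (le_of_eq ?_)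
      push_cast
      ring
    · simp only [Fintype.sum_prod_type]
      rw [Finset.sum_comm]
      simp only [sum_nsq_branchVec]
      refine sum_commutator_simQuery_le hβ ψ fun r d => ?_
      -- Before this query k ≤ Q. If the database with this cell emptied already has more than Q
      -- occupied cells, then so has every refilling, and the whole fibre lies outside the support
      -- of ψ.
      by_cases hd : dbSize (Function.update d r.1 none) ≤ Q
      · exact Or.inl (hg _ _ hd)
      · refine Or.inr fun y u => hψ _ ?_
        have := dbSize_update_none_le d r.1 u
        simp only
        omega
    · simp only [Fintype.sum_prod_type]
      rw [← nsq_simQuery_mulVec ψ]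
      exact ih (by omega) hψ.simQuery
  | announce t next ih => exact ih hk hψ
  | @measure j q m K hK next ih =>
    rw [← sum_nsq_instrument hK ψ, Finset.mul_sum]
    rw [sum_branch_measure]
    refine Finset.sum_le_sum fun k _ => ?_
    simp only [branchVec, kronecker_one_mulVec_res]
    exact ih k hk (hψ.kronecker_one (K k))

/-- Along a fixed branch, each database determines exactly one sequence of extraction outcomes, so
the projections form a complete measurement. -/
lemma sum_nsq_res_matches (f : X → Bits n → T) {R : Type*} [Fintype R] {j q : ℕ}
    (P : Program X n T E W ℓ j q) (b : Branch P) (v : R × DB X n → ℂ) :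
    ∑ o, nsq (res (Matches f P b o) v) = nsq v := by
  induction P generalizing v with
  | finish m K hK out =>
    have : res (fun _ : DB X n => True) v = v := by ext; simp [res]
    refine (sum_outs_finish _).trans ?_
    exact congrArg nsq this
  | query next ih => exact ih b v
  | announce t next ih =>
    change Branch next at b
    refine (sum_outs_announce _).trans ?_
    rw [← sum_nsq_res (extracted f t) v]
    refine Finset.sum_congr rfl fun z _ => ?_
    rw [← ih b]
    refine Finset.sum_congr rfl fun o _ => ?_
    rw [res_res]
    rfl
  | measure m K hK next ih =>
    obtain ⟨k, b⟩ := b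
    exact ih k b v

/-- Some branch reaches `finish`, where all ℓ values are announced: a measurement with no outcomes
would violate completeness on a nonempty register. This makes the truncated difference ℓ − j drop by
one at each announcement. -/
lemma Program.le {j q : ℕ} (P : Program X n T E W ℓ j q) [Nonempty (Reg X n E)] : j ≤ ℓ := by
  induction P with
  | finish m K hK out => exact le_rfl
  | query next ih => exact ih
  | announce t next ih => omega
  | measure m K hK next ih =>
    rcases m with _ | m
    · have r := Classical.arbitrary (Reg X n E)
      have := congrFun (congrFun hK r) r
      simp at this
    · exact ih 0

lemma sizeLE_card {R : Type*} (v : R × DB X n → ℂ) : SizeLE (Fintype.card X) v :=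
  fun a ha => absurd (dbSize_le_card a.2) (not_le.2 ha)

/-- The extractions may be postponed until after the run. -/
lemma sum_extractVec_sub_le [Fintype T] [DecidableEq T] [Nonempty (Reg X n E)]
    (f : X → Bits n → T) {j q : ℕ} (P : Program X n T E W ℓ j q) (ψ : Reg X n E × DB X n → ℂ) :
    ∑ b, ∑ o, nsq (extractVec f P b o ψ - res (Matches f P b o) (branchVec P b ψ)) ≤
      (((ℓ - j : ℕ) : ℝ) * (q * (4 * √(Gam f / 2 ^ n)))) ^ 2 * nsq ψ := by
  induction P generalizing ψ with
  | finish m K hK out =>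
    refine le_trans (le_of_eq ?_) (mul_nonneg (sq_nonneg _) (nsq_nonneg _))
    refine Finset.sum_eq_zero fun b _ => Finset.sum_eq_zero fun z _ => ?_
    have : ∀ w : W × DB X n → ℂ, res (fun _ : DB X n => True) w = w := fun w => by ext; simp [res]
    simp only [extractVec, branchVec]
    exact (congrArg nsq (congrArg₂ (· - ·) rfl (this _))).trans (by simp [nsq])
  | @query j q next ih =>
    refine (ih (simQuery.mulVec ψ)).trans ?_
    rw [nsq_simQuery_mulVec]
    have := nsq_nonneg ψ
    gcongr
    simp
  | @announce j q t next ih =>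
    have hj := next.le
    -- First the later extractions are postponed, starting from the projected state; then the
    -- present one is moved past the rest of the run.
    have e : ∀ (b : Branch next) (z : Option X) (o : Outs next b),
        extractVec f next b o (res (fun d => extracted f t d = z) ψ) -
          res (fun d => Matches f next b o d ∧ extracted f t d = z) (branchVec next b ψ) =
        (extractVec f next b o (res (fun d => extracted f t d = z) ψ) -
          res (Matches f next b o) (branchVec next b (res (fun d => extracted f t d = z) ψ))) +
        res (Matches f next b o) (branchVec next b (res (fun d => extracted f t d = z) ψ) -
          res (fun d => extracted f t d = z) (branchVec next b ψ)) := by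
      intro b z o
      rw [res_sub, res_res]
      abel
    have key := nsq_add_le (N := nsq ψ)
      (α := ((ℓ - (j + 1) : ℕ) : ℝ) * (q * (4 * √(Gam f / 2 ^ n))))
      (β := q * (4 * √(Gam f / 2 ^ n)))
      (fun p : Σ b : Branch next, Option X × Outs next b =>
        (extractVec f next p.1 p.2.2 (res (fun d => extracted f t d = p.2.1) ψ) -
          res (Matches f next p.1 p.2.2)
            (branchVec next p.1 (res (fun d => extracted f t d = p.2.1) ψ))))
      (fun p => res (Matches f next p.1 p.2.2)
          (branchVec next p.1 (res (fun d => extracted f t d = p.2.1) ψ) -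
          res (fun d => extracted f t d = p.2.1) (branchVec next p.1 ψ)))
      (by positivity) (by positivity) (nsq_nonneg _) ?_ ?_
    · simp only [Fintype.sum_sigma, Fintype.sum_prod_type, ← e] at key
      refine (le_of_eq ?_).trans (key.trans (le_of_eq ?_))
      · refine Finset.sum_congr rfl fun b _ => ?_
        exact sum_outs_announce _
      · have : ((ℓ - j : ℕ) : ℝ) = ((ℓ - (j + 1) : ℕ) : ℝ) + 1 := by
          rw [show ℓ - j = ℓ - (j + 1) + 1 by omega]
          push_cast
          rfl
        rw [this]
        ring
    · simp only [Fintype.sum_sigma, Fintype.sum_prod_type]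
      -- The induction hypothesis is applied to each projection of ψ; their squared norms add up to
      -- that of ψ.
      rw [Finset.sum_comm, ← sum_nsq_res (extracted f t) ψ, Finset.mul_sum]
      exact Finset.sum_le_sum fun z _ => ih _
    · simp only [Fintype.sum_sigma, Fintype.sum_prod_type, sum_nsq_res_matches]
      -- Extraction is two-valued on the cells of every database, so the size bound can be the
      -- trivial one.
      exact sum_commutator_branchVec_le (Q := Fintype.card X + q) (by positivity)
        (fun x d _ => splits_extracted f t x d) next (k := Fintype.card X) (by omega)
        (sizeLE_card ψ)
  | @measure j q m K hK next ih =>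
    rw [← sum_nsq_instrument hK ψ, Finset.mul_sum]
    rw [sum_branch_measure]
    refine Finset.sum_le_sum fun k _ => ?_
    exact ih k ((K k ⊗ₖ (1 : Matrix (DB X n) (DB X n) ℂ)).mulVec ψ)

/-- The extractions almost commute with classical queries. -/
lemma sum_commutator_matches_le [Fintype T] [DecidableEq T] [Nonempty (Reg X n E)]
    {R : Type*} [Fintype R]
    (f : X → Bits n → T) {j q : ℕ} (P : Program X n T E W ℓ j q) (b : Branch P)
    (xs : Fin ℓ → Option X) (v : R × DB X n → ℂ) :
    ∑ o, ∑ h, nsq (actD (classicalQueries xs h) (res (Matches f P b o) v) -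
      res (Matches f P b o) (actD (classicalQueries xs h) v)) ≤
      (((ℓ - j : ℕ) : ℝ) * (ℓ * (4 * √(Gam f / 2 ^ n)))) ^ 2 * nsq v := by
  induction P generalizing v with
  | finish m K hK out =>
    refine le_trans (le_of_eq ?_) (mul_nonneg (sq_nonneg _) (nsq_nonneg _))
    refine Finset.sum_eq_zero fun o _ => Finset.sum_eq_zero fun h _ => ?_
    have : ∀ w : R × DB X n → ℂ, res (fun _ : DB X n => True) w = w := fun w => by ext; simp [res]
    exact (congrArg nsq (congrArg₂ (· - ·) (congrArg _ (this v)) (this _))).trans (by simp [nsq])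
  | query next ih => exact ih b v
  | @announce j q t next ih =>
    have hj := next.le
    change Branch next at b
    have e : ∀ (z : Option X) (o : Outs next b) h,
        actD (classicalQueries xs h) (res (fun d => Matches f next b o d ∧ extracted f t d = z) v) -
          res (fun d => Matches f next b o d ∧ extracted f t d = z)
            (actD (classicalQueries xs h) v) =
        (actD (classicalQueries xs h) (res (Matches f next b o)
            (res (fun d => extracted f t d = z) v)) -
          res (Matches f next b o) (actD (classicalQueries xs h)
            (res (fun d => extracted f t d = z) v))) +
        res (Matches f next b o) (actD (classicalQueries xs h) (res (fun d => extracted f t d = z) v)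
          - res (fun d => extracted f t d = z) (actD (classicalQueries xs h) v)) := by
      intro z o h
      rw [res_sub, res_res, res_res]
      abel
    have key := nsq_add_le (N := nsq v)
      (α := ((ℓ - (j + 1) : ℕ) : ℝ) * (ℓ * (4 * √(Gam f / 2 ^ n))))
      (β := ℓ * (4 * √(Gam f / 2 ^ n)))
      (fun p : (Option X × Outs next b) × (Fin ℓ → Option (Bits n)) =>
        (actD (classicalQueries xs p.2) (res (Matches f next b p.1.2)
            (res (fun d => extracted f t d = p.1.1) v)) -
          res (Matches f next b p.1.2) (actD (classicalQueries xs p.2)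
            (res (fun d => extracted f t d = p.1.1) v))))
      (fun p => res (Matches f next b p.1.2) (actD (classicalQueries xs p.2)
          (res (fun d => extracted f t d = p.1.1) v)
          - res (fun d => extracted f t d = p.1.1) (actD (classicalQueries xs p.2) v)))
      (by positivity) (by positivity) (nsq_nonneg _) ?_ ?_
    · simp only [Fintype.sum_prod_type, ← e] at key
      refine (le_of_eq ?_).trans (key.trans (le_of_eq ?_))
      · exact sum_outs_announce _
      · have : ((ℓ - j : ℕ) : ℝ) = ((ℓ - (j + 1) : ℕ) : ℝ) + 1 := by
          rw [show ℓ - j = ℓ - (j + 1) + 1 by omega]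
          push_cast
          rfl
        rw [this]
        ring
    · simp only [Fintype.sum_prod_type]
      rw [← sum_nsq_res (extracted f t) v, Finset.mul_sum]
      exact Finset.sum_le_sum fun z _ => ih b _
    · simp only [Fintype.sum_prod_type]
      rw [Finset.sum_congr rfl fun z _ => Finset.sum_comm]
      simp only [sum_nsq_res_matches]
      exact sum_commutator_classicalQueries_le (by positivity) (splits_extracted f t) xs v
  | measure m K hK next ih =>
    obtain ⟨k, b⟩ := b
    exact ih k b v

end Programs

/-! ### The trace norm -/

section TraceNorm

variable {ι κ C W : Type*} [Fintype ι] [DecidableEq ι] [Fintype κ] [Fintype C] [DecidableEq C]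
  [Fintype W] [DecidableEq W]

open scoped MatrixOrder in
lemma exists_unitary_traceNorm_eq {A : Matrix ι ι ℂ} (hA : A.IsHermitian) :
    ∃ S : Matrix ι ι ℂ, S.conjTranspose * S = 1 ∧ traceNorm A = (S * A).trace.re := by
  -- The sign function with value 1 at 0, so that its square is 1 on the whole spectrum and S is
  -- unitary even for singular A.
  set f : ℝ → ℝ := fun x => if x < 0 then -1 else 1 with hf
  have hA' : IsSelfAdjoint A := hA
  have hc : ∀ g : ℝ → ℝ, ContinuousOn g (spectrum ℝ A) := fun g =>
    (Matrix.finite_real_spectrum).continuousOn g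
  have hS : IsSelfAdjoint (cfc f A) := cfc_predicate f A
  refine ⟨cfc f A, ?_, ?_⟩
  · rw [show (cfc f A).conjTranspose = cfc f A from hS, ← cfc_mul f f A (hc f) (hc f)]
    rw [cfc_congr (g := fun _ => 1) (fun x _ => by simp only [hf]; split_ifs <;> norm_num)]
    exact cfc_const_one ℝ A
  · rw [traceNorm, CFC.abs_eq_cfc_norm A]
    congr 2
    nth_rewrite 3 [← cfc_id' ℝ A]
    rw [← cfc_mul f _ A (hc f) (hc _)]
    refine cfc_congr fun x _ => ?_
    simp only [hf, Real.norm_eq_abs]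
    split_ifs with h
    · rw [abs_of_neg h]; ring
    · rw [abs_of_nonneg (not_lt.1 h)]; ring

lemma norm_star_dotProduct_le (a b : ι → ℂ) : ‖star b ⬝ᵥ a‖ ≤ √(nsq a) * √(nsq b) := by
  rw [← Real.sqrt_mul (nsq_nonneg a)]
  refine Real.le_sqrt_of_sq_le ?_
  rw [mul_comm]
  simpa [nsq, dotProduct] using norm_sum_mul_sq_le Finset.univ (star b) a

lemma re_trace_mul_vecMulVec_le {S : Matrix ι ι ℂ} (hS : S.conjTranspose * S = 1) (a b : ι → ℂ) :
    (S * Matrix.vecMulVec a (star b)).trace.re ≤ √(nsq a) * √(nsq b) := by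
  rw [Matrix.mul_vecMulVec, Matrix.trace_vecMulVec, dotProduct_comm, ← nsq_mulVec S hS a]
  exact (Complex.re_le_norm _).trans (norm_star_dotProduct_le _ _)

/-- From v v* − u u* = v (v − u)* + (v − u) u*, tested against a unitary attaining the trace norm,
with the Cauchy–Schwarz inequality for each k and then over k. -/
lemma traceNorm_sum_sub_le (v u : κ → ι → ℂ) :
    traceNorm (∑ k, (Matrix.vecMulVec (v k) (star (v k)) - Matrix.vecMulVec (u k) (star (u k)))) ≤
      (√(∑ k, nsq (v k)) + √(∑ k, nsq (u k))) * √(∑ k, nsq (v k - u k)) := by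
  have hh : ∀ a : ι → ℂ, (Matrix.vecMulVec a (star a)).conjTranspose = Matrix.vecMulVec a (star a) := by
    intro a
    rw [Matrix.conjTranspose_vecMulVec, star_star]
  obtain ⟨S, hS, h⟩ := exists_unitary_traceNorm_eq (A := ∑ k, (Matrix.vecMulVec (v k) (star (v k)) -
    Matrix.vecMulVec (u k) (star (u k)))) (by
      simp only [Matrix.IsHermitian, Matrix.conjTranspose_sum, Matrix.conjTranspose_sub, hh])
  rw [h, Matrix.mul_sum, Matrix.trace_sum, Complex.re_sum]
  have e : ∀ k, (S * (Matrix.vecMulVec (v k) (star (v k)) -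
      Matrix.vecMulVec (u k) (star (u k)))).trace.re ≤
      √(nsq (v k)) * √(nsq (v k - u k)) + √(nsq (u k)) * √(nsq (v k - u k)) := by
    intro k
    have : Matrix.vecMulVec (v k) (star (v k)) - Matrix.vecMulVec (u k) (star (u k)) =
        Matrix.vecMulVec (v k) (star (v k - u k)) + Matrix.vecMulVec (v k - u k) (star (u k)) := by
      rw [star_sub, Matrix.vecMulVec_sub, Matrix.sub_vecMulVec]
      abel
    rw [this, Matrix.mul_add, Matrix.trace_add, Complex.add_re]
    have h1 := re_trace_mul_vecMulVec_le hS (v k) (v k - u k)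
    have h2 := re_trace_mul_vecMulVec_le hS (v k - u k) (u k)
    linarith
  refine (Finset.sum_le_sum fun k _ => e k).trans ?_
  rw [Finset.sum_add_distrib, add_mul]
  exact add_le_add
    (Real.sum_sqrt_mul_sqrt_le _ (fun _ => nsq_nonneg _) fun _ => nsq_nonneg _)
    (Real.sum_sqrt_mul_sqrt_le _ (fun _ => nsq_nonneg _) fun _ => nsq_nonneg _)

/-- Two mixtures of pure states, with the same classical values, are close if the families of
(unnormalized) state vectors are. -/
lemma traceDist_density_le (c : κ → C) (v u : κ → W → ℂ) {ρ σ : CQState C W}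
    (hρ : ∀ x, ρ x = ∑ k, if x = c k then Matrix.vecMulVec (v k) (star (v k)) else 0)
    (hσ : ∀ x, σ x = ∑ k, if x = c k then Matrix.vecMulVec (u k) (star (u k)) else 0)
    (hv : ∑ k, nsq (v k) ≤ 1) (hu : ∑ k, nsq (u k) ≤ 1) {ε : ℝ} (hε : 0 ≤ ε)
    (h : ∑ k, nsq (v k - u k) ≤ ε ^ 2) : traceDist ρ.density σ.density ≤ ε := by
  -- `L v k` is v k ⊗ |c k⟩, which writes the block-diagonal density as a sum of rank-one operators.
  set L : (κ → W → ℂ) → κ → W × C → ℂ := fun v k a => if a.2 = c k then v k a.1 else 0 with hL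
  have hd : ∀ (ρ : CQState C W) (v : κ → W → ℂ),
      (∀ x, ρ x = ∑ k, if x = c k then Matrix.vecMulVec (v k) (star (v k)) else 0) →
      ρ.density = ∑ k, Matrix.vecMulVec (L v k) (star (L v k)) := by
    intro ρ v hρ
    ext ⟨w, x⟩ ⟨w', x'⟩
    simp only [CQState.density, Matrix.blockDiagonal_apply, hρ, Matrix.sum_apply,
      Matrix.vecMulVec_apply, hL, Pi.star_apply]
    by_cases hx : x = x'
    · subst hx
      rw [if_pos rfl]
      refine Finset.sum_congr rfl fun k _ => ?_
      by_cases hk : x = c k <;> simp [hk, Matrix.vecMulVec_apply]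
    · rw [if_neg hx]
      symm
      refine Finset.sum_eq_zero fun k _ => ?_
      by_cases hk : x = c k
      · have : x' ≠ c k := fun h => hx (hk.trans h.symm)
        simp [this]
      · simp [hk]
  have hn : ∀ w : κ → W → ℂ, ∑ k, nsq (L w k) = ∑ k, nsq (w k) := by
    intro w
    refine Finset.sum_congr rfl fun k _ => ?_
    simp [nsq, hL, Fintype.sum_prod_type, apply_ite norm, ite_pow]
  have hs : ∀ k, L v k - L u k = L (v - u) k := by
    intro k
    ext a
    by_cases ha : a.2 = c k <;> simp [hL, ha]
  rw [traceDist, hd ρ v hρ, hd σ u hσ, ← Finset.sum_sub_distrib]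
  -- The first factor is at most 1 + 1, which cancels the ½ in the trace distance.
  have key := traceNorm_sum_sub_le (L v) (L u)
  simp only [hs, hn] at key
  have h1 := Real.sqrt_le_one.2 hv
  have h2 := Real.sqrt_le_one.2 hu
  have h3 : √(∑ k, nsq ((v - u) k)) ≤ ε := Real.sqrt_le_iff.2 ⟨hε, h⟩
  have h4 := Real.sqrt_nonneg (∑ k, nsq ((v - u) k))
  nlinarith

end TraceNorm

/-! ### Both runs as families of pure states, and the bound on their trace distance -/

section Runs

variable {X T E W R : Type*} {n ℓ : ℕ} [Fintype X] [LinearOrder X] [DecidableEq T]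
  [Fintype E] [DecidableEq E] [Fintype W] [DecidableEq W] [Fintype R]

/-- The projector on a vector. -/
def proj {ι : Type*} (v : ι → ℂ) : Matrix ι ι ℂ := Matrix.vecMulVec v (star v)

lemma mul_proj_mul {ι κ : Type*} [Fintype ι] (A : Matrix κ ι ℂ) (v : ι → ℂ) :
    A * proj v * A.conjTranspose = proj (A.mulVec v) := by
  rw [proj, Matrix.mul_vecMulVec, Matrix.vecMulVec_mul, ← Matrix.star_mulVec, proj]

lemma kronecker_mulVec {A : Type*} [Fintype A] (K : Matrix W A ℂ)
    (C : Matrix (DB X n) (DB X n) ℂ) (ψ : A × DB X n → ℂ) :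
    (K ⊗ₖ C).mulVec ψ = actD C ((K ⊗ₖ (1 : Matrix (DB X n) (DB X n) ℂ)).mulVec ψ) := by
  rw [← one_kronecker_mulVec, Matrix.mulVec_mulVec, ← Matrix.mul_kronecker_mul, Matrix.one_mul,
    Matrix.mul_one]

/-! ### Expansions into branches -/

/-- Each operation applies a single operator per outcome, so once all outcomes are fixed the joint
state with D stays pure until D is traced out. -/
lemma simRun_proj (f : X → Bits n → T) {j q : ℕ} (P : Program X n T E W ℓ j q) (τ : Fin j → T)
    (ξ : Fin j → Option X) (ψ : Reg X n E × DB X n → ℂ) (c : SimOutcome X n T ℓ) :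
    simRun f P τ ξ (proj ψ) c = ∑ b, ∑ o, ∑ h,
      if c = (announced P b τ, extractions P b o ξ, outputs P b, h) then
        traceOutDB (proj (actD (classicalQueries (outputs P b) h) (extractVec f P b o ψ))) else 0 := by
  induction P generalizing ψ with
  | finish m K hK out =>
    simp only [simRun, mul_proj_mul]
    refine Finset.sum_congr rfl fun k _ => Eq.trans ?_ (sum_outs_finish _).symm
    refine Finset.sum_congr rfl fun h _ => ?_
    rw [kronecker_mulVec]
    rfl
  | query next ih =>
    simp only [simRun, mul_proj_mul]
    exact ih _ _ _
  | announce t next ih =>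
    simp only [simRun, mul_proj_mul, Finset.sum_apply, one_kronecker_extractProj_mulVec, ih]
    rw [Finset.sum_comm]
    refine Finset.sum_congr rfl fun b _ => Eq.trans ?_ (sum_outs_announce _).symm
    rfl
  | measure m K hK next ih =>
    simp only [simRun, mul_proj_mul, Finset.sum_apply, ih]
    rw [sum_branch_measure]
    rfl

/-- The final (unnormalized) state of a branch in the run with the oracle `H`. -/
def oracleVec (H : X → Bits n) : {j q : ℕ} → (P : Program X n T E W ℓ j q) → Branch P →
    (Reg X n E → ℂ) → W → ℂ
  | _, _, .finish _ K _ _, k, φ => (K k).mulVec φ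
  | _, _, .query next, b, φ => oracleVec H next b ((oracleUnitary H).mulVec φ)
  | _, _, .announce _ next, b, φ => oracleVec H next b φ
  | _, _, .measure _ K _ next, b, φ => oracleVec H (next b.1) b.2 ((K b.1).mulVec φ)

lemma runWith_proj (H : X → Bits n) {j q : ℕ} (P : Program X n T E W ℓ j q) (τ : Fin j → T)
    (φ : Reg X n E → ℂ) (c : Outcome X n T ℓ) :
    runWith H P τ (proj φ) c = ∑ b,
      if c = (announced P b τ, outputs P b, fun i => (outputs P b i).map H) then
        proj (oracleVec H P b φ) else 0 := by
  induction P generalizing φ with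
  | finish m K hK out =>
    simp only [runWith, mul_proj_mul]
    rfl
  | query next ih =>
    simp only [runWith, mul_proj_mul]
    exact ih _ _
  | announce t next ih =>
    simp only [runWith]
    exact ih _ _
  | measure m K hK next ih =>
    simp only [runWith, mul_proj_mul, Finset.sum_apply, ih]
    rw [sum_branch_measure]
    rfl

/-! ### The compressed oracle is a random oracle -/

open Classical in
/-- The superposition `∑ H, a_H ⊗ |H⟩`. -/
def plain (a : (X → Bits n) → R → ℂ) : R × DB X n → ℂ := fun p =>
  if (∀ x, p.2 x ≠ none) then a (fun x => (p.2 x).getD 0) p.1 else 0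

lemma plain_some (a : (X → Bits n) → R → ℂ) (H : X → Bits n) (r : R) :
    plain a (r, fun x => some (H x)) = a H r := by
  simp [plain]

/-- With F on all cells, the F of the state cancels the first F of the query, and on |H⟩ the plain
query is the oracle unitary of H. -/
lemma simQuery_plain (a : (X → Bits n) → Reg X n E → ℂ) :
    simQuery.mulVec (actD (FS n Finset.univ) (plain a)) =
      actD (FS n Finset.univ) (plain fun H => (oracleUnitary H).mulVec (a H)) := by
  have hc : ∀ ψ : Reg X n E × DB X n → ℂ,
      ctrlF (fun _ => Finset.univ) ψ = actD (FS n Finset.univ) ψ := fun ψ => rfl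
  rw [simQuery_mulVec (S := fun _ => Finset.univ) (by simp), hc, hc, actD_FS_actD_FS]
  congr 1
  ext ⟨⟨x, y, e⟩, d⟩
  simp only [plainQuery, plain]
  split_ifs with h
  · simp only [oracleUnitary, Matrix.mulVec, dotProduct, Matrix.of_apply, Prod.mk.injEq, ite_mul,
      one_mul, zero_mul, Fintype.sum_prod_type, ite_and, Finset.sum_ite_irrel, Finset.sum_const_zero,
      Finset.sum_ite_eq, Finset.mem_univ, if_true, bits_eq_add_iff]
    simp [eq_comm, bits_eq_add_iff, ← bits_eq_add_iff]
  · rfl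

lemma kronecker_one_actD {A : Type*} [Fintype A] (K : Matrix R A ℂ)
    (C : Matrix (DB X n) (DB X n) ℂ) (ψ : A × DB X n → ℂ) :
    (K ⊗ₖ (1 : Matrix (DB X n) (DB X n) ℂ)).mulVec (actD C ψ) =
      actD C ((K ⊗ₖ (1 : Matrix (DB X n) (DB X n) ℂ)).mulVec ψ) := by
  ext a
  simp only [kronecker_one_mulVec, actD]
  simp only [Matrix.mulVec, dotProduct, Finset.mul_sum]
  rw [Finset.sum_comm]
  exact Finset.sum_congr rfl fun d _ => Finset.sum_congr rfl fun r _ => by ring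

lemma kronecker_one_plain {A : Type*} [Fintype A] (K : Matrix R A ℂ)
    (a : (X → Bits n) → A → ℂ) :
    (K ⊗ₖ (1 : Matrix (DB X n) (DB X n) ℂ)).mulVec (plain a) = plain fun H => K.mulVec (a H) := by
  ext p
  rw [kronecker_one_mulVec]
  simp only [plain]
  split_ifs with h
  · rfl
  · exact congrFun (Matrix.mulVec_zero K) p.1

lemma branchVec_plain {j q : ℕ} (P : Program X n T E W ℓ j q) (b : Branch P)
    (a : (X → Bits n) → Reg X n E → ℂ) :
    branchVec P b (actD (FS n Finset.univ) (plain a)) =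
      actD (FS n Finset.univ) (plain fun H => oracleVec H P b (a H)) := by
  induction P generalizing a with
  | finish m K hK out =>
    simp only [branchVec, oracleVec, kronecker_one_actD, kronecker_one_plain]
  | query next ih =>
    simp only [branchVec, oracleVec, simQuery_plain]
    exact ih _ _
  | announce t next ih => exact ih _ _
  | measure m K hK next ih =>
    simp only [branchVec, oracleVec, kronecker_one_actD, kronecker_one_plain]
    exact ih _ _ _

lemma res_responses_plain (xs : Fin ℓ → Option X) (h : Fin ℓ → Option (Bits n))
    (a : (X → Bits n) → R → ℂ) :
    res (fun d => responses xs d = h) (plain a) =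
      plain fun H => if h = (fun i => (xs i).map H) then a H else 0 := by
  ext ⟨r, d⟩
  simp only [res, plain, eq_comm (b := h)]
  by_cases h1 : ∀ x, d x ≠ none
  · rw [if_pos h1, if_pos h1]
    by_cases h2 : h = responses xs d
    · rw [if_pos h2]
      exact (congrFun (if_pos h2) r).symm
    · rw [if_neg h2]
      have := congrFun (if_neg h2 : (if h = responses xs d then a fun x => (d x).getD 0 else 0) = 0) r
      exact this.symm
  · rw [if_neg h1, if_neg h1, ite_self]

lemma traceOutDB_proj_actD_FS (s : Finset X) (v : R × DB X n → ℂ) :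
    traceOutDB (proj (actD (FS n s) v)) = traceOutDB (proj v) := by
  ext w w'
  have e : ∀ u : R × DB X n → ℂ, traceOutDB (proj u) w w' =
      star (fun d => u (w', d)) ⬝ᵥ fun d => u (w, d) := by
    intro u
    simp [traceOutDB, proj, Matrix.vecMulVec_apply, dotProduct, mul_comm]
  rw [e, e]
  simp only [actD]
  rw [Matrix.star_mulVec, Matrix.dotProduct_mulVec, Matrix.vecMul_vecMul, FS_conjTranspose,
    FS_mul_self, Matrix.vecMul_one]

lemma traceOutDB_proj_plain (a : (X → Bits n) → R → ℂ) :
    traceOutDB (proj (plain a)) = ∑ H, proj (a H) := by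
  ext w w'
  simp only [traceOutDB, Matrix.of_apply, Matrix.sum_apply]
  symm
  refine Fintype.sum_of_injective (fun (H : X → Bits n) x => some (H x)) ?_ _ _ ?_ ?_
  · intro H H' h
    ext1 x
    simpa using congrFun h x
  · intro d hd
    have : ¬ ∀ x, d x ≠ none := by
      intro h
      refine hd ⟨fun x => (d x).getD 0, funext fun x => ?_⟩
      change some ((d x).getD 0) = d x
      rcases hx : d x with _ | y
      · exact absurd hx (h x)
      · rfl
    simp [proj, Matrix.vecMulVec_apply, plain, this]
  · intro H
    simp [proj, Matrix.vecMulVec_apply, plain_some]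

/-- Purification: running with every H is one run on the superposition of all |H⟩. The final F is
invisible after tracing out D, the responses are the values of H, and the trace over D restores the
sum over H. -/
lemma sum_runWith_proj {j q : ℕ} (P : Program X n T E W ℓ j q) (τ : Fin j → T)
    (a : (X → Bits n) → Reg X n E → ℂ) (c : Outcome X n T ℓ) :
    ∑ H, runWith H P τ (proj (a H)) c = ∑ b, ∑ h,
      if c = (announced P b τ, outputs P b, h) then
        traceOutDB (proj (actD (classicalQueries (outputs P b) h)
          (branchVec P b (actD (FS n Finset.univ) (plain a))))) else 0 := by
  simp_rw [runWith_proj]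
  rw [Finset.sum_comm]
  refine Finset.sum_congr rfl fun b _ => ?_
  simp only [branchVec_plain]
  simp_rw [actD_classicalQueries (s := Finset.univ) (xs := outputs P b) (by simp), actD_FS_actD_FS,
    traceOutDB_proj_actD_FS, res_responses_plain, traceOutDB_proj_plain]
  have e : ∀ (h : Fin ℓ → Option (Bits n)) (M : (X → Bits n) → Matrix W W ℂ),
      (if c = (announced P b τ, outputs P b, h) then ∑ H, M H else 0) =
        ∑ H, if c = (announced P b τ, outputs P b, h) then M H else 0 := fun h M => by
    split_ifs <;> simp
  simp_rw [e]
  rw [Finset.sum_comm]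
  refine Finset.sum_congr rfl fun H _ => ?_
  rw [Finset.sum_eq_single fun i => (outputs P b i).map H]
  · simp
  · intro h _ hh
    rw [if_neg hh]
    simp [proj]
  · simp

/-- The initial state of the run with the simulator. -/
def initVec (φ : Reg X n E → ℂ) : Reg X n E × DB X n → ℂ :=
  fun p => if p.2 = (fun _ => none) then φ p.1 else 0

/-- F maps |⊥⟩ to |φ₀⟩ in each cell, so up to F the empty database is the uniform superposition of
all functions. -/
lemma initVec_eq (φ : Reg X n E → ℂ) : initVec φ = actD (FS n Finset.univ)
    (plain fun _ r => (((√(2 ^ n))⁻¹ : ℝ) : ℂ) ^ Fintype.card X * φ r) := by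
  rw [← actD_FS_actD_FS Finset.univ (initVec φ)]
  congr 1
  ext ⟨r, d⟩
  have h : ∀ u : Option (Bits n), opF n u none =
      if u ≠ none then (((√(2 ^ n))⁻¹ : ℝ) : ℂ) else 0 := by
    intro u
    rw [opF_apply]
    rcases u with _ | y <;> simp [wvec]
  simp only [actD, Matrix.mulVec, dotProduct, initVec, mul_ite, mul_zero, Finset.sum_ite_eq',
    Finset.mem_univ, if_true, FS, tens, Matrix.of_apply, h, plain, Finset.prod_ite_zero, true_implies,
    Finset.prod_const, Finset.card_univ, ite_mul, zero_mul]

lemma nsq_initVec {φ : Reg X n E → ℂ} (hφ : ∑ r, ‖φ r‖ ^ 2 = 1) : nsq (initVec φ) = 1 := by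
  rw [← hφ]
  simp [nsq, initVec, Fintype.sum_prod_type, apply_ite norm, ite_pow]

variable {q : ℕ}

lemma runWith_smul (H : X → Bits n) {j q : ℕ} (P : Program X n T E W ℓ j q) (τ : Fin j → T)
    (z : ℂ) (ρ : Matrix (Reg X n E) (Reg X n E) ℂ) (c : Outcome X n T ℓ) :
    runWith H P τ (z • ρ) c = z • runWith H P τ ρ c := by
  induction P generalizing ρ with
  | finish m K hK out => simp [runWith, Finset.smul_sum]
  | query next ih => simp [runWith, ih]
  | announce t next ih => simp [runWith, ih]
  | measure m K hK next ih => simp [runWith, ih, Finset.smul_sum]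

lemma realState_apply (A : Algorithm X n T E W ℓ q) (c : Outcome X n T ℓ) :
    realState A c = ∑ b, ∑ h, if c = (announced A.prog b Fin.elim0, outputs A.prog b, h) then
        traceOutDB (proj (actD (classicalQueries (outputs A.prog b) h)
          (branchVec A.prog b (initVec A.init)))) else 0 := by
  rw [initVec_eq, ← sum_runWith_proj, realState, Finset.sum_apply]
  refine Finset.sum_congr rfl fun H _ => ?_
  rw [Pi.smul_apply, ← runWith_smul]
  congr 1
  ext r r'
  -- The probability of a function is the square of its amplitude (2^{-n/2})^{|X|}.
  have h : ((Fintype.card (X → Bits n) : ℂ))⁻¹ =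
      (((√(2 ^ n))⁻¹ : ℝ) : ℂ) ^ Fintype.card X * (((√(2 ^ n))⁻¹ : ℝ) : ℂ) ^ Fintype.card X := by
    rw [← mul_pow, ← Complex.ofReal_mul, ← sq, inv_sqrt_two_pow_sq, Fintype.card_fun, card_bits]
    push_cast
    rw [inv_pow]
  simp only [Matrix.smul_apply, Matrix.vecMulVec_apply, proj, h, Pi.star_apply, star_mul',
    star_pow, Complex.star_def, Complex.conj_ofReal, smul_eq_mul]
  ring

lemma simState_apply (f : X → Bits n → T) (A : Algorithm X n T E W ℓ q)
    (c : SimOutcome X n T ℓ) : simState f A c = ∑ b, ∑ o, ∑ h,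
      if c = (announced A.prog b Fin.elim0, extractions A.prog b o Fin.elim0,
          outputs A.prog b, h) then
        traceOutDB (proj (actD (classicalQueries (outputs A.prog b) h)
          (extractVec f A.prog b o (initVec A.init)))) else 0 := by
  rw [← simRun_proj, simState]
  congr 1
  ext ⟨r, d⟩ ⟨r', d'⟩
  by_cases h : d = fun _ => none <;> by_cases h' : d' = fun _ => none <;>
    simp [proj, Matrix.vecMulVec_apply, initVec, Matrix.single_apply, h, h', eq_comm (b := d),
      eq_comm (b := d')]

lemma sum_nsq_extractVec (f : X → Bits n → T) {j q : ℕ} (P : Program X n T E W ℓ j q)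
    (ψ : Reg X n E × DB X n → ℂ) : ∑ b, ∑ o, nsq (extractVec f P b o ψ) = nsq ψ := by
  induction P generalizing ψ with
  | finish m K hK out =>
    rw [← sum_nsq_instrument hK ψ]
    refine Finset.sum_congr rfl fun k _ => ?_
    exact sum_outs_finish _
  | query next ih => exact (ih _).trans (nsq_simQuery_mulVec ψ)
  | announce t next ih =>
    rw [← sum_nsq_res (extracted f t) ψ]
    have e : ∀ z, ∑ b, ∑ o, nsq (extractVec f next b o (res (fun d => extracted f t d = z) ψ)) =
        nsq (res (fun d => extracted f t d = z) ψ) := fun z => ih _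
    rw [← Finset.sum_congr rfl fun z _ => e z, Finset.sum_comm]
    refine Finset.sum_congr rfl fun b _ => ?_
    exact sum_outs_announce _
  | measure m K hK next ih =>
    rw [← sum_nsq_instrument hK ψ, sum_branch_measure]
    refine Finset.sum_congr rfl fun k _ => ?_
    exact ih k ((K k ⊗ₖ (1 : Matrix (DB X n) (DB X n) ℂ)).mulVec ψ)

open Classical in
-- Completeness of the postponed measurement, tested on the basis vector |d⟩.
lemma sum_ite_matches (f : X → Bits n → T) {j q : ℕ} (P : Program X n T E W ℓ j q) (b : Branch P)
    (d : DB X n) : ∑ o, (if Matches f P b o d then (1 : ℝ) else 0) = 1 := by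
  have h := sum_nsq_res_matches f P b (R := Unit) (Pi.single ((), d) 1)
  have e : ∀ p : DB X n → Prop, nsq (res p (Pi.single ((), d) 1 : Unit × DB X n → ℂ)) =
      if p d then 1 else 0 := by
    intro p
    rw [nsq, Finset.sum_eq_single ((), d)]
    · by_cases hp : p d <;> simp [res, hp]
    · intro a _ ha
      simp [res, ha]
    · simp
  have e2 : nsq (Pi.single ((), d) 1 : Unit × DB X n → ℂ) = 1 := by
    rw [nsq, Finset.sum_eq_single ((), d)]
    · simp
    · intro a _ ha
      simp [ha]
    · simp
  simpa only [e, e2] using h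

lemma traceOutDB_proj (v : R × DB X n → ℂ) :
    traceOutDB (proj v) = ∑ d, proj fun r => v (r, d) := by
  ext r r'
  simp [traceOutDB, proj, Matrix.sum_apply, Matrix.vecMulVec_apply]

/-- Measuring D just before tracing it out, and forgetting the outcome, changes nothing. This is how
extraction outcomes are inserted into the real run. -/
lemma sum_traceOutDB_proj_res_matches (f : X → Bits n → T) {j q : ℕ}
    (P : Program X n T E W ℓ j q) (b : Branch P) (v : R × DB X n → ℂ) :
    ∑ o, traceOutDB (proj (res (Matches f P b o) v)) = traceOutDB (proj v) := by
  classical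
  simp only [traceOutDB_proj]
  rw [Finset.sum_comm]
  refine Finset.sum_congr rfl fun d _ => ?_
  have e : ∀ o, proj (fun r => res (Matches f P b o) v (r, d)) =
      (if Matches f P b o d then (1 : ℝ) else 0) • proj fun r => v (r, d) := by
    intro o
    ext r r'
    by_cases h : Matches f P b o d <;> simp [proj, Matrix.vecMulVec_apply, res, h]
  simp_rw [e]
  rw [← Finset.sum_smul, sum_ite_matches, one_smul]

/-- The runs with the random oracle and with the simulator are hard to distinguish. -/
lemma traceDist_realState_simState_le [Fintype T] (f : X → Bits n → T)
    (A : Algorithm X n T E W ℓ q) :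
    traceDist (realState A).density (simState f A).forgetExtracted.density ≤
      4 * ℓ * (q + ℓ) * √(Gam f / 2 ^ n) := by
  have hne : Nonempty (Reg X n E) := by
    by_contra h
    rw [not_nonempty_iff] at h
    simpa using A.norm_init
  set ψ := initVec A.init with hψ
  have hn : nsq ψ = 1 := nsq_initVec A.norm_init
  set γ := √((Gam f : ℝ) / 2 ^ n) with hγ
  have hγ0 : 0 ≤ γ := Real.sqrt_nonneg _
  have hflat : ∀ v : (Σ b : Branch A.prog, Outs A.prog b × (Fin ℓ → Option (Bits n))) →
      W × DB X n → ℂ, ∑ k : (Σ b : Branch A.prog, Outs A.prog b × (Fin ℓ → Option (Bits n))) ×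
        DB X n, nsq (fun w => v k.1 (w, k.2)) = ∑ b, ∑ o, ∑ h, nsq (v ⟨b, o, h⟩) := by
    intro v
    rw [Fintype.sum_prod_type, Fintype.sum_sigma]
    refine Finset.sum_congr rfl fun b _ => ?_
    rw [Fintype.sum_prod_type]
    refine Finset.sum_congr rfl fun o _ => Finset.sum_congr rfl fun h _ => ?_
    simp only [nsq, Fintype.sum_prod_type]
    rw [Finset.sum_comm]
  -- Both states are indexed by branch, extraction outcomes, responses and final basis state of D.
  -- The extraction outcomes and D are absent from the classical label, since they are discarded.
  refine traceDist_density_le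
    (κ := (Σ b : Branch A.prog, Outs A.prog b × (Fin ℓ → Option (Bits n))) × DB X n)
    (fun k => (announced A.prog k.1.1 Fin.elim0, outputs A.prog k.1.1, k.1.2.2))
    (fun k w => res (Matches f A.prog k.1.1 k.1.2.1)
      (actD (classicalQueries (outputs A.prog k.1.1) k.1.2.2) (branchVec A.prog k.1.1 ψ)) (w, k.2))
    (fun k w => actD (classicalQueries (outputs A.prog k.1.1) k.1.2.2)
      (extractVec f A.prog k.1.1 k.1.2.1 ψ) (w, k.2)) ?_ ?_ ?_ ?_ (by positivity) ?_
  · intro c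
    rw [realState_apply, Fintype.sum_prod_type, Fintype.sum_sigma]
    refine Finset.sum_congr rfl fun b _ => ?_
    rw [Fintype.sum_prod_type, Finset.sum_comm]
    refine Finset.sum_congr rfl fun h _ => ?_
    by_cases hc : c = (announced A.prog b Fin.elim0, outputs A.prog b, h)
    · simp only [if_pos hc]
      rw [← sum_traceOutDB_proj_res_matches f A.prog b]
      simp only [traceOutDB_proj]
      rfl
    · simp [if_neg hc]
  · intro c
    simp only [CQState.forgetExtracted, simState_apply]
    rw [Fintype.sum_prod_type, Fintype.sum_sigma, Finset.sum_comm]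
    refine Finset.sum_congr rfl fun b _ => ?_
    rw [Fintype.sum_prod_type, Finset.sum_comm]
    refine Finset.sum_congr rfl fun o _ => ?_
    rw [Finset.sum_comm]
    refine Finset.sum_congr rfl fun h _ => ?_
    obtain ⟨t, x, h'⟩ := c
    rw [Finset.sum_eq_single (extractions A.prog b o Fin.elim0)]
    · by_cases hc : (t, x, h') = (announced A.prog b Fin.elim0, outputs A.prog b, h)
      · simp only [Prod.mk.injEq] at hc
        obtain ⟨rfl, rfl, rfl⟩ := hc
        simp only [if_true, traceOutDB_proj]
        rfl
      · simp only [if_neg hc, Finset.sum_const_zero]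
        rw [if_neg]
        simpa using hc
    · intro z _ hz
      rw [if_neg]
      simp [hz]
    · simp
  · rw [hflat fun k => res (Matches f A.prog k.1 k.2.1)
      (actD (classicalQueries (outputs A.prog k.1) k.2.2) (branchVec A.prog k.1 ψ))]
    refine le_of_eq ?_
    rw [← hn, ← sum_nsq_branchVec A.prog ψ]
    refine Finset.sum_congr rfl fun b _ => ?_
    rw [Finset.sum_comm]
    simp only [sum_nsq_res_matches, sum_nsq_actD_classicalQueries]
  · rw [hflat fun k => actD (classicalQueries (outputs A.prog k.1) k.2.2)
      (extractVec f A.prog k.1 k.2.1 ψ)]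
    simp only [sum_nsq_actD_classicalQueries, sum_nsq_extractVec, hn, le_refl]
  · refine (le_of_eq (hflat fun k => res (Matches f A.prog k.1 k.2.1)
      (actD (classicalQueries (outputs A.prog k.1) k.2.2) (branchVec A.prog k.1 ψ)) -
      actD (classicalQueries (outputs A.prog k.1) k.2.2)
      (extractVec f A.prog k.1 k.2.1 ψ))).trans ?_
    have e : ∀ b o h, res (Matches f A.prog b o)
        (actD (classicalQueries (outputs A.prog b) h) (branchVec A.prog b ψ)) -
        actD (classicalQueries (outputs A.prog b) h) (extractVec f A.prog b o ψ) =
        -(actD (classicalQueries (outputs A.prog b) h) (extractVec f A.prog b o ψ -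
          res (Matches f A.prog b o) (branchVec A.prog b ψ)) +
        (actD (classicalQueries (outputs A.prog b) h) (res (Matches f A.prog b o)
          (branchVec A.prog b ψ)) - res (Matches f A.prog b o)
        (actD (classicalQueries (outputs A.prog b) h) (branchVec A.prog b ψ)))) := by
      intro b o h
      rw [actD_sub]
      abel
    have hneg : ∀ v : W × DB X n → ℂ, nsq (-v) = nsq v := fun v => by simp [nsq]
    simp_rw [e, hneg]
    -- ℓ extractions are moved past q queries during the run, then past ℓ classical queries after
    -- it.
    have key := nsq_add_le (N := nsq ψ) (α := ℓ * (q * (4 * γ))) (β := ℓ * (ℓ * (4 * γ)))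
      (fun k : Σ b : Branch A.prog, Outs A.prog b × (Fin ℓ → Option (Bits n)) =>
        actD (classicalQueries (outputs A.prog k.1) k.2.2) (extractVec f A.prog k.1 k.2.1 ψ -
          res (Matches f A.prog k.1 k.2.1) (branchVec A.prog k.1 ψ)))
      (fun k => (actD (classicalQueries (outputs A.prog k.1) k.2.2) (res (Matches f A.prog k.1 k.2.1)
          (branchVec A.prog k.1 ψ)) - res (Matches f A.prog k.1 k.2.1)
        (actD (classicalQueries (outputs A.prog k.1) k.2.2) (branchVec A.prog k.1 ψ))))
      (by positivity) (by positivity) (nsq_nonneg _) ?_ ?_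
    · simp only [Fintype.sum_sigma, Fintype.sum_prod_type] at key
      refine key.trans (le_of_eq ?_)
      rw [hn]
      ring
    · simp only [Fintype.sum_sigma, Fintype.sum_prod_type, sum_nsq_actD_classicalQueries]
      have := sum_extractVec_sub_le f A.prog ψ
      rwa [Nat.sub_zero] at this
    · simp only [Fintype.sum_sigma, Fintype.sum_prod_type]
      rw [← sum_nsq_branchVec A.prog ψ, Finset.mul_sum]
      refine Finset.sum_le_sum fun b _ => ?_
      have := sum_commutator_matches_le f A.prog b (outputs A.prog b) (branchVec A.prog b ψ)
      rwa [Nat.sub_zero] at this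

end Runs

/-! ### Collisions in the database -/

section Collisions

variable {X T : Type*} {n : ℕ} [Fintype X] [DecidableEq X]

/-- The database contains a collision of `f` between different cells. -/
def Collides (f : X → Bits n → T) (d : DB X n) : Prop :=
  ∃ x x' y y', x ≠ x' ∧ d x = some y ∧ d x' = some y' ∧ f x y = f x' y'

open Classical in
/-- The values of `D_x` that collide with another cell. -/
def collidingValues (f : X → Bits n → T) (x : X) (d : DB X n) : Finset (Bits n) :=
  Finset.univ.filter fun y => ∃ x' y', x ≠ x' ∧ d x' = some y' ∧ f x y = f x' y'

/-- Each other occupied cell contributes at most Γ' values. Cell x is emptied in the count because a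
collision involves two different cells. -/
lemma card_collidingValues_le [DecidableEq T] (f : X → Bits n → T) (x : X) (d : DB X n) :
    (collidingValues f x d).card ≤ dbSize (Function.update d x none) * Gam' f := by
  classical
  have hsub : collidingValues f x d ⊆
      (Finset.univ.filter fun x' => Function.update d x none x' ≠ none).biUnion
        fun x' => Finset.univ.filter fun y => x ≠ x' ∧ f x y = f x' ((d x').getD 0) := by
    intro y hy
    simp only [collidingValues, Finset.mem_filter, Finset.mem_univ, true_and] at hy
    obtain ⟨x', y', hx, hd, hf⟩ := hy
    simp only [Finset.mem_biUnion, Finset.mem_filter, Finset.mem_univ, true_and]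
    refine ⟨x', ?_, hx, ?_⟩
    · rw [Function.update_of_ne hx.symm, hd]
      simp
    · rw [hd]
      exact hf
  refine (Finset.card_le_card hsub).trans (Finset.card_biUnion_le_card_mul _ _ _ fun x' _ => ?_)
  by_cases hx : x = x'
  · simp [hx]
  · simp only [ne_eq, hx, not_false_eq_true, true_and]
    exact Finset.le_sup
      (f := fun p : X × X × Bits n => (Finset.univ.filter fun y => f p.1 y = f p.2.1 p.2.2).card)
      (b := (x, x', (d x').getD 0)) (by simpa using hx)

lemma collides_update_iff (f : X → Bits n → T) (x : X) (d : DB X n) (u : Option (Bits n)) :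
    Collides f (Function.update d x u) ↔
      Collides f (Function.update d x none) ∨ ∃ y ∈ collidingValues f x d, u = some y := by
  simp only [collidingValues, Finset.mem_filter, Finset.mem_univ, true_and]
  constructor
  · rintro ⟨x₁, x₂, y₁, y₂, hx, h1, h2, hf⟩
    by_cases e1 : x₁ = x
    · subst e1
      rw [Function.update_self] at h1
      rw [Function.update_of_ne hx.symm] at h2
      exact Or.inr ⟨y₁, ⟨x₂, y₂, hx, h2, hf⟩, h1⟩
    · rw [Function.update_of_ne e1] at h1
      by_cases e2 : x₂ = x
      · subst e2
        rw [Function.update_self] at h2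
        exact Or.inr ⟨y₂, ⟨x₁, y₁, hx.symm, h1, hf.symm⟩, h2⟩
      · rw [Function.update_of_ne e2] at h2
        refine Or.inl ⟨x₁, x₂, y₁, y₂, hx, ?_, ?_, hf⟩
        · rw [Function.update_of_ne e1, h1]
        · rw [Function.update_of_ne e2, h2]
  · rintro (⟨x₁, x₂, y₁, y₂, hx, h1, h2, hf⟩ | ⟨y, ⟨x', y', hx, h1, hf⟩, rfl⟩)
    · have e1 : x₁ ≠ x := by rintro rfl; simp at h1
      have e2 : x₂ ≠ x := by rintro rfl; simp at h2
      rw [Function.update_of_ne e1] at h1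
      rw [Function.update_of_ne e2] at h2
      refine ⟨x₁, x₂, y₁, y₂, hx, ?_, ?_, hf⟩
      · rw [Function.update_of_ne e1, h1]
      · rw [Function.update_of_ne e2, h2]
    · exact ⟨x, x', y, y', hx, by simp, by rw [Function.update_of_ne hx.symm, h1], hf⟩

/-- If the other cells already collide, D_x is irrelevant; otherwise exactly the values colliding
with another cell matter. -/
lemma splits_collides [DecidableEq T] (f : X → Bits n → T) {Q : ℕ} (x : X) (d : DB X n)
    (hd : dbSize (Function.update d x none) ≤ Q) :
    Splits (Collides f) (Q * Gam' f / 2 ^ n) x d := by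
  by_cases h : Collides f (Function.update d x none)
  · refine ⟨∅, True, True, by simp; positivity, fun u => ⟨by simp, fun _ => ?_⟩⟩
    simp only [eq_iff_iff, iff_true]
    exact (collides_update_iff f x d u).2 (Or.inl h)
  · refine ⟨(collidingValues f x d).map Function.Embedding.some, False, True, ?_, fun u => ?_⟩
    · rw [sum_wvec_sq_map]
      have h1 : (collidingValues f x d).card ≤ Q * Gam' f :=
        (card_collidingValues_le f x d).trans (Nat.mul_le_mul_right _ hd)
      have h2 : ((collidingValues f x d).card : ℝ) ≤ Q * Gam' f := by exact_mod_cast h1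
      gcongr
    · rw [collides_update_iff]
      simp only [h, false_or, Finset.mem_map, Function.Embedding.some_apply, eq_iff_iff, iff_true,
        iff_false]
      constructor
      · rintro ⟨y, hy, rfl⟩
        exact ⟨y, hy, rfl⟩
      · rintro hu ⟨y, hy, rfl⟩
        exact hu ⟨y, hy, rfl⟩

end Collisions

/-! ### A single cell -/

section Cell

variable {n : ℕ} {O : Type*} [Fintype O]

open Classical in
-- The overlap with |φ₀⟩ stays small after a measurement that depends on few values of the cell. If
-- μ o holds at ⊥, the sum is minus that of the excluded values, since v sums to zero; if not, it is
-- the sum of the included values. Either way only values in B occur. The two cases account for the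
-- factor 2.
lemma sum_norm_sum_some_sq_le (μ : O → Option (Bits n) → Prop)
    (hμ : ∀ u, ∑ o, (if μ o u then (1 : ℝ) else 0) ≤ 1) (B : Finset (Bits n))
    (hB : ∀ o, ∀ y ∉ B, (μ o (some y) ↔ μ o none)) (v : Option (Bits n) → ℂ)
    (hv : ∑ y, v (some y) = 0) :
    ∑ o, ‖∑ y, if μ o (some y) then v (some y) else 0‖ ^ 2 ≤
      2 * B.card * ∑ y, ‖v (some y)‖ ^ 2 := by
  have key : ∀ o, ‖∑ y, if μ o (some y) then v (some y) else 0‖ ^ 2 ≤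
      B.card * ∑ y, (if μ o (some y) then (1 : ℝ) else 0) * ‖v (some y)‖ ^ 2 +
      (if μ o none then (1 : ℝ) else 0) * (B.card * ∑ y, ‖v (some y)‖ ^ 2) := by
    intro o
    have nn1 : 0 ≤ ∑ y, (if μ o (some y) then (1 : ℝ) else 0) * ‖v (some y)‖ ^ 2 :=
      Finset.sum_nonneg fun y _ => by positivity
    by_cases h : μ o none
    · have e : (∑ y, if μ o (some y) then v (some y) else 0) =
          ∑ y ∈ B, -(if μ o (some y) then 0 else v (some y)) := by
        have hv' := hv
        rw [← Finset.sum_add_sum_compl B] at hv' ⊢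
        have e1 : ∑ y ∈ Bᶜ, (if μ o (some y) then v (some y) else 0) = ∑ y ∈ Bᶜ, v (some y) := by
          refine Finset.sum_congr rfl fun y hy => ?_
          rw [if_pos ((hB o y (by simpa using hy)).2 h)]
        rw [e1, eq_neg_of_add_eq_zero_right hv', ← Finset.sum_neg_distrib, ← Finset.sum_add_distrib]
        refine Finset.sum_congr rfl fun y _ => ?_
        split_ifs <;> simp
      rw [e, if_pos h, one_mul]
      refine (norm_sum_sq_le _ _).trans (le_add_of_nonneg_of_le (by positivity) ?_)
      gcongr
      refine (Finset.sum_le_sum_of_subset_of_nonneg (Finset.subset_univ _)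
        fun _ _ _ => by positivity).trans (Finset.sum_le_sum fun y _ => ?_)
      split_ifs <;> simp
    · have e : (∑ y, if μ o (some y) then v (some y) else 0) =
          ∑ y ∈ B, if μ o (some y) then v (some y) else 0 := by
        symm
        refine Finset.sum_subset (Finset.subset_univ _) fun y _ hy => ?_
        rw [if_neg fun hh => h ((hB o y hy).1 hh)]
      rw [e, if_neg h, zero_mul, add_zero]
      refine (norm_sum_sq_le _ _).trans ?_
      gcongr
      refine (Finset.sum_le_sum_of_subset_of_nonneg (Finset.subset_univ _)
        fun _ _ _ => by positivity).trans (Finset.sum_le_sum fun y _ => ?_)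
      split_ifs <;> simp
  have nn : 0 ≤ ∑ y, ‖v (some y)‖ ^ 2 := Finset.sum_nonneg fun y _ => by positivity
  refine (Finset.sum_le_sum fun o _ => key o).trans ?_
  rw [Finset.sum_add_distrib, ← Finset.mul_sum, ← Finset.sum_mul, Finset.sum_comm]
  have h1 : ∑ y, ∑ o, (if μ o (some y) then (1 : ℝ) else 0) * ‖v (some y)‖ ^ 2 ≤
      ∑ y, ‖v (some y)‖ ^ 2 := by
    refine Finset.sum_le_sum fun y _ => ?_
    rw [← Finset.sum_mul]
    exact mul_le_of_le_one_left (by positivity) (hμ _)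
  have h2 := mul_le_of_le_one_left (b := (B.card : ℝ) * ∑ y, ‖v (some y)‖ ^ 2) (by positivity)
    (hμ none)
  have h3 := mul_le_mul_of_nonneg_left h1 (Nat.cast_nonneg (α := ℝ) B.card)
  linarith

open Classical in
/-- A query on a cell without hits rarely responds with a hit. -/
lemma sum_hit_cell_le (μ : O → Option (Bits n) → Prop)
    (hμ : ∀ u, ∑ o, (if μ o u then (1 : ℝ) else 0) ≤ 1) (B : Finset (Bits n))
    (hB : ∀ o, ∀ y ∉ B, (μ o (some y) ↔ μ o none)) (S : Finset (Bits n))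
    (hS : ∀ o, ∀ y ∈ S, ¬ μ o (some y)) (v : Option (Bits n) → ℂ)
    (hv : ∑ y, v (some y) = 0) (φ : O → Option (Bits n) → ℂ)
    (hφ : ∀ o u, φ o u = if μ o u then v u else 0) :
    ∑ u, ∑ o, (if u.getD 0 ∈ S then
      ‖φ o u - wvec n u * ∑ a, wvec n a * φ o a‖ ^ 2 else 0) ≤
      (2 * (S.card + B.card)) / 2 ^ n * ∑ u, ‖v u‖ ^ 2 := by
  have hw : ∀ y, ‖((wvec n (some y) : ℝ) : ℂ)‖ ^ 2 = (2 ^ n)⁻¹ := by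
    intro y
    rw [Complex.norm_real, Real.norm_eq_abs, sq_abs, wvec, neg_sq, inv_sqrt_two_pow_sq]
  have hsum : ∑ o, ∑ a, ‖φ o a‖ ^ 2 ≤ ∑ u, ‖v u‖ ^ 2 := by
    rw [Finset.sum_comm]
    refine Finset.sum_le_sum fun u _ => ?_
    have e : ∀ o, ‖φ o u‖ ^ 2 = (if μ o u then (1 : ℝ) else 0) * ‖v u‖ ^ 2 := by
      intro o
      rw [hφ]
      split_ifs <;> simp
    simp_rw [e]
    rw [← Finset.sum_mul]
    exact mul_le_of_le_one_left (by positivity) (hμ _)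
  -- A cell in state ⊥ after F gives the response 0, which may be a hit. Its amplitude is the
  -- overlap of φ o with |φ₀⟩.
  have hnone : ∑ o, ‖φ o none - wvec n none * ∑ a, wvec n a * φ o a‖ ^ 2 ≤
      2 * B.card / 2 ^ n * ∑ u, ‖v u‖ ^ 2 := by
    have e : ∀ o, ‖φ o none - wvec n none * ∑ a, wvec n a * φ o a‖ ^ 2 =
        (2 ^ n)⁻¹ * ‖∑ y, if μ o (some y) then v (some y) else 0‖ ^ 2 := by
      intro o
      have e1 : φ o none - wvec n none * ∑ a, wvec n a * φ o a =
          -((wvec n (some 0) : ℝ) * ∑ y, if μ o (some y) then v (some y) else 0) := by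
        rw [Fintype.sum_option, Finset.mul_sum]
        simp only [← hφ]
        simp [wvec]
      rw [e1, norm_neg, norm_mul, mul_pow, hw]
    simp_rw [e]
    rw [← Finset.mul_sum]
    have h1 := sum_norm_sum_some_sq_le μ hμ B hB v hv
    have h2 : ∑ y, ‖v (some y)‖ ^ 2 ≤ ∑ u, ‖v u‖ ^ 2 := by
      rw [Fintype.sum_option]
      exact le_add_of_nonneg_left (by positivity)
    calc _ ≤ (2 ^ n : ℝ)⁻¹ * (2 * B.card * ∑ u, ‖v u‖ ^ 2) := by
          gcongr
          exact h1.trans (by gcongr)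
      _ = _ := by ring
  -- φ o vanishes at hits, so only the rank-one part of F contributes: the w-weight 2^{-n} of y
  -- times ‖w‖² = 2.
  have hsome : ∀ o, ∀ y ∈ S, ‖φ o (some y) - wvec n (some y) * ∑ a, wvec n a * φ o a‖ ^ 2 ≤
      (2 ^ n)⁻¹ * (2 * ∑ a, ‖φ o a‖ ^ 2) := by
    intro o y hy
    rw [hφ o (some y), if_neg (hS o y hy), zero_sub, norm_neg, norm_mul, mul_pow, hw]
    gcongr
    have := norm_sum_mul_sq_le Finset.univ (fun a => ((wvec n a : ℝ) : ℂ)) (φ o)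
    simpa only [Complex.norm_real, Real.norm_eq_abs, sq_abs, sum_wvec_sq] using this
  rw [Fintype.sum_option]
  calc _ ≤ 2 * B.card / 2 ^ n * ∑ u, ‖v u‖ ^ 2 +
        ∑ y ∈ S, ∑ o, (2 ^ n : ℝ)⁻¹ * (2 * ∑ a, ‖φ o a‖ ^ 2) := by
        refine add_le_add (le_trans (Finset.sum_le_sum fun o _ => ?_) hnone) ?_
        · split_ifs
          · exact le_rfl
          · positivity
        · rw [← Finset.sum_filter_add_sum_filter_not Finset.univ (· ∈ S)]
          rw [Finset.sum_eq_zero (s := Finset.univ.filter (· ∉ S)), add_zero,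
            Finset.filter_mem_eq_inter, Finset.univ_inter]
          · refine Finset.sum_le_sum fun y hy => Finset.sum_le_sum fun o _ => ?_
            rw [Option.getD_some, if_pos hy]
            exact hsome o y hy
          · intro y hy
            simp only [Finset.mem_filter, Finset.mem_univ, true_and] at hy
            simp [hy]
    _ ≤ 2 * B.card / 2 ^ n * ∑ u, ‖v u‖ ^ 2 +
        S.card * ((2 ^ n : ℝ)⁻¹ * (2 * ∑ u, ‖v u‖ ^ 2)) := by
        rw [Finset.sum_const, nsmul_eq_mul, ← Finset.mul_sum, ← Finset.mul_sum]
        gcongr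
    _ = _ := by ring

end Cell

/-! ### Responses that hit an announced value without being extracted -/

section Extraction

variable {X T E W R : Type*} {n ℓ : ℕ} [Fintype X] [LinearOrder X] [Fintype T] [DecidableEq T]
  [Fintype E] [DecidableEq E] [Fintype W] [DecidableEq W] [Fintype R]

/-- Unfolds the recursion into one equation per announced value. The clause on ξ carries the earlier
announcements through the induction and is void for j = 0. -/
lemma matches_iff (f : X → Bits n → T) {j q : ℕ} (P : Program X n T E W ℓ j q) (b : Branch P)
    (o : Outs P b) (τ : Fin j → T) (ξ : Fin j → Option X) (d : DB X n) :
    (Matches f P b o d ∧ ∀ i, ξ i = extracted f (τ i) d) ↔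
      ∀ i, extractions P b o ξ i = extracted f (announced P b τ i) d := by
  induction P with
  | finish m K hK out => simp [Matches, extractions, announced]
  | query next ih => exact ih b o τ ξ
  | announce t next ih =>
    change Branch next at b
    change Option X × Outs next b at o
    refine Iff.trans ?_ (ih b o.2 (Fin.snoc (α := fun _ => T) τ t)
      (Fin.snoc (α := fun _ => Option X) ξ o.1))
    change ((Matches f next b o.2 d ∧ extracted f t d = o.1) ∧ _) ↔ _
    simp only [Fin.forall_fin_succ', Fin.snoc_castSucc, Fin.snoc_last, eq_comm (a := o.1)]
    tauto
  | measure m K hK next ih => exact ih b.1 b.2 o τ ξ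

lemma actD_FS_res_actD_FS {s : Finset X} {x : X} (hx : x ∈ s) (p : Option (Bits n) → Prop)
    (v : R × DB X n → ℂ) :
    actD (FS n s) (res (fun d => p (d x)) (actD (FS n s) v)) =
      actD (FS n {x}) (res (fun d => p (d x)) (actD (FS n {x}) v)) := by
  classical
  have e : ∀ w : R × DB X n → ℂ, res (fun d => p (d x)) w =
      actD (tens (Function.update 1 x (Matrix.diagonal fun u => if p u then (1 : ℂ) else 0))) w := by
    intro w
    rw [tens_update_diagonal]
    ext a
    by_cases h : p (a.2 x) <;> simp [actD, Matrix.mulVec_diagonal, res, h]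
  rw [e, e, ← actD_mul, ← actD_mul, ← actD_mul, ← actD_mul, FS_mul_tens_mul_FS hx,
    FS_mul_tens_mul_FS (Finset.mem_singleton_self x)]

/-- F on the cells other than x preserves norms and commutes with a measurement of D_x. -/
lemma nsq_res_actD_FS {s : Finset X} {x : X} (hx : x ∈ s) (p : Option (Bits n) → Prop)
    (v : R × DB X n → ℂ) :
    nsq (res (fun d => p (d x)) (actD (FS n s) v)) =
      nsq (res (fun d => p (d x)) (actD (FS n {x}) v)) := by
  rw [← nsq_actD_FS s, actD_FS_res_actD_FS hx, nsq_actD_FS]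

/-- The states that a run with the simulator can reach are orthogonal to `|φ₀⟩` in each cell. -/
lemma sum_actD_FS_plain_update (a : (X → Bits n) → R → ℂ) (x : X) (r : R) (d : DB X n) :
    ∑ y, actD (FS n Finset.univ) (plain a) (r, Function.update d x (some y)) = 0 := by
  set v := actD (FS n Finset.univ) (plain a) with hv
  -- Applying F once more to cell x leaves it without a ⊥ component; the ⊥ amplitude after F is the
  -- overlap with |φ₀⟩ before it.
  have h1 : actD (FS n {x}) v = actD (FS n (Finset.univ.erase x)) (plain a) := by
    rw [hv, ← actD_mul, ← Finset.insert_erase (Finset.mem_univ x),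
      FS_insert (Finset.notMem_erase x _), ← Matrix.mul_assoc, FS_mul_self, Matrix.one_mul,
      Finset.insert_erase (Finset.mem_univ x)]
  have h2 := congrFun h1 (r, Function.update d x none)
  have h3 : actD (FS n (Finset.univ.erase x)) (plain a) (r, Function.update d x none) = 0 := by
    refine Finset.sum_eq_zero fun d' _ => ?_
    by_cases hd : d' x = none
    · have : plain a (r, d') = 0 := if_neg fun h => h x hd
      simp only [this, mul_zero]
    · have : FS n (Finset.univ.erase x) (Function.update d x none) d' = 0 := by
        refine Finset.prod_eq_zero (Finset.mem_univ x) ?_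
        simp [Matrix.one_apply, eq_comm (a := none), hd]
      exact mul_eq_zero_of_left this _
  have h4 : actD (FS n {x}) v (r, Function.update d x none) =
      v (r, Function.update d x none) - wvec n none * (wvec n none * v (r, Function.update d x none)
        + ∑ y, ((-(√(2 ^ n))⁻¹ : ℝ) : ℂ) * v (r, Function.update d x (some y))) := by
    simp only [actD, FS_singleton_mulVec, Function.update_self, Function.update_idem,
      Fintype.sum_option]
    rfl
  rw [h3, h4, ← Finset.mul_sum] at h2
  have hs : ((-(√(2 ^ n))⁻¹ : ℝ) : ℂ) ≠ 0 := by
    rw [Complex.ofReal_ne_zero]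
    exact neg_ne_zero.2 (inv_ne_zero (Real.sqrt_ne_zero'.2 (by positivity)))
  have h5 : ((-(√(2 ^ n))⁻¹ : ℝ) : ℂ) * ∑ y, v (r, Function.update d x (some y)) = 0 := by
    have : ((wvec n none : ℝ) : ℂ) = 1 := by simp [wvec]
    rw [this] at h2
    linear_combination -h2
  exact (mul_eq_zero.1 h5).resolve_left hs

open Classical in
/-- If the extraction on `tᵢ` does not return `x`, and there are no collisions, then a query on `x`
rarely responds with a preimage of `tᵢ`. -/
lemma sum_nsq_hit_le (f : X → Bits n → T) {q : ℕ} (P : Program X n T E W ℓ 0 q) (b : Branch P)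
    (v : R × DB X n → ℂ) (hv : SizeLE q v)
    (hv0 : ∀ x r d, ∑ y, v (r, Function.update d x (some y)) = 0) (x : X) (i : Fin ℓ) :
    ∑ o, nsq (res (fun d => f x ((d x).getD 0) = announced P b Fin.elim0 i)
      (actD (FS n {x}) (res (fun d => some x ≠ extractions P b o Fin.elim0 i ∧
        Matches f P b o d ∧ ¬ Collides f d) v))) ≤
      2 * (Gam f + (ℓ * Gam f + q * Gam' f)) / 2 ^ n * nsq v := by
  set t := announced P b Fin.elim0 with ht
  have hm : ∀ o d, Matches f P b o d ↔ ∀ i, extractions P b o Fin.elim0 i = extracted f (t i) d := by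
    intro o d
    rw [← matches_iff f P b o Fin.elim0 Fin.elim0 d]
    simp
  set μ : Outs P b → DB X n → Prop := fun o d => some x ≠ extractions P b o Fin.elim0 i ∧
        Matches f P b o d ∧ ¬ Collides f d with hμ
  simp only [nsq_prod (R := R)]
  rw [Finset.sum_comm, Finset.mul_sum]
  refine Finset.sum_le_sum fun r _ => ?_
  simp only [nsq]
  rw [Finset.sum_comm, Finset.mul_sum]
  refine sum_le_sum_of_update x _ _ fun d => ?_
  set S : Finset (Bits n) := Finset.univ.filter fun y => f x y = t i with hS
  -- The values of D_x that can affect a collision or any of the ℓ extractions; off B the condition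
  -- μ is as for D_x = ⊥.
  set B : Finset (Bits n) := collidingValues f x d ∪
    Finset.univ.biUnion fun i' : Fin ℓ => Finset.univ.filter fun y => f x y = t i' with hB
  have e : ∀ u o, ‖res (fun d => f x ((d x).getD 0) = t i) (actD (FS n {x}) (res (μ o) v))
      (r, Function.update d x u)‖ ^ 2 = if u.getD 0 ∈ S then
        ‖(if μ o (Function.update d x u) then v (r, Function.update d x u) else 0) -
          wvec n u * ∑ a, wvec n a * (if μ o (Function.update d x a) then
            v (r, Function.update d x a) else 0)‖ ^ 2 else 0 := by
    intro u o
    have e1 : u.getD 0 ∈ S ↔ f x (u.getD 0) = t i := by simp [hS]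
    simp only [res, actD, FS_singleton_mulVec, Function.update_self, Function.update_idem, e1]
    split_ifs <;> simp
  refine (le_of_eq (Finset.sum_congr rfl fun u _ => Finset.sum_congr rfl fun o _ => e u o)).trans ?_
  rw [← Finset.mul_sum]
  by_cases hd : dbSize (Function.update d x none) ≤ q
  · have hBc : B.card ≤ ℓ * Gam f + q * Gam' f := by
      refine (Finset.card_union_le _ _).trans ?_
      rw [add_comm]
      refine add_le_add ?_ ((card_collidingValues_le f x d).trans (Nat.mul_le_mul_right _ hd))
      refine (Finset.card_biUnion_le_card_mul _ _ (Gam f) fun i' _ => ?_).trans (by simp)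
      exact card_filter_le_Gam f x (t i')
    have hSc : S.card ≤ Gam f := card_filter_le_Gam f x (t i)
    have hBc' : (B.card : ℝ) ≤ ℓ * Gam f + q * Gam' f := by exact_mod_cast hBc
    have hSc' : (S.card : ℝ) ≤ Gam f := by exact_mod_cast hSc
    refine (sum_hit_cell_le (fun o u => μ o (Function.update d x u)) ?_ B ?_ S ?_
      (fun u => v (r, Function.update d x u)) (hv0 x r d)
      (fun o u => if μ o (Function.update d x u) then v (r, Function.update d x u) else 0)
      fun o u => by congr).trans ?_
    · intro u
      refine le_trans (Finset.sum_le_sum fun o _ => ?_)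
        (sum_ite_matches f P b (Function.update d x u)).le
      by_cases h : μ o (Function.update d x u)
      · rw [if_pos h, if_pos h.2.1]
      · rw [if_neg h]
        positivity
    · intro o y hy
      simp only [hB, Finset.mem_union, Finset.mem_biUnion, Finset.mem_filter, Finset.mem_univ,
        true_and, not_or, not_exists] at hy
      have h1 : Collides f (Function.update d x (some y)) ↔
          Collides f (Function.update d x none) := by
        rw [collides_update_iff]
        simp [hy.1]
      have h2 : ∀ i', extracted f (t i') (Function.update d x (some y)) =
          extracted f (t i') (Function.update d x none) := by
        intro i'
        refine extracted_congr fun x' => ?_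
        by_cases hx : x' = x
        · subst hx
          rw [hits_update_self, hits_update_self]
          simp [hy.2 i']
        · rw [hits_update_of_ne hx, hits_update_of_ne hx]
      simp only [hμ, hm, h1, h2]
    -- With such a y in its cell, x hits tᵢ, so the extraction returns some x', which differs from x
    -- by assumption. Both cells are mapped to tᵢ, a collision.
    · rintro o y hy ⟨h1, h2, h3⟩
      have hy' : f x y = t i := by simpa [hS] using hy
      have hi := (hm o _).1 h2 i
      have hx : Hits f (t i) (Function.update d x (some y)) x :=
        hits_update_self _ |>.2 ⟨y, rfl, hy'⟩
      rcases hz : extracted f (t i) (Function.update d x (some y)) with _ | x'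
      · exact extracted_eq_none.1 hz x hx
      · have hne : x ≠ x' := by
          rintro rfl
          exact h1 (hi.trans hz).symm
        obtain ⟨⟨y', hd', hf'⟩, -⟩ := extracted_eq_some.1 hz
        exact h3 ⟨x, x', y, y', hne, by simp, hd', hy'.trans hf'.symm⟩
    · have : 0 ≤ ∑ u, ‖v (r, Function.update d x u)‖ ^ 2 :=
        Finset.sum_nonneg fun _ _ => by positivity
      gcongr
  · have hz : ∀ u, v (r, Function.update d x u) = 0 := by
      intro u
      refine hv _ ?_
      have := dbSize_update_none_le d x u
      simp only
      omega
    simp [hz]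

/-- All responses are read in one measurement, so the marginal of the i-th is that of a single query
on x, whatever the other queries are. -/
lemma sum_ite_nsq_actD_classicalQueries (xs : Fin ℓ → Option X) (i : Fin ℓ) (x : X)
    (hx : xs i = some x) (p : Bits n → Prop) [DecidablePred p]
    (p' : Option (Bits n) → Prop) [DecidablePred p'] (hp : ∀ y, p' (some y) ↔ p y)
    (v : R × DB X n → ℂ) :
    ∑ h, (if p' (h i) then nsq (actD (classicalQueries xs h) v) else 0) =
      nsq (res (fun d => p ((d x).getD 0)) (actD (FS n {x}) v)) := by
  classical
  rw [← nsq_res_actD_FS (Finset.mem_univ x) (fun u => p (u.getD 0))]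
  simp_rw [actD_classicalQueries (s := Finset.univ) (xs := xs) (by simp), nsq_actD_FS]
  rw [← sum_nsq_res (responses xs) (res _ _)]
  refine Finset.sum_congr rfl fun h _ => ?_
  have e : ∀ d : DB X n, responses xs d = h → (p' (h i) ↔ p ((d x).getD 0)) := by
    rintro d rfl
    simp only [responses, hx, Option.map_some, hp]
  rw [res_res]
  by_cases hh : p' (h i)
  · rw [if_pos hh]
    congr 2
    ext d
    exact ⟨fun hd => ⟨hd, (e d hd).1 hh⟩, fun hd => hd.1⟩
  · rw [if_neg hh]
    symm
    have : (res (fun d => responses xs d = h ∧ p ((d x).getD 0)) (actD (FS n Finset.univ) v)) = 0 := by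
      ext a
      exact if_neg fun hd => hh ((e a.2 hd.1).2 hd.2)
    rw [this]
    simp [nsq]

end Extraction

/-! ### The probability of a bad opening -/

section Openings

variable {X T E W R : Type*} {n ℓ q : ℕ} [Fintype X] [LinearOrder X] [Fintype T] [DecidableEq T]
  [Fintype E] [DecidableEq E] [Fintype W] [DecidableEq W] [Fintype R]

lemma trace_traceOutDB_proj (v : W × DB X n → ℂ) : (traceOutDB (proj v)).trace.re = nsq v := by
  simp only [nsq, Fintype.sum_prod_type, Matrix.trace, Matrix.diag, traceOutDB, Matrix.of_apply,
    Complex.re_sum, proj, Matrix.vecMulVec_apply, Pi.star_apply, Complex.star_def, Complex.mul_conj,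
    Complex.ofReal_re, Complex.normSq_eq_norm_sq]

open Classical in
lemma prob_simState (f : X → Bits n → T) (A : Algorithm X n T E W ℓ q)
    (ev : SimOutcome X n T ℓ → Prop) :
    (simState f A).prob ev = ∑ b, ∑ o, ∑ h,
      if ev (announced A.prog b Fin.elim0, extractions A.prog b o Fin.elim0, outputs A.prog b, h) then
        nsq (actD (classicalQueries (outputs A.prog b) h)
          (extractVec f A.prog b o (initVec A.init))) else 0 := by
  have e : ∀ c, (if ev c then (simState f A c).trace.re else 0) = ∑ b, ∑ o, ∑ h,
      if c = (announced A.prog b Fin.elim0, extractions A.prog b o Fin.elim0, outputs A.prog b, h) then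
        (if ev c then nsq (actD (classicalQueries (outputs A.prog b) h)
          (extractVec f A.prog b o (initVec A.init))) else 0) else 0 := by
    intro c
    by_cases hc : ev c
    · simp only [if_pos hc, simState_apply, Matrix.trace_sum, Complex.re_sum]
      refine Finset.sum_congr rfl fun b _ => Finset.sum_congr rfl fun o _ =>
        Finset.sum_congr rfl fun h _ => ?_
      split_ifs
      · exact trace_traceOutDB_proj _
      · simp
    · simp [if_neg hc]
  rw [CQState.prob, Finset.sum_congr rfl fun c _ => e c, Finset.sum_comm]
  refine Finset.sum_congr rfl fun b _ => ?_
  rw [Finset.sum_comm]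
  refine Finset.sum_congr rfl fun o _ => ?_
  rw [Finset.sum_comm]
  refine Finset.sum_congr rfl fun h _ => ?_
  rw [Finset.sum_ite_eq' , if_pos (Finset.mem_univ _)]

/-- The final opening of some announced value is not the extracted one. -/
def BadOpening (f : X → Bits n → T) (c : SimOutcome X n T ℓ) : Prop :=
  ∃ i, c.2.2.1 i ≠ c.2.1 i ∧ Opens f (c.2.2.1 i) (c.2.2.2 i) (c.1 i)

open Classical in
-- Union bound over i: the output ⊥ never opens, and each other output is covered by
-- `sum_nsq_hit_le`.
lemma sum_bad_opening_le (f : X → Bits n → T) (P : Program X n T E W ℓ 0 q) (b : Branch P)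
    (v : R × DB X n → ℂ) (hv : SizeLE q v)
    (hv0 : ∀ x r d, ∑ y, v (r, Function.update d x (some y)) = 0) :
    ∑ o, ∑ h, (if BadOpening f (announced P b Fin.elim0, extractions P b o Fin.elim0, outputs P b, h)
      then nsq (actD (classicalQueries (outputs P b) h)
        (res (fun d => Matches f P b o d ∧ ¬ Collides f d) v)) else 0) ≤
      ℓ * (2 * (Gam f + (ℓ * Gam f + q * Gam' f)) / 2 ^ n * nsq v) := by
  set t := announced P b Fin.elim0 with ht
  set C := classicalQueries (n := n) (outputs P b) with hC
  have hnn := nsq_nonneg v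
  have h1 : ∀ i : Fin ℓ, ∑ o, ∑ h, (if outputs P b i ≠ extractions P b o Fin.elim0 i ∧
      Opens f (outputs P b i) (h i) (t i) then nsq (actD (C h)
        (res (fun d => Matches f P b o d ∧ ¬ Collides f d) v)) else 0) ≤
      2 * (Gam f + (ℓ * Gam f + q * Gam' f)) / 2 ^ n * nsq v := by
    intro i
    rcases hx : outputs P b i with _ | x
    · refine (le_of_eq (Finset.sum_eq_zero fun o _ => Finset.sum_eq_zero fun h _ => ?_)).trans
        (by positivity)
      exact if_neg fun h => h.2
    · refine (Finset.sum_le_sum fun o _ => ?_).trans (sum_nsq_hit_le f P b v hv hv0 x i)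
      by_cases hne : some x ≠ extractions P b o Fin.elim0 i
      · simp only [hne, ne_eq, not_false_eq_true, true_and]
        exact (sum_ite_nsq_actD_classicalQueries (outputs P b) i x hx (fun y => f x y = t i)
          (fun u => Opens f (some x) u (t i)) (fun y => Iff.rfl) _).le
      · simp only [hne, false_and, if_false, Finset.sum_const_zero]
        exact nsq_nonneg _
  calc _ ≤ ∑ o, ∑ h, ∑ i : Fin ℓ, (if outputs P b i ≠ extractions P b o Fin.elim0 i ∧
      Opens f (outputs P b i) (h i) (t i) then nsq (actD (C h)
        (res (fun d => Matches f P b o d ∧ ¬ Collides f d) v)) else 0) := by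
        refine Finset.sum_le_sum fun o _ => Finset.sum_le_sum fun h _ => ?_
        have hn : ∀ i ∈ (Finset.univ : Finset (Fin ℓ)),
            0 ≤ (if outputs P b i ≠ extractions P b o Fin.elim0 i ∧
              Opens f (outputs P b i) (h i) (t i) then nsq (actD (C h)
              (res (fun d => Matches f P b o d ∧ ¬ Collides f d) v)) else 0) := by
          intro i _
          split_ifs
          · exact nsq_nonneg _
          · exact le_rfl
        split_ifs with hb
        · obtain ⟨i, hi⟩ := hb
          refine le_trans ?_ (Finset.single_le_sum hn (Finset.mem_univ i))
          rw [if_pos hi]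
        · exact Finset.sum_nonneg hn
    _ = ∑ i : Fin ℓ, ∑ o, ∑ h, (if outputs P b i ≠ extractions P b o Fin.elim0 i ∧
      Opens f (outputs P b i) (h i) (t i) then nsq (actD (C h)
        (res (fun d => Matches f P b o d ∧ ¬ Collides f d) v)) else 0) := by
        rw [Finset.sum_comm]
        simp_rw [Finset.sum_comm (s := (Finset.univ : Finset (Fin ℓ)))]
        rw [Finset.sum_comm]
    _ ≤ _ := (Finset.sum_le_sum fun i _ => h1 i).trans (by simp)

lemma branchVec_zero {j : ℕ} (P : Program X n T E W ℓ j q) (b : Branch P) :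
    branchVec P b 0 = 0 := by
  induction P with
  | finish m K hK out => exact Matrix.mulVec_zero _
  | query next ih =>
    refine Eq.trans ?_ (ih b)
    simp only [branchVec, Matrix.mulVec_zero]
  | announce t next ih => exact ih b
  | measure m K hK next ih =>
    refine Eq.trans ?_ (ih b.1 b.2)
    simp only [branchVec, Matrix.mulVec_zero]

lemma sizeLE_initVec (φ : Reg X n E → ℂ) : SizeLE 0 (initVec (X := X) (n := n) φ) := by
  intro a ha
  refine if_neg fun h => ?_
  rw [h] at ha
  simp [dbSize] at ha

/-- The run with the simulator rarely produces a collision in the database. -/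
lemma sum_nsq_collides_le (f : X → Bits n → T) (P : Program X n T E W ℓ 0 q) (φ : Reg X n E → ℂ) :
    ∑ b, nsq (res (Collides f) (branchVec P b (initVec φ))) ≤
      16 * q ^ 3 * Gam' f / 2 ^ n * nsq (initVec φ) := by
  have hs := sizeLE_initVec (X := X) (n := n) φ
  -- The empty database has no collision, so the colliding part of the final state is itself a
  -- commutator.
  have h0 : res (fun d => Collides f d = True) (initVec φ) = 0 := by
    ext a
    by_cases hd : a.2 = fun _ => none
    · refine if_neg fun h => ?_
      rw [hd] at h
      obtain ⟨x, x', y, y', -, h1, -⟩ := of_eq_true h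
      cases h1
    · simp [res, initVec, hd]
  -- At most q cells are ever in use, so β = qΓ'/2^n suffices, and (4q√β)² = 16q³Γ'/2^n.
  have key := sum_commutator_branchVec_le (g := Collides f) (β := q * Gam' f / 2 ^ n) (Q := q)
    (by positivity) (fun x d hd => splits_collides f x d hd) P (k := 0) (by omega) hs
  have hβ : (q * (4 * √(q * Gam' f / 2 ^ n : ℝ))) ^ 2 = 16 * q ^ 3 * Gam' f / 2 ^ n := by
    rw [mul_pow, mul_pow, Real.sq_sqrt (by positivity)]
    ring
  rw [hβ] at key
  refine le_trans (Finset.sum_le_sum fun b _ => ?_) key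
  refine le_trans (le_of_eq ?_)
    (Finset.single_le_sum (fun z _ => nsq_nonneg _) (Finset.mem_univ True))
  have e : (fun d : DB X n => Collides f d = True) = Collides f := funext fun d => by simp
  change _ = nsq (branchVec P b (res (fun d => Collides f d = True) (initVec φ)) -
    res (fun d => Collides f d = True) (branchVec P b (initVec φ)))
  rw [h0, branchVec_zero, zero_sub, e]
  simp only [nsq, Pi.neg_apply, norm_neg]

lemma nsq_actD_add_le (C : Matrix (DB X n) (DB X n) ℂ) (v w : R × DB X n → ℂ) :
    nsq (actD C (v + w)) ≤ 2 * nsq (actD C v) + 2 * nsq (actD C w) := by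
  have e : actD C (v + w) = actD C v + actD C w := by
    ext i
    exact congrFun (Matrix.mulVec_add C (fun d => v (i.1, d)) fun d => w (i.1, d)) i.2
  rw [e]
  exact sum_norm_add_sq_le_two (actD C v) (actD C w)

open Classical in
/-- The bound on the bad event if all extractions are postponed to the end of the run. -/
lemma sum_bad_opening_postponed_le (f : X → Bits n → T) (P : Program X n T E W ℓ 0 q)
    (φ : Reg X n E → ℂ) :
    ∑ b, ∑ o, ∑ h, (if BadOpening f
        (announced P b Fin.elim0, extractions P b o Fin.elim0, outputs P b, h)
      then nsq (actD (classicalQueries (outputs P b) h)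
        (res (Matches f P b o) (branchVec P b (initVec φ)))) else 0) ≤
      (32 * q ^ 3 * Gam' f / 2 ^ n + ℓ * (4 * (Gam f + (ℓ * Gam f + q * Gam' f)) / 2 ^ n)) *
        nsq (initVec φ) := by
  set ψ := initVec (X := X) (n := n) φ with hψ
  have hs : SizeLE 0 ψ := sizeLE_initVec φ
  -- The outer factors 2 come from splitting the final state into its colliding and collision-free
  -- parts, which may interfere after the classical queries.
  have h1 : ∀ b, ∑ o, ∑ h, (if BadOpening f
        (announced P b Fin.elim0, extractions P b o Fin.elim0, outputs P b, h)
      then nsq (actD (classicalQueries (outputs P b) h)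
        (res (Matches f P b o) (branchVec P b ψ))) else 0) ≤
      2 * nsq (res (Collides f) (branchVec P b ψ)) +
      2 * (ℓ * (2 * (Gam f + (ℓ * Gam f + q * Gam' f)) / 2 ^ n * nsq (branchVec P b ψ))) := by
    intro b
    set V := branchVec P b ψ with hV
    have hb := sum_bad_opening_le f P b V
      (by simpa using SizeLE.branchVec P b hs)
      -- The state is F on all cells of a superposition of functions, hence orthogonal to |φ₀⟩ in
      -- each cell.
      (fun x r d => by
        rw [hV, hψ, initVec_eq, branchVec_plain]
        exact sum_actD_FS_plain_update _ x r d)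
    have hc : ∑ o, ∑ h, nsq (actD (classicalQueries (outputs P b) h)
        (res (Matches f P b o) (res (Collides f) V))) = nsq (res (Collides f) V) := by
      simp only [sum_nsq_actD_classicalQueries, sum_nsq_res_matches]
    rw [← hc]
    refine le_trans ?_ (add_le_add_right (mul_le_mul_of_nonneg_left hb zero_le_two) _)
    simp only [Finset.mul_sum, ← Finset.sum_add_distrib]
    refine Finset.sum_le_sum fun o _ => Finset.sum_le_sum fun h _ => ?_
    have e : res (Matches f P b o) V = res (Matches f P b o) (res (Collides f) V) +
        res (fun d => Matches f P b o d ∧ ¬ Collides f d) V := by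
      ext a
      by_cases ha : Matches f P b o a.2 <;> by_cases ha' : Collides f a.2 <;> simp [res, ha, ha']
    split_ifs
    · rw [e]
      exact nsq_actD_add_le _ _ _
    · have := nsq_nonneg (actD (classicalQueries (outputs P b) h)
        (res (Matches f P b o) (res (Collides f) V)))
      linarith
  refine (Finset.sum_le_sum fun b _ => h1 b).trans ?_
  rw [Finset.sum_add_distrib, ← Finset.mul_sum, ← Finset.mul_sum, ← Finset.mul_sum,
    ← Finset.mul_sum, sum_nsq_branchVec]
  have := sum_nsq_collides_le f P φ
  refine (add_le_add_left (mul_le_mul_of_nonneg_left this zero_le_two) _).trans (le_of_eq ?_)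
  ring

/-- S − J = (√S − √J)(√S + √J), where the first factor is at most D and the second at most 2: an
error D in norm costs at most 2D in probability. -/
lemma le_add_of_le_sqrt_add_sq {S J D : ℝ} (hJ0 : 0 ≤ J) (hJ1 : J ≤ 1) (hS0 : 0 ≤ S) (hS1 : S ≤ 1)
    (hD0 : 0 ≤ D) (h : S ≤ (√J + D) ^ 2) : S ≤ J + 2 * D := by
  have hj := Real.sq_sqrt hJ0
  have hs := Real.sq_sqrt hS0
  have hj1 : √J ≤ 1 := Real.sqrt_le_one.2 hJ1
  have hs1 : √S ≤ 1 := Real.sqrt_le_one.2 hS1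
  have hj0 := Real.sqrt_nonneg J
  have hs0 := Real.sqrt_nonneg S
  have hsj : √S ≤ √J + D := Real.sqrt_le_iff.2 ⟨by positivity, h⟩
  have h1 : (√S - √J) * (√S + √J) ≤ D * (√S + √J) :=
    mul_le_mul_of_nonneg_right (by linarith) (by positivity)
  have h2 : D * (√S + √J) ≤ D * 2 := mul_le_mul_of_nonneg_left (by linarith) hD0
  nlinarith

/-- The outcomes of the extractions are close to those of postponed extractions, and the final
openings only depend on these up to the corresponding error. -/
lemma prob_badOpening_le (f : X → Bits n → T) (A : Algorithm X n T E W ℓ q) :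
    (simState f A).prob (BadOpening f) ≤ 1 ∧ (simState f A).prob (BadOpening f) ≤
      32 * q ^ 3 * Gam' f / 2 ^ n + ℓ * (4 * (Gam f + (ℓ * Gam f + q * Gam' f)) / 2 ^ n) +
        2 * (ℓ * (q * (4 * √(Gam f / 2 ^ n)))) := by
  classical
  have hne : Nonempty (Reg X n E) := by
    by_contra h
    rw [not_nonempty_iff] at h
    simpa using A.norm_init
  set ψ := initVec A.init with hψ
  have hn : nsq ψ = 1 := nsq_initVec A.norm_init
  set D : ℝ := ℓ * (q * (4 * √(Gam f / 2 ^ n))) with hD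
  have hD0 : 0 ≤ D := by positivity
  let bad : (Σ b : Branch A.prog, Outs A.prog b × (Fin ℓ → Option (Bits n))) → Prop := fun k =>
    BadOpening f (announced A.prog k.1 Fin.elim0, extractions A.prog k.1 k.2.1 Fin.elim0,
      outputs A.prog k.1, k.2.2)
  have hite : ∀ (p : Prop) [Decidable p] (v : W × DB X n → ℂ),
      nsq (if p then v else 0) = if p then nsq v else 0 := by
    intro p _ v
    split_ifs
    · rfl
    · simp [nsq]
  have hite_le : ∀ (p : Prop) [Decidable p] (v : W × DB X n → ℂ),
      nsq (if p then v else 0) ≤ nsq v := by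
    intro p _ v
    rw [hite]
    split_ifs
    · exact le_rfl
    · exact nsq_nonneg v
  have post := sum_bad_opening_postponed_le f A.prog A.init
  rw [← hψ, hn, mul_one] at post
  set J := ∑ b, ∑ o, ∑ h, (if BadOpening f
        (announced A.prog b Fin.elim0, extractions A.prog b o Fin.elim0, outputs A.prog b, h)
      then nsq (actD (classicalQueries (outputs A.prog b) h)
        (res (Matches f A.prog b o) (branchVec A.prog b ψ))) else 0) with hJ
  have hJ0 : 0 ≤ J := by
    refine Finset.sum_nonneg fun b _ => Finset.sum_nonneg fun o _ => Finset.sum_nonneg fun h _ => ?_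
    split_ifs
    · exact nsq_nonneg _
    · exact le_rfl
  have hJ1 : J ≤ 1 := by
    calc J ≤ ∑ b, ∑ o, ∑ h, nsq (actD (classicalQueries (outputs A.prog b) h)
        (res (Matches f A.prog b o) (branchVec A.prog b ψ))) := by
          refine Finset.sum_le_sum fun b _ => Finset.sum_le_sum fun o _ =>
            Finset.sum_le_sum fun h _ => ?_
          rw [← hite]
          exact hite_le _ _
      _ = 1 := by
          simp only [sum_nsq_actD_classicalQueries, sum_nsq_res_matches, sum_nsq_branchVec, hn]
  rw [prob_simState]
  set S := ∑ b, ∑ o, ∑ h, (if BadOpening f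
        (announced A.prog b Fin.elim0, extractions A.prog b o Fin.elim0, outputs A.prog b, h)
      then nsq (actD (classicalQueries (outputs A.prog b) h) (extractVec f A.prog b o ψ)) else 0)
      with hS
  have hS0 : 0 ≤ S := by
    refine Finset.sum_nonneg fun b _ => Finset.sum_nonneg fun o _ => Finset.sum_nonneg fun h _ => ?_
    split_ifs
    · exact nsq_nonneg _
    · exact le_rfl
  have hS1 : S ≤ 1 := by
    calc S ≤ ∑ b, ∑ o, ∑ h, nsq (actD (classicalQueries (outputs A.prog b) h)
        (extractVec f A.prog b o ψ)) := by
          refine Finset.sum_le_sum fun b _ => Finset.sum_le_sum fun o _ =>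
            Finset.sum_le_sum fun h _ => ?_
          rw [← hite]
          exact hite_le _ _
      _ = 1 := by
          simp only [sum_nsq_actD_classicalQueries, sum_nsq_extractVec, hn]
  -- Minkowski's inequality on the bad components. The classical queries act alike on both families
  -- and preserve norms, so the extractions need not be moved past them and D has no ℓ² term.
  have key : S ≤ (√J + D) ^ 2 * 1 := by
    have h := nsq_add_le (N := 1) (α := √J) (β := D)
      (fun k : Σ b : Branch A.prog, Outs A.prog b × (Fin ℓ → Option (Bits n)) =>
        if bad k then actD (classicalQueries (outputs A.prog k.1) k.2.2)
          (res (Matches f A.prog k.1 k.2.1) (branchVec A.prog k.1 ψ)) else 0)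
      (fun k => if bad k then actD (classicalQueries (outputs A.prog k.1) k.2.2)
          (extractVec f A.prog k.1 k.2.1 ψ - res (Matches f A.prog k.1 k.2.1)
            (branchVec A.prog k.1 ψ)) else 0)
      (Real.sqrt_nonneg _) hD0 zero_le_one ?_ ?_
    · refine le_trans (le_of_eq ?_) h
      simp only [Fintype.sum_sigma, Fintype.sum_prod_type, hS]
      refine Finset.sum_congr rfl fun b _ => Finset.sum_congr rfl fun o _ =>
        Finset.sum_congr rfl fun h _ => ?_
      by_cases hb : bad ⟨b, o, h⟩
      · refine (if_pos hb).trans ?_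
        rw [if_pos hb, if_pos hb, actD_sub, add_sub_cancel]
      · refine (if_neg hb).trans ?_
        rw [if_neg hb, if_neg hb, add_zero]
        simp [nsq]
    · rw [Real.sq_sqrt hJ0, mul_one]
      simp only [Fintype.sum_sigma, Fintype.sum_prod_type, hite]
      exact le_rfl
    · refine (Finset.sum_le_sum fun k _ => hite_le _ _).trans ?_
      simp only [Fintype.sum_sigma, Fintype.sum_prod_type, sum_nsq_actD_classicalQueries]
      have := sum_extractVec_sub_le f A.prog ψ
      rwa [Nat.sub_zero, hn] at this
  refine ⟨hS1, le_trans ?_ (add_le_add_left post (2 * D))⟩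
  exact le_add_of_le_sqrt_add_sq hJ0 hJ1 hS0 hS1 hD0 (by rwa [mul_one] at key)

lemma opening_bound_numeric {l q G g N R : ℝ} (hl : 0 ≤ l) (hq : 0 ≤ q) (hG : 0 ≤ G) (hg : 0 ≤ g)
    (hN : 0 < N) (hl1 : l = 0 ∨ 1 ≤ l) (hR1 : R ≤ 1)
    (hR : R ≤ 32 * q ^ 3 * g / N + l * (4 * (G + (l * G + q * g)) / N) +
      2 * (l * (q * (4 * √(G / N))))) :
    R ≤ 8 * l * (q + 1) * √(2 * G / N) +
      (40 * Real.exp 1 ^ 2 * (q + l + 1) ^ 3 * g + 2) / N := by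
  have hγ : √(G / N) ≤ √(2 * G / N) := by
    apply Real.sqrt_le_sqrt
    gcongr
    linarith
  set γ := √(G / N) with hγd
  have hγ0 : 0 ≤ γ := Real.sqrt_nonneg _
  have hγ2 : γ ^ 2 = G / N := Real.sq_sqrt (by positivity)
  have he : 1 ≤ Real.exp 1 ^ 2 := one_le_pow₀ (Real.one_le_exp zero_le_one)
  have h1 : 8 * l * (q + 1) * γ ≤ 8 * l * (q + 1) * √(2 * G / N) := by gcongr
  have h2 : (32 * q ^ 3 + 4 * l * q) * g / N ≤
      (40 * Real.exp 1 ^ 2 * (q + l + 1) ^ 3 * g + 2) / N := by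
    have h3 : 32 * q ^ 3 + 4 * l * q ≤ 40 * Real.exp 1 ^ 2 * (q + l + 1) ^ 3 := by
      have h4 : 32 * q ^ 3 + 4 * l * q ≤ 40 * (q + l + 1) ^ 3 := by
        have e : 40 * (q + l + 1) ^ 3 - (32 * q ^ 3 + 4 * l * q) = 8 * q ^ 3 + 236 * (l * q) +
            40 * (l ^ 3 + 1 + 3 * q ^ 2 * l + 3 * q ^ 2 + 3 * l ^ 2 * q + 3 * l ^ 2 + 3 * q +
              3 * l) := by ring
        have : 0 ≤ 8 * q ^ 3 + 236 * (l * q) +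
            40 * (l ^ 3 + 1 + 3 * q ^ 2 * l + 3 * q ^ 2 + 3 * l ^ 2 * q + 3 * l ^ 2 + 3 * q +
              3 * l) := by positivity
        linarith
      refine h4.trans ?_
      have : 0 ≤ (q + l + 1) ^ 3 := by positivity
      nlinarith
    have := mul_le_mul_of_nonneg_right h3 hg
    gcongr
    linarith
  have h5 : 0 ≤ (40 * Real.exp 1 ^ 2 * (q + l + 1) ^ 3 * g + 2) / N := by positivity
  -- If ℓγ > 1, the claimed bound exceeds 1. Otherwise (ℓ+1)γ ≤ 2ℓγ ≤ 2 for ℓ ≥ 1, so the quadratic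
  -- term 4ℓ(ℓ+1)γ² is at most 8ℓγ: this is the +1 in q + 1.
  rcases le_or_gt (l * γ) 1 with h | h
  · refine le_trans ?_ (add_le_add h1 h2)
    have e : 32 * q ^ 3 * g / N + l * (4 * (G + (l * G + q * g)) / N) + 2 * (l * (q * (4 * γ))) =
        4 * l * (l + 1) * (G / N) + 8 * l * q * γ + (32 * q ^ 3 + 4 * l * q) * g / N := by ring
    rw [e, ← hγ2] at hR
    have h6 : 4 * l * (l + 1) * γ ^ 2 ≤ 8 * l * γ := by
      rcases hl1 with rfl | hl1
      · simp
      · have : (l + 1) * γ ≤ 2 := by nlinarith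
        calc 4 * l * (l + 1) * γ ^ 2 = 4 * l * γ * ((l + 1) * γ) := by ring
          _ ≤ 4 * l * γ * 2 := by gcongr
          _ = _ := by ring
    linarith
  · have : 0 ≤ q * (l * γ) := by positivity
    nlinarith

end Openings

end

end QROM

theorem mainTheorem5 {X T E W : Type*} [Fintype X] [LinearOrder X] [Fintype T] [DecidableEq T]
    [Fintype E] [DecidableEq E] [Fintype W] [DecidableEq W] (n ℓ q : ℕ)
    (f : X → QROM.Bits n → T) (A : QROM.Algorithm X n T E W ℓ q) :
    QROM.traceDist (QROM.realState A).density (QROM.simState f A).forgetExtracted.density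
        ≤ 8 * ℓ * (q + ℓ) * √(2 * QROM.Gam f / 2 ^ n) ∧
      (QROM.simState f A).prob
          (fun (t, xhat, x, h) => ∃ i, x i ≠ xhat i ∧ QROM.Opens f (x i) (h i) (t i))
        ≤ 8 * ℓ * (q + 1) * √(2 * QROM.Gam f / 2 ^ n) +
          (40 * Real.exp 1 ^ 2 * (q + ℓ + 1) ^ 3 * QROM.Gam' f + 2) / 2 ^ n := by
  constructor
  · refine (QROM.traceDist_realState_simState_le f A).trans ?_
    -- The argument gives 4 and √(Γ/2^n) in place of 8 and √(2Γ/2^n).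
    have : √((QROM.Gam f : ℝ) / 2 ^ n) ≤ √(2 * QROM.Gam f / 2 ^ n) := by
      apply Real.sqrt_le_sqrt
      gcongr
      have : (0 : ℝ) ≤ QROM.Gam f := Nat.cast_nonneg _
      linarith
    gcongr
    norm_num
  · obtain ⟨h1, h2⟩ := QROM.prob_badOpening_le f A
    refine QROM.opening_bound_numeric (Nat.cast_nonneg _) (Nat.cast_nonneg _) (Nat.cast_nonneg _)
      (Nat.cast_nonneg _) (by positivity) ?_ h1 h2
    rcases Nat.eq_zero_or_pos ℓ with h | h
    · exact Or.inl (by exact_mod_cast h)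
    · exact Or.inr (by exact_mod_cast h)
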